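/- Conventions. An \emph{object} in $\mathbb R^d$ is a nonempty bounded subset of $\mathbb R^d$. The \emph{side length} of an object is the maximum side length of its axis-aligned bounding box. A family of objects is \emph{fat with constant $c$} if for every axis-aligned hypercube $\gamma$ of side length $r>0$, the objects of the family that intersect $\gamma$ and have side length at least $r$ can be stabbed by at most $c$ points (each of these objects contains at least one of the points). The \emph{intersection graph} of a family $S_1,\dots,S_n$ has vertices $1,\dots,n$, and $i\ne j$ are adjacent iff $S_i\cap S_j\neq\emptyset$. Computational model. A real RAM, with memory consisting of finitely many arrays of natural numbers and of real numbers (initially $0$, except that $n$ is given), on which the following operations take unit time: reading and writing array cells; constants, addition, truncated subtraction and comparison of natural numbers; rational constants, addition, subtraction, multiplication by a fixed rational number, and comparison of real numbers; the two quadtree operations on real numbers: (i) given $x,y$, the length of the smallest dyadic interval $[i2^j,(i+1)2^j)$ ($i,j\in\mathbb Z$) containing $x$ and $y$ ($0$ if $x=y$ or if there is no such interval), and (ii) given $x$ and $r>0$, the left endpoint of the dyadic interval containing $x$ whose length is the least power of two that is at least $r$; and the following access to the input objects: the two ends of the bounding box of an object along a coordinate axis, the test whether two objects intersect, and the test whether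 an object intersects a given closed axis-aligned hypercube. Programs are built from assignments by sequencing, conditionals and while-loops. Theorem. Let $d$, $k$, $c$ be constants and let $X$ be a graph with $k$ vertices. There is a program that, given any $n$ objects in $\mathbb R^d$ forming a family that is fat with constant $c$, decides in $O(n\log n)$ time (with the hidden constant depending only on $d$, $k$, $c$, $X$) whether $X$ is a (not necessarily induced) subgraph of the intersection graph of the objects, and, if so, reports one occurrence, that is, an injective map from the vertices of $X$ to the objects taking each edge of $X$ to an intersecting pair of objects. -/

import Mathlib

noncomputable section

namespace FatSubgraph

/-! ### Objects, fatness, intersection graphs -/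

/-- Left end of the extent of `s` along axis `i`. -/
def lower {d : ℕ} (s : Set (Fin d → ℝ)) (i : Fin d) : ℝ := sInf ((fun x => x i) '' s)

/-- Right end of the extent of `s` along axis `i`. -/
def upper {d : ℕ} (s : Set (Fin d → ℝ)) (i : Fin d) : ℝ := sSup ((fun x => x i) '' s)

/-- The side length of an object: the maximum side length of its axis-aligned bounding box. -/
def sideLength {d : ℕ} (s : Set (Fin d → ℝ)) : ℝ := ⨆ i, (upper s i - lower s i)

/-- The axis-aligned closed hypercube with lower corner `a` and side length `r`. -/
def cube {d : ℕ} (a : Fin d → ℝ) (r : ℝ) : Set (Fin d → ℝ) :=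
  {x | ∀ i, a i ≤ x i ∧ x i ≤ a i + r}

/-- An object is a nonempty bounded set; nothing else (convexity, connectedness, closedness)
is required. -/
def IsObject {d : ℕ} (s : Set (Fin d → ℝ)) : Prop := s.Nonempty ∧ Bornology.IsBounded s

/-- A family is fat with constant `c` if, for every hypercube of side length `r`, the objects of
side length at least `r` that meet the hypercube can be stabbed by at most `c` points. -/
def IsFat {d n : ℕ} (c : ℕ) (S : Fin n → Set (Fin d → ℝ)) : Prop :=
  ∀ (a : Fin d → ℝ) (r : ℝ), 0 < r → ∃ P : Finset (Fin d → ℝ), P.card ≤ c ∧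
    ∀ j, (S j ∩ cube a r).Nonempty → r ≤ sideLength (S j) → ∃ p ∈ P, p ∈ S j

/-- The intersection graph: the vertices are the (indices of the) objects, and two different ones
are adjacent iff the objects intersect. -/
def intersectionGraph {d n : ℕ} (S : Fin n → Set (Fin d → ℝ)) : SimpleGraph (Fin n) where
  Adj i j := i ≠ j ∧ (S i ∩ S j).Nonempty
  symm := ⟨fun _ _ h => ⟨h.1.symm, by rw [Set.inter_comm]; exact h.2⟩⟩
  loopless := ⟨fun _ h => h.1 rfl⟩

/-! ### The two quadtree primitives on real numbers -/

/-- The side length of the smallest dyadic interval `[i 2^j, (i+1) 2^j)` that contains `x` and `y`.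
It is `0` when `x = y`, and also when there is no such interval (which happens only when one of the
numbers is negative and the other one is not). -/
def dyadicSide (x y : ℝ) : ℝ :=
  sInf {s | ∃ i j : ℤ, s = (2 : ℝ) ^ j ∧
    x ∈ Set.Ico ((i : ℝ) * 2 ^ j) (((i : ℝ) + 1) * 2 ^ j) ∧
    y ∈ Set.Ico ((i : ℝ) * 2 ^ j) (((i : ℝ) + 1) * 2 ^ j)}

/-- The left endpoint of the dyadic interval that contains `x` and whose length is the least power
of two that is at least `r` (for `r > 0`; the length is `1` when `r ≤ 0`). -/
def dyadicFloor (x r : ℝ) : ℝ := (⌊x / (2 : ℝ) ^ Int.clog 2 r⌋ : ℝ) * (2 : ℝ) ^ Int.clog 2 r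

/-! ### The machine: a real RAM, with structured control flow

The memory consists of arrays of natural numbers and arrays of real numbers; the name of an array
is a literal of the program, so that a program uses only finitely many arrays, while positions in
arrays are computed. The input objects can be accessed only through the extents of their bounding
boxes, the test whether two objects intersect, and the test whether an object meets a hypercube. -/

/-- Expressions for natural numbers: literals, array cells, sum, truncated difference. -/
inductive NExp : Type
  | lit (m : ℕ)
  | get (a : ℕ) (i : NExp)
  | add (e f : NExp)
  | sub (e f : NExp)

/-- Expressions for real numbers: rational literals, array cells, sum, difference, multiplication
by a rational literal, the two quadtree primitives, and the two ends of the extent of the object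
with a given index along a given axis. General multiplication, division, and conversions between
real and natural numbers are not available. -/
inductive RExp (d : ℕ) : Type
  | lit (q : ℚ)
  | get (a : ℕ) (i : NExp)
  | add (e f : RExp d)
  | sub (e f : RExp d)
  | scale (q : ℚ) (e : RExp d)
  | dyadicSide (e f : RExp d)
  | dyadicFloor (e f : RExp d)
  | lower (o : NExp) (axis : Fin d)
  | upper (o : NExp) (axis : Fin d)

/-- Tests: comparisons, intersection of two input objects, intersection of an input object with
the hypercube of given lower corner and side length, and Boolean combinations. -/
inductive BExp (d : ℕ) : Type
  | natLe (e f : NExp)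
  | realLe (e f : RExp d)
  | meets (o p : NExp)
  | meetsCube (o : NExp) (corner : Fin d → RExp d) (side : RExp d)
  | not (b : BExp d)
  | and (b c : BExp d)

/-- Programs. -/
inductive Prog (d : ℕ) : Type
  | skip
  | setNat (a : ℕ) (i e : NExp)
  | setReal (a : ℕ) (i : NExp) (e : RExp d)
  | seq (p q : Prog d)
  | ite (b : BExp d) (p q : Prog d)
  | loop (b : BExp d) (p : Prog d)

/-- Contents of the memory: `nat a i` and `real a i` are the `i`-th cells of the `a`-th array of
natural numbers, respectively of real numbers. -/
@[ext] structure Memory : Type where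
  nat : ℕ → ℕ → ℕ
  real : ℕ → ℕ → ℝ

/-- `v[a][i] := x`. -/
def update {α : Type} (v : ℕ → ℕ → α) (a i : ℕ) (x : α) : ℕ → ℕ → α :=
  Function.update v a (Function.update (v a) i x)

/-- The initial memory for an input of `n` objects: cell `0` of the natural-number array `0` holds
`n`, everything else is `0`. -/
def initial (n : ℕ) : Memory where
  nat := update (fun _ _ => 0) 0 0 n
  real := fun _ _ => 0

/-- Value of an expression for natural numbers. -/
def NExp.val (m : Memory) : NExp → ℕ
  | lit k => k
  | get a i => m.nat a (i.val m)
  | add e f => e.val m + f.val m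
  | sub e f => e.val m - f.val m

/-- Value of an expression for real numbers; extents of nonexistent objects read as `0`. -/
def RExp.val {d n : ℕ} (S : Fin n → Set (Fin d → ℝ)) (m : Memory) : RExp d → ℝ
  | lit q => q
  | get a i => m.real a (i.val m)
  | add e f => e.val S m + f.val S m
  | sub e f => e.val S m - f.val S m
  | scale q e => q * e.val S m
  | dyadicSide e f => FatSubgraph.dyadicSide (e.val S m) (f.val S m)
  | dyadicFloor e f => FatSubgraph.dyadicFloor (e.val S m) (f.val S m)
  | lower o i => if h : o.val m < n then FatSubgraph.lower (S ⟨o.val m, h⟩) i else 0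
  | upper o i => if h : o.val m < n then FatSubgraph.upper (S ⟨o.val m, h⟩) i else 0

/-- Truth of a test; tests on nonexistent objects fail. -/
def BExp.Holds {d n : ℕ} (S : Fin n → Set (Fin d → ℝ)) (m : Memory) : BExp d → Prop
  | natLe e f => e.val m ≤ f.val m
  | realLe e f => e.val S m ≤ f.val S m
  | meets o p => ∃ (h : o.val m < n) (h' : p.val m < n),
      (S ⟨o.val m, h⟩ ∩ S ⟨p.val m, h'⟩).Nonempty
  | meetsCube o a r => ∃ h : o.val m < n,
      (S ⟨o.val m, h⟩ ∩ cube (fun i => (a i).val S m) (r.val S m)).Nonempty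
  | not b => ¬ b.Holds S m
  | and b c => b.Holds S m ∧ c.Holds S m

/-- Number of primitive operations in the evaluation of an expression. -/
def NExp.cost : NExp → ℕ
  | lit _ => 1
  | get _ i => i.cost + 1
  | add e f => e.cost + f.cost + 1
  | sub e f => e.cost + f.cost + 1

/-- Number of primitive operations in the evaluation of an expression. -/
def RExp.cost {d : ℕ} : RExp d → ℕ
  | lit _ => 1
  | get _ i => i.cost + 1
  | add e f => e.cost + f.cost + 1
  | sub e f => e.cost + f.cost + 1
  | scale _ e => e.cost + 1
  | dyadicSide e f => e.cost + f.cost + 1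
  | dyadicFloor e f => e.cost + f.cost + 1
  | lower o _ => o.cost + 1
  | upper o _ => o.cost + 1

/-- Number of primitive operations in the evaluation of a test. -/
def BExp.cost {d : ℕ} : BExp d → ℕ
  | natLe e f => e.cost + f.cost + 1
  | realLe e f => e.cost + f.cost + 1
  | meets o p => o.cost + p.cost + 1
  | meetsCube o a r => o.cost + (∑ i, (a i).cost) + r.cost + 1
  | not b => b.cost + 1
  | and b c => b.cost + c.cost + 1

/-- `Runs S p m t m'`: on the input objects `S`, the program `p`, started with memory `m`, halts
after exactly `t` steps with memory `m'`. -/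
inductive Runs {d n : ℕ} (S : Fin n → Set (Fin d → ℝ)) :
    Prog d → Memory → ℕ → Memory → Prop
  | skip (m : Memory) : Runs S Prog.skip m 1 m
  | setNat (a : ℕ) (i e : NExp) (m : Memory) :
      Runs S (Prog.setNat a i e) m (i.cost + e.cost + 1)
        { m with nat := update m.nat a (i.val m) (e.val m) }
  | setReal (a : ℕ) (i : NExp) (e : RExp d) (m : Memory) :
      Runs S (Prog.setReal a i e) m (i.cost + e.cost + 1)
        { m with real := update m.real a (i.val m) (e.val S m) }
  | seq {p q : Prog d} {m m' m'' : Memory} {t t' : ℕ} :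
      Runs S p m t m' → Runs S q m' t' m'' → Runs S (Prog.seq p q) m (t + t') m''
  | iteTrue {b : BExp d} {p q : Prog d} {m m' : Memory} {t : ℕ} :
      b.Holds S m → Runs S p m t m' → Runs S (Prog.ite b p q) m (b.cost + t + 1) m'
  | iteFalse {b : BExp d} {p q : Prog d} {m m' : Memory} {t : ℕ} :
      ¬ b.Holds S m → Runs S q m t m' → Runs S (Prog.ite b p q) m (b.cost + t + 1) m'
  | loopDone {b : BExp d} {p : Prog d} {m : Memory} :
      ¬ b.Holds S m → Runs S (Prog.loop b p) m (b.cost + 1) m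
  | loopStep {b : BExp d} {p : Prog d} {m m' m'' : Memory} {t t' : ℕ} :
      b.Holds S m → Runs S p m t m' → Runs S (Prog.loop b p) m' t' m'' →
      Runs S (Prog.loop b p) m (b.cost + t + t' + 1) m''

/-- The machine is deterministic: running time and final memory are unique. -/
theorem Runs.unique {d n : ℕ} {S : Fin n → Set (Fin d → ℝ)} {p : Prog d} {m m₁ m₂ : Memory}
    {t₁ t₂ : ℕ} (h₁ : Runs S p m t₁ m₁) (h₂ : Runs S p m t₂ m₂) : t₁ = t₂ ∧ m₁ = m₂ := by
  induction h₁ generalizing t₂ m₂ with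
  | skip => cases h₂; exact ⟨rfl, rfl⟩
  | setNat => cases h₂; exact ⟨rfl, rfl⟩
  | setReal => cases h₂; exact ⟨rfl, rfl⟩
  | seq _ _ ih ih' =>
    cases h₂ with
    | seq k k' =>
      obtain ⟨rfl, rfl⟩ := ih k
      obtain ⟨rfl, rfl⟩ := ih' k'
      exact ⟨rfl, rfl⟩
  | iteTrue hb _ ih =>
    cases h₂ with
    | iteTrue _ k => obtain ⟨rfl, rfl⟩ := ih k; exact ⟨rfl, rfl⟩
    | iteFalse hb' _ => exact absurd hb hb'
  | iteFalse hb _ ih =>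
    cases h₂ with
    | iteTrue hb' _ => exact absurd hb' hb
    | iteFalse _ k => obtain ⟨rfl, rfl⟩ := ih k; exact ⟨rfl, rfl⟩
  | loopDone hb =>
    cases h₂ with
    | loopDone => exact ⟨rfl, rfl⟩
    | loopStep hb' => exact absurd hb' hb
  | loopStep hb _ _ ih ih' =>
    cases h₂ with
    | loopDone hb' => exact absurd hb hb'
    | loopStep _ k k' =>
      obtain ⟨rfl, rfl⟩ := ih k
      obtain ⟨rfl, rfl⟩ := ih' k'
      exact ⟨rfl, rfl⟩

/-- The final memory `m` is a correct answer to the question whether `X` is a (not necessarily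
induced) subgraph of `G`: cell `0` of the natural-number array `0` holds `1` if it is and `0` if it
is not, and if it is, the first `k` cells of the natural-number array `1` hold the images of the
vertices of `X` under an injective map that takes edges of `X` to edges of `G`. -/
def Answers {k n : ℕ} (X : SimpleGraph (Fin k)) (G : SimpleGraph (Fin n)) (m : Memory) : Prop :=
  (X.IsContained G ∧ m.nat 0 0 = 1 ∧
    ∃ f : SimpleGraph.Copy X G, ∀ v : Fin k, m.nat 1 v = f v) ∨
  (¬ X.IsContained G ∧ m.nat 0 0 = 0)

end FatSubgraph

end

/-! ### Cost semantics: loop-free programs and total-correctness rules with time bounds. -/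

noncomputable section

namespace FatSubgraph

/-! The algorithm is a sweep over shifted quadtrees. Put `K = 2kd + 1`. An object of positive width
`w` is assigned a dyadic cell whose side is a power of two in `(2Kw, 4Kw]`, namely the cell
containing the lower corner of its bounding box after a translation; an object of width `0` gets a
cell of side `0`. The object is good for the translation if it fits into its cell. The `K`
translations are by `j/K * W - m₀`, with `W` a power of two exceeding the extent of the input. Since
`K` is odd and cells are more than `2K` times wider than their objects, a given object fails along a
given axis for at most one `j` (`not_fits_unique`). An occurrence of `X` involves `k` objects and
`d` axes, so some translation makes all of it good (`exists_shift_good`), and it suffices to search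
among the good objects of each translation.

For one translation, the good objects are sorted so that their cells appear in depth-first preorder
of the quadtree: Z-order of the corners, larger cells first. Two good objects that intersect share a
point of their cells, so one cell contains the other (`CellLe.anc`), and the descendants of a cell
form an interval of the order (`Anc.of_between`). A sweep therefore only maintains a stack of nested
cells, the path from the root to the current cell.

Fatness enters through `exists_common_point`. If more than a constant number of objects with cells
above a given cell meet that closed cell, then `k` of them share a point. They form a clique, and
any graph on `k` vertices occurs in it. So either the answer is found at once, or each stack level
has fewer than `b` objects on the stack meeting its cell; these are the only channel between the
subtree below that level and the rest of the stack.

When a level is popped, everything kept in its finished subtree is merged with what is kept one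
level below, and only a constant number of representatives survives. A partial embedding of `X` into
the merged objects matters to the outside only through its signature: which vertices are embedded,
and which of the `b` boundary objects each image meets. There are at most `(2^b + 1)^k` signatures,
and keeping the at most `k` objects of one partial embedding per signature suffices
(`exists_representatives`). Replacing part of an occurrence by the representative with the same
signature gives another occurrence; this exchange is the heart of `SweepInv.pop`. At the end
constantly many objects remain, and they are searched exhaustively.

Each object is pushed and popped at most once, at constant cost, so the sweep is linear and the
sorting dominates. The sort is a bottom-up merge sort, analysed with a potential (`sortPot`,
`reach_sortProg`). Correctness is first proved for abstract stacks (`SweepInv`) and then transferred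
to memory (`push_spec`, `pop_spec`, `reach_sweep`). -/

open Classical in
/-- Final memory of a loop-free program (loops are treated as `skip`). -/
def exec {d n : ℕ} (S : Fin n → Set (Fin d → ℝ)) : Prog d → Memory → Memory
  | .skip, m => m
  | .setNat a i e, m => { m with nat := update m.nat a (i.val m) (e.val m) }
  | .setReal a i e, m => { m with real := update m.real a (i.val m) (e.val S m) }
  | .seq p q, m => exec S q (exec S p m)
  | .ite b p q, m => if b.Holds S m then exec S p m else exec S q m
  | .loop _ _, m => m

/-- The program contains no loop. -/
def Prog.LoopFree {d : ℕ} : Prog d → Prop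
  | .skip => True
  | .setNat _ _ _ => True
  | .setReal _ _ _ => True
  | .seq p q => p.LoopFree ∧ q.LoopFree
  | .ite _ p q => p.LoopFree ∧ q.LoopFree
  | .loop _ _ => False

/-- A bound on the running time of a loop-free program. -/
def Prog.bound {d : ℕ} : Prog d → ℕ
  | .skip => 1
  | .setNat _ i e => i.cost + e.cost + 1
  | .setReal _ i e => i.cost + e.cost + 1
  | .seq p q => p.bound + q.bound
  | .ite b p q => b.cost + (p.bound + q.bound) + 1
  | .loop _ _ => 0

/-- Started in `m`, the program `p` halts within `T` steps in a memory that satisfies `Q`. -/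
def Reach {d n : ℕ} (S : Fin n → Set (Fin d → ℝ)) (p : Prog d) (m : Memory) (T : ℕ)
    (Q : Memory → Prop) : Prop :=
  ∃ (t : ℕ) (m' : Memory), t ≤ T ∧ Runs S p m t m' ∧ Q m'

section Framework

variable {d n : ℕ} {S : Fin n → Set (Fin d → ℝ)}

theorem Prog.LoopFree.runs {p : Prog d} (hp : p.LoopFree) (m : Memory) :
    ∃ t ≤ p.bound, Runs S p m t (exec S p m) := by
  induction p generalizing m with
  | skip => exact ⟨_, le_rfl, Runs.skip m⟩
  | setNat a i e => exact ⟨_, le_rfl, Runs.setNat a i e m⟩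
  | setReal a i e => exact ⟨_, le_rfl, Runs.setReal a i e m⟩
  | seq p q ihp ihq =>
    obtain ⟨t, ht, h⟩ := ihp hp.1 m
    obtain ⟨t', ht', h'⟩ := ihq hp.2 (exec S p m)
    exact ⟨t + t', Nat.add_le_add ht ht', Runs.seq h h'⟩
  | ite b p q ihp ihq =>
    by_cases hb : b.Holds S m
    · obtain ⟨t, ht, h⟩ := ihp hp.1 m
      refine ⟨b.cost + t + 1, ?_, ?_⟩
      · simp only [Prog.bound]; omega
      · simp only [exec, if_pos hb]; exact Runs.iteTrue hb h
    · obtain ⟨t, ht, h⟩ := ihq hp.2 m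
      refine ⟨b.cost + t + 1, ?_, ?_⟩
      · simp only [Prog.bound]; omega
      · simp only [exec, if_neg hb]; exact Runs.iteFalse hb h
  | loop b p => exact hp.elim

theorem Prog.LoopFree.reach {p : Prog d} (hp : p.LoopFree) {m : Memory} {T : ℕ}
    (hT : p.bound ≤ T) {Q : Memory → Prop} (hQ : Q (exec S p m)) : Reach S p m T Q := by
  obtain ⟨t, ht, h⟩ := hp.runs (S := S) m
  exact ⟨t, _, ht.trans hT, h, hQ⟩

theorem Reach.mono {p : Prog d} {m : Memory} {T T' : ℕ} {Q Q' : Memory → Prop}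
    (h : Reach S p m T Q) (hT : T ≤ T') (hQ : ∀ m', Q m' → Q' m') : Reach S p m T' Q' := by
  obtain ⟨t, m', ht, hr, hq⟩ := h
  exact ⟨t, m', ht.trans hT, hr, hQ _ hq⟩

theorem Reach.seq {p q : Prog d} {m : Memory} {T T' : ℕ} {Q Q' : Memory → Prop}
    (h : Reach S p m T Q) (h' : ∀ m', Q m' → Reach S q m' T' Q') :
    Reach S (.seq p q) m (T + T') Q' := by
  obtain ⟨t, m', ht, hr, hq⟩ := h
  obtain ⟨t', m'', ht', hr', hq'⟩ := h' m' hq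
  exact ⟨_, _, Nat.add_le_add ht ht', Runs.seq hr hr', hq'⟩

theorem Reach.ite {b : BExp d} {p q : Prog d} {m : Memory} {T : ℕ} {Q : Memory → Prop}
    (h : b.Holds S m → Reach S p m T Q) (h' : ¬ b.Holds S m → Reach S q m T Q) :
    Reach S (.ite b p q) m (b.cost + T + 1) Q := by
  by_cases hb : b.Holds S m
  · obtain ⟨t, m', ht, hr, hq⟩ := h hb
    exact ⟨_, m', by omega, Runs.iteTrue hb hr, hq⟩
  · obtain ⟨t, m', ht, hr, hq⟩ := h' hb
    exact ⟨_, m', by omega, Runs.iteFalse hb hr, hq⟩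

/-- Loop rule: `I w m` says that the loop may be entered with memory `m` and `w` steps left. -/
theorem Reach.loop {b : BExp d} {p : Prog d} {Q : Memory → Prop} (I : ℕ → Memory → Prop)
    (hstep : ∀ w m, I w m → b.Holds S m → ∃ T, Reach S p m T
      fun m' => ∃ w', I w' m' ∧ b.cost + T + w' + 1 ≤ w)
    (hdone : ∀ w m, I w m → ¬ b.Holds S m → b.cost + 1 ≤ w ∧ Q m) :
    ∀ w m, I w m → Reach S (.loop b p) m w Q := by
  intro w
  induction w using Nat.strong_induction_on with
  | _ w ih =>
    intro m hI
    by_cases hb : b.Holds S m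
    · obtain ⟨T, t, m', ht, hr, w', hI', hw⟩ := hstep w m hI hb
      obtain ⟨t', m'', ht', hr', hq⟩ := ih w' (by omega) m' hI'
      exact ⟨_, m'', by omega, Runs.loopStep hb hr hr', hq⟩
    · obtain ⟨hw, hq⟩ := hdone w m hI hb
      exact ⟨_, m, hw, Runs.loopDone hb, hq⟩

/-- Loop rule for loop-free bodies, with a measure that decreases in each round. -/
theorem Reach.loop_measure {b : BExp d} {p : Prog d} (hp : p.LoopFree) (I : Memory → Prop)
    (φ : Memory → ℕ)
    (hstep : ∀ m, I m → b.Holds S m → I (exec S p m) ∧ φ (exec S p m) < φ m)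
    {m : Memory} (hm : I m) {T : ℕ} (hT : (b.cost + p.bound + 1) * (φ m + 1) ≤ T) :
    Reach S (.loop b p) m T fun m' => I m' ∧ ¬ b.Holds S m' := by
  refine Reach.mono (Reach.loop (fun w m => I m ∧ (b.cost + p.bound + 1) * (φ m + 1) ≤ w)
    ?_ ?_ T m ⟨hm, hT⟩) le_rfl fun _ h => h
  · rintro w m ⟨hI, hw⟩ hb
    obtain ⟨hI', hφ⟩ := hstep m hI hb
    refine ⟨p.bound, hp.reach le_rfl ⟨_, ⟨hI', le_rfl⟩, ?_⟩⟩
    refine le_trans ?_ hw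
    -- The budget allows `φ + 1` rounds of cost `b.cost + p.bound + 1`; the extra round pays for the
    -- final failing test.
    have : (b.cost + p.bound + 1) * (φ (exec S p m) + 1 + 1)
        ≤ (b.cost + p.bound + 1) * (φ m + 1) := Nat.mul_le_mul_left _ (by omega)
    rw [Nat.mul_add _ _ 1] at this
    omega
  · rintro w m ⟨hI, hw⟩ hb
    refine ⟨le_trans ?_ hw, hI, hb⟩
    calc b.cost + 1 ≤ (b.cost + p.bound + 1) * 1 := by omega
      _ ≤ _ := Nat.mul_le_mul_left _ (by omega)

end Framework

theorem update_apply {α : Type} (v : ℕ → ℕ → α) (a i : ℕ) (x : α) (b j : ℕ) :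
    update v a i x b j = if b = a ∧ j = i then x else v b j := by
  unfold update
  by_cases hb : b = a
  · subst hb
    by_cases hj : j = i
    · subst hj; simp
    · simp [hj]
  · simp [hb]

/-! ### Program combinators -/

/-- The scalar variable stored in cell `0` of array `a`. -/
abbrev NExp.var (a : ℕ) : NExp := .get a (.lit 0)

/-- The real scalar variable stored in cell `0` of array `a`. -/
abbrev RExp.var {d : ℕ} (a : ℕ) : RExp d := .get a (.lit 0)

namespace BExp

variable {d : ℕ}

/-- The test that always holds. -/
def tt : BExp d := natLe (.lit 0) (.lit 0)

/-- Disjunction. -/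
def or (b c : BExp d) : BExp d := not (and (not b) (not c))

/-- Conjunction over a list. -/
def all {ι : Type} (l : List ι) (f : ι → BExp d) : BExp d := l.foldr (fun i b => and (f i) b) tt

/-- Disjunction over a list. -/
def any {ι : Type} (l : List ι) (f : ι → BExp d) : BExp d := not (all l fun i => not (f i))

/-- Strict comparison of reals. -/
def realLt (e f : RExp d) : BExp d := not (realLe f e)

/-- Strict comparison of natural numbers. -/
def natLt (e f : NExp) : BExp d := not (natLe f e)

variable {n : ℕ} (S : Fin n → Set (Fin d → ℝ)) (m : Memory)

@[simp] theorem holds_tt : (tt : BExp d).Holds S m := by simp [tt, Holds]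

@[simp] theorem holds_or (b c : BExp d) : (or b c).Holds S m ↔ b.Holds S m ∨ c.Holds S m := by
  simp only [or, Holds]; tauto

@[simp] theorem holds_all {ι : Type} (l : List ι) (f : ι → BExp d) :
    (all l f).Holds S m ↔ ∀ i ∈ l, (f i).Holds S m := by
  induction l with
  | nil => simp [all]
  | cons i l ih =>
    have : (all (i :: l) f).Holds S m ↔ (f i).Holds S m ∧ (all l f).Holds S m := Iff.rfl
    rw [this, ih]; simp

@[simp] theorem holds_any {ι : Type} (l : List ι) (f : ι → BExp d) :
    (any l f).Holds S m ↔ ∃ i ∈ l, (f i).Holds S m := by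
  simp [any, Holds]

@[simp] theorem holds_realLt (e f : RExp d) :
    (realLt e f).Holds S m ↔ e.val S m < f.val S m := by
  simp [realLt, Holds]

@[simp] theorem holds_natLt (e f : NExp) :
    (natLt e f : BExp d).Holds S m ↔ e.val m < f.val m := by
  simp [natLt, Holds]

end BExp

section Combinators

variable {d : ℕ}

/-- Sequential composition of a list of programs. -/
def seqs : List (Prog d) → Prog d
  | [] => .skip
  | p :: l => .seq p (seqs l)

theorem loopFree_seqs {l : List (Prog d)} (h : ∀ p ∈ l, p.LoopFree) : (seqs l).LoopFree := by
  induction l with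
  | nil => trivial
  | cons p l ih =>
    exact ⟨h p (by simp), ih fun q hq => h q (by simp [hq])⟩

/-- Decision tree: evaluates the tests `f i`, `i ∈ l`, and runs the program chosen by the
outcomes. -/
def branchOn {ι : Type} [DecidableEq ι] (f : ι → BExp d) :
    List ι → ((ι → Prop) → Prog d) → Prog d
  | [], P => P fun _ => False
  | i :: l, P => .ite (f i) (branchOn f l fun τ => P (Function.update τ i True))
      (branchOn f l fun τ => P (Function.update τ i False))

theorem loopFree_branchOn {ι : Type} [DecidableEq ι] {f : ι → BExp d} {l : List ι}
    {P : (ι → Prop) → Prog d} (h : ∀ τ, (P τ).LoopFree) : (branchOn f l P).LoopFree := by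
  induction l generalizing P with
  | nil => exact h _
  | cons i l ih => exact ⟨ih fun τ => h _, ih fun τ => h _⟩

variable {n : ℕ} (S : Fin n → Set (Fin d → ℝ))

/-- All tests are evaluated before a leaf is reached, and the leaf program is chosen as an arbitrary
function of the outcomes when the program is built. Thus any finite combinatorial choice, even a
noncomputable one, becomes a constant-size decision tree. -/
theorem exec_branchOn {ι : Type} [DecidableEq ι] (f : ι → BExp d) (l : List ι)
    (P : (ι → Prop) → Prog d) (m : Memory) :
    exec S (branchOn f l P) m = exec S (P fun i => i ∈ l ∧ (f i).Holds S m) m := by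
  induction l generalizing P with
  | nil => simp [branchOn]
  | cons i l ih =>
    simp only [branchOn, exec]
    by_cases hb : (f i).Holds S m
    · rw [if_pos hb, ih]
      congr 2
      funext j
      by_cases hj : j = i
      · subst hj; simp [hb]
      · simp [hj]
    · rw [if_neg hb, ih]
      congr 2
      funext j
      by_cases hj : j = i
      · subst hj; simp [hb]
      · simp [hj]

/-- Decision tree over all tests of a finite family. -/
def branch {ι : Type} [DecidableEq ι] [Fintype ι] (f : ι → BExp d)
    (P : (ι → Prop) → Prog d) : Prog d :=
  branchOn f (Finset.univ : Finset ι).toList P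

theorem loopFree_branch {ι : Type} [DecidableEq ι] [Fintype ι] {f : ι → BExp d}
    {P : (ι → Prop) → Prog d} (h : ∀ τ, (P τ).LoopFree) : (branch f P).LoopFree :=
  loopFree_branchOn h

theorem exec_branch {ι : Type} [DecidableEq ι] [Fintype ι] (f : ι → BExp d)
    (P : (ι → Prop) → Prog d) (m : Memory) :
    exec S (branch f P) m = exec S (P fun i => (f i).Holds S m) m := by
  rw [branch, exec_branchOn]
  simp

/-- Assignments `cell (arr q) (idx q) := e q` for all `q` in a finite type. -/
def assignNats {ι : Type} [Fintype ι] (arr : ι → ℕ) (idx e : ι → NExp) : Prog d :=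
  seqs ((Finset.univ : Finset ι).toList.map fun q => .setNat (arr q) (idx q) (e q))

theorem loopFree_assignNats {ι : Type} [Fintype ι] (arr : ι → ℕ) (idx e : ι → NExp) :
    (assignNats arr idx e : Prog d).LoopFree :=
  loopFree_seqs fun p hp => by
    obtain ⟨q, -, rfl⟩ := List.mem_map.1 hp
    trivial

/-- The assignments act as a simultaneous one: targets are distinct by `hinj`, and by `hst` neither
indices nor right-hand sides change while only target cells are overwritten. The induction
generalises the start memory to one that agrees with `m` off the targets. -/
theorem exec_assignNats {ι : Type} [Fintype ι] (arr : ι → ℕ) (idx e : ι → NExp) (m : Memory)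
    (hinj : Function.Injective fun q => (arr q, (idx q).val m))
    (hst : ∀ m' : Memory, m'.real = m.real →
      (∀ a j, (∀ q, ¬ (a = arr q ∧ j = (idx q).val m)) → m'.nat a j = m.nat a j) →
      ∀ q, (idx q).val m' = (idx q).val m ∧ (e q).val m' = (e q).val m) :
    (exec S (assignNats arr idx e) m).real = m.real ∧
    (∀ q, (exec S (assignNats arr idx e) m).nat (arr q) ((idx q).val m) = (e q).val m) ∧
    (∀ a j, (∀ q, ¬ (a = arr q ∧ j = (idx q).val m)) →
      (exec S (assignNats arr idx e) m).nat a j = m.nat a j) := by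
  suffices H : ∀ (l : List ι) (m' : Memory), l.Nodup → m'.real = m.real →
      (∀ a j, (∀ q, ¬ (a = arr q ∧ j = (idx q).val m)) → m'.nat a j = m.nat a j) →
      (exec S (seqs (l.map fun q => .setNat (arr q) (idx q) (e q))) m').real = m.real ∧
      (∀ q, q ∈ l → (exec S (seqs (l.map fun q => .setNat (arr q) (idx q) (e q))) m').nat
        (arr q) ((idx q).val m) = (e q).val m) ∧
      (∀ a j, (∀ q ∈ l, ¬ (a = arr q ∧ j = (idx q).val m)) →
        (exec S (seqs (l.map fun q => .setNat (arr q) (idx q) (e q))) m').nat a j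
          = m'.nat a j) by
    obtain ⟨h1, h2, h3⟩ := H _ m (Finset.nodup_toList Finset.univ) rfl fun _ _ _ => rfl
    exact ⟨h1, fun q => h2 q (by simp), fun a j h => h3 a j fun q _ => h q⟩
  intro l
  induction l with
  | nil => intro m' _ hr _; exact ⟨hr, by simp, fun _ _ _ => rfl⟩
  | cons q l ih =>
    intro m' hnd hr hag
    rw [List.nodup_cons] at hnd
    simp only [List.map_cons, seqs, exec]
    have hq := hst m' hr hag q
    set m1 : Memory := { m' with nat := update m'.nat (arr q) ((idx q).val m') ((e q).val m') }
      with hm1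
    have hag1 : ∀ a j, (∀ q, ¬ (a = arr q ∧ j = (idx q).val m)) → m1.nat a j = m.nat a j := by
      intro a j h
      rw [hm1]
      simp only [update_apply, hq.1]
      rw [if_neg (h q), hag a j h]
    obtain ⟨h1, h2, h3⟩ := ih m1 hnd.2 hr hag1
    refine ⟨h1, ?_, ?_⟩
    · intro q' hq'
      rcases List.mem_cons.1 hq' with rfl | hq'
      · rw [h3]
        · simp [hm1, update_apply, hq]
        · rintro r hr ⟨e1, e2⟩
          have : q' = r := hinj (by simp only [e1, e2])
          exact hnd.1 (this ▸ hr)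
      · exact h2 q' hq'
    · intro a j h
      rw [h3 a j fun r hr => h r (by simp [hr])]
      have := h q (by simp)
      simp only [hm1, update_apply, hq.1, if_neg this]

/-- Assignments `cell (arr q) idx := e q` of reals for all `q` in a finite type. -/
def assignReals {ι : Type} [Fintype ι] (arr : ι → ℕ) (idx : NExp) (e : ι → RExp d) : Prog d :=
  seqs ((Finset.univ : Finset ι).toList.map fun q => .setReal (arr q) idx (e q))

theorem loopFree_assignReals {ι : Type} [Fintype ι] (arr : ι → ℕ) (idx : NExp)
    (e : ι → RExp d) : (assignReals arr idx e : Prog d).LoopFree :=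
  loopFree_seqs fun p hp => by
    obtain ⟨q, -, rfl⟩ := List.mem_map.1 hp
    trivial

theorem NExp.val_congr {m m' : Memory} (h : m'.nat = m.nat) (e : NExp) : e.val m' = e.val m := by
  induction e with
  | lit => rfl
  | get a i ih => simp [NExp.val, ih, h]
  | add e f ihe ihf => simp [NExp.val, ihe, ihf]
  | sub e f ihe ihf => simp [NExp.val, ihe, ihf]

theorem exec_assignReals {ι : Type} [Fintype ι] (arr : ι → ℕ) (idx : NExp) (e : ι → RExp d)
    (m : Memory) (hinj : Function.Injective arr)
    (hst : ∀ m' : Memory, m'.nat = m.nat →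
      (∀ a j, (∀ q, ¬ (a = arr q ∧ j = idx.val m)) → m'.real a j = m.real a j) →
      ∀ q, (e q).val S m' = (e q).val S m) :
    (exec S (assignReals arr idx e) m).nat = m.nat ∧
    (∀ q, (exec S (assignReals arr idx e) m).real (arr q) (idx.val m) = (e q).val S m) ∧
    (∀ a j, (∀ q, ¬ (a = arr q ∧ j = idx.val m)) →
      (exec S (assignReals arr idx e) m).real a j = m.real a j) := by
  suffices H : ∀ (l : List ι) (m' : Memory), l.Nodup → m'.nat = m.nat →
      (∀ a j, (∀ q, ¬ (a = arr q ∧ j = idx.val m)) → m'.real a j = m.real a j) →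
      (exec S (seqs (l.map fun q => .setReal (arr q) idx (e q))) m').nat = m.nat ∧
      (∀ q, q ∈ l → (exec S (seqs (l.map fun q => .setReal (arr q) idx (e q))) m').real
        (arr q) (idx.val m) = (e q).val S m) ∧
      (∀ a j, (∀ q ∈ l, ¬ (a = arr q ∧ j = idx.val m)) →
        (exec S (seqs (l.map fun q => .setReal (arr q) idx (e q))) m').real a j
          = m'.real a j) by
    obtain ⟨h1, h2, h3⟩ := H _ m (Finset.nodup_toList Finset.univ) rfl fun _ _ _ => rfl
    exact ⟨h1, fun q => h2 q (by simp), fun a j h => h3 a j fun q _ => h q⟩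
  intro l
  induction l with
  | nil => intro m' _ hr _; exact ⟨hr, by simp, fun _ _ _ => rfl⟩
  | cons q l ih =>
    intro m' hnd hr hag
    rw [List.nodup_cons] at hnd
    simp only [List.map_cons, seqs, exec]
    have hq := hst m' hr hag q
    have hi := NExp.val_congr hr idx
    set m1 : Memory := { m' with real := update m'.real (arr q) (idx.val m') ((e q).val S m') }
      with hm1
    have hag1 : ∀ a j, (∀ q, ¬ (a = arr q ∧ j = idx.val m)) → m1.real a j = m.real a j := by
      intro a j h
      rw [hm1]
      simp only [update_apply, hi]
      rw [if_neg (h q), hag a j h]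
    obtain ⟨h1, h2, h3⟩ := ih m1 hnd.2 hr hag1
    refine ⟨h1, ?_, ?_⟩
    · intro q' hq'
      rcases List.mem_cons.1 hq' with rfl | hq'
      · rw [h3]
        · simp [hm1, update_apply, hq, hi]
        · rintro r hr ⟨e1, e2⟩
          have : q' = r := hinj e1
          exact hnd.1 (this ▸ hr)
      · exact h2 q' hq'
    · intro a j h
      rw [h3 a j fun r hr => h r (by simp [hr])]
      have := h q (by simp)
      simp only [hm1, update_apply, hi, if_neg this]

end Combinators

end FatSubgraph

end

noncomputable section

namespace FatSubgraph

/-! ### Dyadic intervals -/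

section Dyadic

variable {x y z : ℝ}

theorem mem_dyadic_iff (x : ℝ) (i e : ℤ) :
    x ∈ Set.Ico ((i : ℝ) * 2 ^ e) (((i : ℝ) + 1) * 2 ^ e) ↔ ⌊x / (2 : ℝ) ^ e⌋ = i := by
  have h : (0 : ℝ) < 2 ^ e := by positivity
  rw [Int.floor_eq_iff, Set.mem_Ico, le_div_iff₀ h, div_lt_iff₀ h]

/-- Dyadic grids are nested: membership in an interval of length `2^(e+k)` is a condition on the
integer index of the interval of length `2^e`. -/
theorem floor_coarsen {e e' : ℤ} (he : e ≤ e')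
    (h : ⌊x / (2 : ℝ) ^ e⌋ = ⌊y / (2 : ℝ) ^ e⌋) : ⌊x / (2 : ℝ) ^ e'⌋ = ⌊y / (2 : ℝ) ^ e'⌋ := by
  obtain ⟨k, rfl⟩ := Int.le.dest he
  have h0 : (0 : ℝ) < 2 ^ e := by positivity
  have key : ∀ (w : ℝ) (i : ℤ), ⌊w / (2 : ℝ) ^ (e + k)⌋ = i ↔
      i * 2 ^ k ≤ ⌊w / (2 : ℝ) ^ e⌋ ∧ ⌊w / (2 : ℝ) ^ e⌋ < (i + 1) * 2 ^ k := by
    intro w i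
    rw [Int.floor_eq_iff, zpow_add₀ two_ne_zero, zpow_natCast, ← div_div, Int.le_floor,
      Int.floor_lt, le_div_iff₀ (by positivity), div_lt_iff₀ (by positivity)]
    push_cast
    rfl
  rw [key, h, ← key]

theorem abs_sub_lt_of_floor_eq {e : ℤ} (h : ⌊x / (2 : ℝ) ^ e⌋ = ⌊y / (2 : ℝ) ^ e⌋) :
    |x - y| < 2 ^ e := by
  have h0 : (0 : ℝ) < 2 ^ e := by positivity
  have := Int.abs_sub_lt_one_of_floor_eq_floor h
  rwa [← sub_div, abs_div, abs_of_pos h0, div_lt_one h0] at this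

theorem exists_floor_eq (hx : 0 ≤ x) (hy : 0 ≤ y) :
    ∃ e : ℤ, ⌊x / (2 : ℝ) ^ e⌋ = ⌊y / (2 : ℝ) ^ e⌋ := by
  obtain ⟨k, hk⟩ := pow_unbounded_of_one_lt (max x y) (one_lt_two (α := ℝ))
  refine ⟨k, ?_⟩
  have key : ∀ w : ℝ, 0 ≤ w → w < 2 ^ k → ⌊w / (2 : ℝ) ^ (k : ℤ)⌋ = 0 := by
    intro w h0 h1
    rw [Int.floor_eq_zero_iff, zpow_natCast]
    exact ⟨by positivity, (div_lt_one (by positivity)).2 h1⟩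
  rw [key x hx ((le_max_left _ _).trans_lt hk), key y hy ((le_max_right _ _).trans_lt hk)]

theorem exists_zpow_lt {r : ℝ} (hr : 0 < r) : ∃ e : ℤ, (2 : ℝ) ^ e < r := by
  obtain ⟨k, hk⟩ := exists_pow_lt_of_lt_one hr (by norm_num : (1 / 2 : ℝ) < 1)
  exact ⟨-k, by rw [zpow_neg, zpow_natCast]; simpa using hk⟩

theorem exists_floor_ne (h : x ≠ y) : ∃ e : ℤ, ⌊x / (2 : ℝ) ^ e⌋ ≠ ⌊y / (2 : ℝ) ^ e⌋ := by
  obtain ⟨e, he⟩ := exists_zpow_lt (abs_pos.2 (sub_ne_zero.2 h))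
  exact ⟨e, fun hf => (abs_sub_lt_of_floor_eq hf).not_gt he⟩

theorem dyadicSide_eq_sInf (x y : ℝ) : dyadicSide x y =
    sInf {s | ∃ e : ℤ, s = (2 : ℝ) ^ e ∧ ⌊x / (2 : ℝ) ^ e⌋ = ⌊y / (2 : ℝ) ^ e⌋} := by
  unfold dyadicSide
  congr 1
  ext s
  constructor
  · rintro ⟨i, j, rfl, hx, hy⟩
    exact ⟨j, rfl, ((mem_dyadic_iff _ _ _).1 hx).trans ((mem_dyadic_iff _ _ _).1 hy).symm⟩
  · rintro ⟨e, rfl, h⟩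
    exact ⟨_, e, rfl, (mem_dyadic_iff _ _ _).2 rfl, (mem_dyadic_iff _ _ _).2 h.symm⟩

theorem dyadicSide_nonneg (x y : ℝ) : 0 ≤ dyadicSide x y := by
  rw [dyadicSide_eq_sInf]
  refine Real.sInf_nonneg ?_
  rintro _ ⟨e, rfl, -⟩
  positivity

theorem dyadicSide_comm (x y : ℝ) : dyadicSide x y = dyadicSide y x := by
  simp only [dyadicSide_eq_sInf, eq_comm]

/-- The levels at which the two points share an interval are closed upwards by `floor_coarsen`.
Nonnegativity makes the set of such levels nonempty; otherwise the infimum would be the default `0`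
and the equivalence would fail. This is why inputs are translated to nonnegative coordinates. -/
theorem dyadicSide_le_zpow_iff (hx : 0 ≤ x) (hy : 0 ≤ y) {e : ℤ} :
    dyadicSide x y ≤ 2 ^ e ↔ ⌊x / (2 : ℝ) ^ e⌋ = ⌊y / (2 : ℝ) ^ e⌋ := by
  rw [dyadicSide_eq_sInf]
  constructor
  · intro h
    by_contra hne
    have : (2 : ℝ) ^ (e + 1) ≤ 2 ^ e := by
      refine le_trans (le_csInf ?_ ?_) h
      · obtain ⟨e', he'⟩ := exists_floor_eq hx hy
        exact ⟨_, e', rfl, he'⟩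
      · rintro _ ⟨e', rfl, he'⟩
        refine zpow_le_zpow_right₀ one_le_two ?_
        by_contra hlt
        exact hne (floor_coarsen (by omega) he')
    have h2 : (2 : ℝ) ^ e < 2 ^ (e + 1) := zpow_lt_zpow_right₀ one_lt_two (by omega)
    linarith
  · intro h
    refine csInf_le ⟨0, ?_⟩ ⟨e, rfl, h⟩
    rintro _ ⟨e, rfl, -⟩
    positivity

theorem dyadicSide_eq_zero_iff (hx : 0 ≤ x) (hy : 0 ≤ y) : dyadicSide x y = 0 ↔ x = y := by
  constructor
  · intro h
    by_contra hne
    obtain ⟨e, he⟩ := exists_floor_ne hne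
    exact he ((dyadicSide_le_zpow_iff hx hy).1 (h.trans_le (by positivity)))
  · rintro rfl
    refine le_antisymm (le_of_forall_pos_lt_add fun r hr => ?_) (dyadicSide_nonneg _ _)
    obtain ⟨e, he⟩ := exists_zpow_lt hr
    have := (dyadicSide_le_zpow_iff hx hx (e := e)).2 rfl
    linarith

/-- The separating levels are bounded above and nonempty, so there is a greatest one `e`; level `e +
1` is then the first that joins the points. -/
theorem exists_dyadicSide_eq (hx : 0 ≤ x) (hy : 0 ≤ y) (hne : x ≠ y) :
    ∃ e : ℤ, dyadicSide x y = 2 ^ (e + 1) ∧ ⌊x / (2 : ℝ) ^ e⌋ ≠ ⌊y / (2 : ℝ) ^ e⌋ := by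
  obtain ⟨e1, h1⟩ := exists_floor_eq hx hy
  have hb : ∀ e : ℤ, ⌊x / (2 : ℝ) ^ e⌋ ≠ ⌊y / (2 : ℝ) ^ e⌋ → e ≤ e1 := by
    intro e he
    by_contra hlt
    exact he (floor_coarsen (by omega) h1)
  obtain ⟨e, he, hmax⟩ := Int.exists_greatest_of_bdd ⟨e1, hb⟩ (exists_floor_ne hne)
  have he' : ⌊x / (2 : ℝ) ^ (e + 1)⌋ = ⌊y / (2 : ℝ) ^ (e + 1)⌋ := by
    by_contra h
    have := hmax _ h
    omega
  refine ⟨e, le_antisymm ((dyadicSide_le_zpow_iff hx hy).2 he') ?_, he⟩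
  rw [dyadicSide_eq_sInf]
  refine le_csInf ⟨_, e1, rfl, h1⟩ ?_
  rintro _ ⟨e', rfl, he''⟩
  refine zpow_le_zpow_right₀ one_le_two ?_
  by_contra hlt
  exact he (floor_coarsen (by omega) he'')

/-- `0` or a power of two. -/
def IsScale (s : ℝ) : Prop := s = 0 ∨ ∃ e : ℤ, s = 2 ^ e

theorem IsScale.nonneg {s : ℝ} (h : IsScale s) : 0 ≤ s := by
  rcases h with rfl | ⟨e, rfl⟩
  · exact le_rfl
  · positivity

theorem dyadicSide_trans {s : ℝ} (hs : IsScale s) (hx : 0 ≤ x) (hy : 0 ≤ y) (hz : 0 ≤ z)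
    (h : dyadicSide x y ≤ s) (h' : dyadicSide y z ≤ s) : dyadicSide x z ≤ s := by
  rcases hs with rfl | ⟨e, rfl⟩
  · have h1 := (dyadicSide_eq_zero_iff hx hy).1 (le_antisymm h (dyadicSide_nonneg _ _))
    rwa [h1]
  · rw [dyadicSide_le_zpow_iff hx hy] at h
    rw [dyadicSide_le_zpow_iff hy hz] at h'
    rw [dyadicSide_le_zpow_iff hx hz, h, h']

theorem dyadicFloor_zpow (x : ℝ) (e : ℤ) :
    dyadicFloor x (2 ^ e) = (⌊x / (2 : ℝ) ^ e⌋ : ℝ) * 2 ^ e := by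
  unfold dyadicFloor
  have : Int.clog 2 ((2 : ℝ) ^ e) = e := by
    have := Int.clog_zpow (R := ℝ) (b := 2) (by norm_num) e
    exact_mod_cast this
  rw [this]

/-- `dyadicSide 0 r` is a power of two in `(r, 2 r]`. -/
theorem dyadicSide_zero_left {r : ℝ} (hr : 0 < r) :
    ∃ e : ℤ, dyadicSide 0 r = 2 ^ e ∧ r < 2 ^ e ∧ (2 : ℝ) ^ e ≤ 2 * r := by
  obtain ⟨e, he, hne⟩ := exists_dyadicSide_eq le_rfl hr.le hr.ne
  have h1 : ⌊(0 : ℝ) / (2 : ℝ) ^ (e + 1)⌋ = ⌊r / (2 : ℝ) ^ (e + 1)⌋ :=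
    (dyadicSide_le_zpow_iff le_rfl hr.le).1 he.le
  have h2 := abs_sub_lt_of_floor_eq h1
  rw [zero_sub, abs_neg, abs_of_pos hr] at h2
  refine ⟨e + 1, he, h2, ?_⟩
  by_contra hlt
  apply hne
  have h0 : (0 : ℝ) < 2 ^ e := by positivity
  rw [zpow_add_one₀ two_ne_zero] at hlt
  symm
  rw [zero_div, Int.floor_zero, Int.floor_eq_zero_iff]
  exact ⟨by positivity, (div_lt_one h0).2 (by linarith)⟩

end Dyadic

/-! ### Lexicographic order and Z-order -/

/-- Lexicographic comparison of the coordinates listed in `l`. -/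
def lexLt {ι α : Type} [LinearOrder α] : List ι → (ι → α) → (ι → α) → Prop
  | [], _, _ => False
  | i :: l, x, y => x i < y i ∨ (x i ≤ y i ∧ lexLt l x y)

section Lex

variable {ι α β : Type} [LinearOrder α] [LinearOrder β] {l : List ι} {x y z : ι → α}

theorem lexLt_comp {f : α → β} (hf : StrictMono f) :
    lexLt l (fun i => f (x i)) (fun i => f (y i)) ↔ lexLt l x y := by
  induction l with
  | nil => exact Iff.rfl
  | cons i l ih => simp only [lexLt, hf.lt_iff_lt, hf.le_iff_le, ih]

theorem lexLt.exists_lt (h : lexLt l x y) : ∃ i ∈ l, x i < y i := by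
  induction l with
  | nil => exact h.elim
  | cons i l ih =>
    rcases h with h | ⟨-, h⟩
    · exact ⟨i, by simp, h⟩
    · obtain ⟨j, hj, h⟩ := ih h
      exact ⟨j, by simp [hj], h⟩

theorem lexLt.trans (h : lexLt l x y) (h' : lexLt l y z) : lexLt l x z := by
  induction l with
  | nil => exact h.elim
  | cons i l ih =>
    rcases h with h | ⟨h1, h2⟩ <;> rcases h' with h' | ⟨h1', h2'⟩
    · exact Or.inl (h.trans h')
    · exact Or.inl (h.trans_le h1')
    · exact Or.inl (h1.trans_lt h')
    · exact Or.inr ⟨h1.trans h1', ih h2 h2'⟩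

theorem lexLt_or_lexLt (h : ∃ i ∈ l, x i ≠ y i) : lexLt l x y ∨ lexLt l y x := by
  induction l with
  | nil => simp at h
  | cons i l ih =>
    rcases lt_trichotomy (x i) (y i) with hi | hi | hi
    · exact Or.inl (Or.inl hi)
    · have h' : ∃ i ∈ l, x i ≠ y i := by
        obtain ⟨j, hj, hne⟩ := h
        rcases List.mem_cons.1 hj with rfl | hj
        · exact absurd hi hne
        · exact ⟨j, hj, hne⟩
      rcases ih h' with h' | h'
      · exact Or.inl (Or.inr ⟨hi.le, h'⟩)
      · exact Or.inr (Or.inr ⟨hi.ge, h'⟩)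
    · exact Or.inr (Or.inl hi)

end Lex

section ZOrder

variable {d : ℕ} {x y z : Fin d → ℝ} {s t r : ℝ}

/-- Strict Z-order of points with nonnegative coordinates. -/
def zlt (x y : Fin d → ℝ) : Prop :=
  ∃ i, (∀ l, dyadicSide (x l) (y l) ≤ dyadicSide (x i) (y i)) ∧
    lexLt (List.finRange d) (fun l => dyadicFloor (x l) (dyadicSide (x i) (y i) / 2))
      (fun l => dyadicFloor (y l) (dyadicSide (x i) (y i) / 2))

/-- `x` precedes `y` in Z-order, and `e` is the most significant level where they differ. -/
def zltAt (e : ℤ) (x y : Fin d → ℝ) : Prop :=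
  (∀ l, ⌊x l / (2 : ℝ) ^ (e + 1)⌋ = ⌊y l / (2 : ℝ) ^ (e + 1)⌋) ∧
    lexLt (List.finRange d) (fun l => ⌊x l / (2 : ℝ) ^ e⌋) (fun l => ⌊y l / (2 : ℝ) ^ e⌋)

/-- The coordinate with the largest `dyadicSide` reveals the coarsest separating level `e`, its side
being `2^(e+1)`; half of that side is the grid on which the lexicographic comparison takes place.
Thus the machine primitives decide Z-order without access to exponents or bits. -/
theorem zlt_iff (hx : 0 ≤ x) (hy : 0 ≤ y) : zlt x y ↔ ∃ e, zltAt e x y := by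
  have hmul : ∀ e : ℤ, StrictMono fun i : ℤ => (i : ℝ) * 2 ^ e := fun e i j hij =>
    mul_lt_mul_of_pos_right (Int.cast_lt.2 hij) (by positivity)
  constructor
  · rintro ⟨i, hmax, hlex⟩
    by_cases hi : x i = y i
    · exfalso
      rw [(dyadicSide_eq_zero_iff (hx i) (hy i)).2 hi] at hmax
      obtain ⟨l, -, hl⟩ := hlex.exists_lt
      have := (dyadicSide_eq_zero_iff (hx l) (hy l)).1
        (le_antisymm (hmax l) (dyadicSide_nonneg _ _))
      simp [this] at hl
    · obtain ⟨e, he, -⟩ := exists_dyadicSide_eq (hx i) (hy i) hi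
      rw [he] at hmax hlex
      have h2 : (2 : ℝ) ^ (e + 1) / 2 = 2 ^ e := by rw [zpow_add_one₀ two_ne_zero]; ring
      simp only [h2, dyadicFloor_zpow] at hlex
      exact ⟨e, fun l => (dyadicSide_le_zpow_iff (hx l) (hy l)).1 (hmax l),
        (lexLt_comp (hmul e)).1 hlex⟩
  · rintro ⟨e, heq, hlex⟩
    obtain ⟨i, -, hi⟩ := hlex.exists_lt
    have hle : ∀ l, dyadicSide (x l) (y l) ≤ 2 ^ (e + 1) := fun l =>
      (dyadicSide_le_zpow_iff (hx l) (hy l)).2 (heq l)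
    have hne : x i ≠ y i := fun h => by simp [h] at hi
    obtain ⟨e', he', -⟩ := exists_dyadicSide_eq (hx i) (hy i) hne
    have h1 : ¬ dyadicSide (x i) (y i) ≤ 2 ^ e := fun h =>
      hi.ne ((dyadicSide_le_zpow_iff (hx i) (hy i)).1 h)
    have h2 := hle i
    rw [he'] at h1 h2
    rw [zpow_le_zpow_iff_right₀ one_lt_two] at h1 h2
    have : e' = e := by omega
    subst this
    have h2 : (2 : ℝ) ^ (e' + 1) / 2 = 2 ^ e' := by rw [zpow_add_one₀ two_ne_zero]; ring
    refine ⟨i, fun l => by rw [he']; exact hle l, ?_⟩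
    simp only [he', h2, dyadicFloor_zpow]
    exact (lexLt_comp (hmul e')).2 hlex

/-- The coarser of the two levels decides, because there the pair separated at a finer level still
has equal indices. For equal levels, lexicographic transitivity applies. -/
theorem zltAt.trans {e e' : ℤ} (h : zltAt e x y) (h' : zltAt e' y z) :
    zltAt (max e e') x z := by
  rcases lt_trichotomy e e' with hlt | rfl | hlt
  · have key : ∀ l, ⌊x l / (2 : ℝ) ^ e'⌋ = ⌊y l / (2 : ℝ) ^ e'⌋ := fun l =>
      floor_coarsen (by omega) (h.1 l)
    rw [max_eq_right hlt.le]
    refine ⟨fun l => (floor_coarsen (by omega) (key l)).trans (h'.1 l), ?_⟩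
    simp only [key]
    exact h'.2
  · rw [max_self]
    exact ⟨fun l => (h.1 l).trans (h'.1 l), h.2.trans h'.2⟩
  · have key : ∀ l, ⌊y l / (2 : ℝ) ^ e⌋ = ⌊z l / (2 : ℝ) ^ e⌋ := fun l =>
      floor_coarsen (by omega) (h'.1 l)
    rw [max_eq_left hlt.le]
    refine ⟨fun l => (h.1 l).trans (floor_coarsen (by omega) (key l)), ?_⟩
    simp only [← key]
    exact h.2

theorem zlt_irrefl (hx : 0 ≤ x) : ¬ zlt x x := by
  rw [zlt_iff hx hx]
  rintro ⟨e, -, h⟩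
  obtain ⟨i, -, hi⟩ := h.exists_lt
  exact lt_irrefl _ hi

theorem zlt.trans (hx : 0 ≤ x) (hy : 0 ≤ y) (hz : 0 ≤ z) (h : zlt x y) (h' : zlt y z) :
    zlt x z := by
  rw [zlt_iff hx hy] at h
  rw [zlt_iff hy hz] at h'
  obtain ⟨e, h⟩ := h
  obtain ⟨e', h'⟩ := h'
  exact (zlt_iff hx hz).2 ⟨_, h.trans h'⟩

theorem zlt_or_zlt (hx : 0 ≤ x) (hy : 0 ≤ y) (hne : x ≠ y) : zlt x y ∨ zlt y x := by
  obtain ⟨i, hi⟩ := Function.ne_iff.1 hne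
  obtain ⟨m, -, hm⟩ := Finset.exists_max_image Finset.univ
    (fun l => dyadicSide (x l) (y l)) ⟨i, Finset.mem_univ i⟩
  have hm0 : x m ≠ y m := by
    intro h
    have h1 := hm i (Finset.mem_univ _)
    rw [(dyadicSide_eq_zero_iff (hx m) (hy m)).2 h] at h1
    exact hi ((dyadicSide_eq_zero_iff (hx i) (hy i)).1
      (le_antisymm h1 (dyadicSide_nonneg _ _)))
  obtain ⟨e, he, hne⟩ := exists_dyadicSide_eq (hx m) (hy m) hm0
  have heq : ∀ l, ⌊x l / (2 : ℝ) ^ (e + 1)⌋ = ⌊y l / (2 : ℝ) ^ (e + 1)⌋ := fun l =>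
    (dyadicSide_le_zpow_iff (hx l) (hy l)).1 (he ▸ hm l (Finset.mem_univ _))
  rw [zlt_iff hx hy, zlt_iff hy hx]
  rcases lexLt_or_lexLt (l := List.finRange d) (x := fun l => ⌊x l / (2 : ℝ) ^ e⌋)
    (y := fun l => ⌊y l / (2 : ℝ) ^ e⌋) ⟨m, List.mem_finRange m, hne⟩ with h | h
  · exact Or.inl ⟨e, heq, h⟩
  · exact Or.inr ⟨e, fun l => (heq l).symm, h⟩

/-- `x` and `y` lie in a common dyadic cell of side length at most `s`. -/
def Near (s : ℝ) (x y : Fin d → ℝ) : Prop := ∀ i, dyadicSide (x i) (y i) ≤ s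

theorem Near.symm (h : Near s x y) : Near s y x := fun i => by
  rw [dyadicSide_comm]; exact h i

theorem Near.trans (hs : IsScale s) (hx : 0 ≤ x) (hy : 0 ≤ y) (hz : 0 ≤ z) (h : Near s x y)
    (h' : Near s y z) : Near s x z := fun i =>
  dyadicSide_trans hs (hx i) (hy i) (hz i) (h i) (h' i)

theorem Near.mono (h : Near s x y) (hst : s ≤ t) : Near t x y := fun i => (h i).trans hst

theorem near_zero_iff (hx : 0 ≤ x) (hy : 0 ≤ y) : Near 0 x y ↔ x = y := by
  constructor
  · intro h
    funext i
    exact (dyadicSide_eq_zero_iff (hx i) (hy i)).1 (le_antisymm (h i) (dyadicSide_nonneg _ _))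
  · rintro rfl i
    exact ((dyadicSide_eq_zero_iff (hx i) (hy i)).2 rfl).le

theorem near_zpow_iff (hx : 0 ≤ x) (hy : 0 ≤ y) {e : ℤ} :
    Near (2 ^ e) x y ↔ ∀ i, ⌊x i / (2 : ℝ) ^ e⌋ = ⌊y i / (2 : ℝ) ^ e⌋ :=
  forall_congr' fun i => dyadicSide_le_zpow_iff (hx i) (hy i)

/-- Cells are intervals of the Z-order. -/
theorem near_of_between (hs : IsScale s) (hx : 0 ≤ x) (hy : 0 ≤ y) (hz : 0 ≤ z)
    (h : Near s x z) (hxy : ¬ zlt y x) (hyz : ¬ zlt z y) : Near s x y := by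
  by_cases hxy' : x = y
  · rw [hxy']; exact fun i => ((dyadicSide_eq_zero_iff (hy i) (hy i)).2 rfl).le.trans hs.nonneg
  by_cases hyz' : y = z
  · rwa [hyz']
  have h1 := (zlt_or_zlt hx hy hxy').resolve_right hxy
  have h2 := (zlt_or_zlt hy hz hyz').resolve_right hyz
  rcases hs with rfl | ⟨J, rfl⟩
  · rw [near_zero_iff hx hz] at h
    subst h
    exact absurd h1 hyz
  · rw [near_zpow_iff hx hz] at h
    rw [zlt_iff hx hy] at h1
    rw [zlt_iff hy hz] at h2
    obtain ⟨e, h1⟩ := h1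
    obtain ⟨e', h2⟩ := h2
    have h3 := h1.trans h2
    obtain ⟨i, -, hi⟩ := h3.2.exists_lt
    rw [near_zpow_iff hx hy]
    -- The level separating `x` and `z` is the maximum of the two levels, so it lies strictly below
    -- the common cell; hence `x` and `y` also agree at level `J`.
    have hlt : max e e' < J := by
      by_contra hle
      exact hi.ne (floor_coarsen (by omega) (h i))
    exact fun i => floor_coarsen (by omega) (h1.1 i)

/-! ### Cells -/

/-- `a` is the lower corner of a dyadic cell of side length `s`; a cell of side length `0` is a
point. -/
structure IsCell (a : Fin d → ℝ) (s : ℝ) : Prop where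
  nonneg : 0 ≤ a
  scale : s = 0 ∨ ∃ e : ℤ, s = 2 ^ e ∧ ∀ i, a i = (⌊a i / (2 : ℝ) ^ e⌋ : ℝ) * 2 ^ e

/-- The point `x` lies in the cell with corner `a` and side length `s`. -/
def InCell (a : Fin d → ℝ) (s : ℝ) (x : Fin d → ℝ) : Prop :=
  ∀ i, a i ≤ x i ∧ (x i < a i + s ∨ x i ≤ a i)

/-- The second cell is contained in the first one. -/
def Anc (a : Fin d → ℝ) (s : ℝ) (b : Fin d → ℝ) (t : ℝ) : Prop := t ≤ s ∧ Near s a b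

/-- Preorder on cells: Z-order of the corners, larger cells first. -/
def CellLe (a : Fin d → ℝ) (s : ℝ) (b : Fin d → ℝ) (t : ℝ) : Prop :=
  zlt a b ∨ (¬ zlt b a ∧ t ≤ s)

variable {a b c : Fin d → ℝ}

theorem IsCell.isScale (h : IsCell a s) : IsScale s := by
  rcases h.scale with h | ⟨e, h, -⟩
  · exact Or.inl h
  · exact Or.inr ⟨e, h⟩

theorem IsCell.near_iff (h : IsCell a s) (hx : 0 ≤ x) : Near s a x ↔ InCell a s x := by
  rcases h.scale with rfl | ⟨e, rfl, hc⟩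
  · rw [near_zero_iff h.nonneg hx]
    constructor
    · rintro rfl i; exact ⟨le_rfl, Or.inr le_rfl⟩
    · intro h; funext i
      obtain ⟨h1, h2 | h2⟩ := h i <;> linarith
  · rw [near_zpow_iff h.nonneg hx]
    have h0 : (0 : ℝ) < 2 ^ e := by positivity
    refine forall_congr' fun i => ?_
    rw [eq_comm, ← mem_dyadic_iff, add_mul, ← hc i, one_mul, Set.mem_Ico]
    refine and_congr_right fun _ => ⟨Or.inl, ?_⟩
    rintro (h | h)
    · exact h
    · linarith

theorem InCell.nonneg (h : IsCell a s) (hx : InCell a s x) : 0 ≤ x := fun i =>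
  (h.nonneg i).trans (hx i).1

/-- The lower corner is coordinatewise minimal in its cell, hence first in Z-order; this makes
Z-order of corners a preorder traversal. -/
theorem IsCell.not_zlt (h : IsCell a s) (hx : 0 ≤ x) (hn : Near s a x) : ¬ zlt x a := by
  rw [zlt_iff hx h.nonneg]
  rintro ⟨e, -, hl⟩
  obtain ⟨i, -, hi⟩ := hl.exists_lt
  have := ((h.near_iff hx).1 hn i).1
  have h0 : (0 : ℝ) < 2 ^ e := by positivity
  exact absurd (Int.floor_le_floor (div_le_div_of_nonneg_right this h0.le)) (not_le.2 hi)

theorem CellLe.not_zlt (ha : 0 ≤ a) (hb : 0 ≤ b) (h : CellLe a s b t) : ¬ zlt b a := by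
  rcases h with h | h
  · exact fun h' => zlt_irrefl ha (h.trans ha hb ha h')
  · exact h.1

theorem CellLe.total (ha : 0 ≤ a) (hb : 0 ≤ b) (s t : ℝ) :
    CellLe a s b t ∨ CellLe b t a s := by
  unfold CellLe
  by_cases h : a = b
  · subst h
    simp only [zlt_irrefl ha, not_false_eq_true, false_or, true_and]
    exact le_total _ _
  · rcases zlt_or_zlt ha hb h with h | h
    · exact Or.inl (Or.inl h)
    · exact Or.inr (Or.inl h)

theorem CellLe.trans (ha : 0 ≤ a) (hb : 0 ≤ b) (hc : 0 ≤ c) (h : CellLe a s b t)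
    (h' : CellLe b t c r) : CellLe a s c r := by
  have e1 := h.not_zlt ha hb
  have e2 := h'.not_zlt hb hc
  by_cases hab : a = b
  · subst hab
    rcases h' with h' | ⟨h1, h2⟩
    · exact Or.inl h'
    · rcases h with h | ⟨-, h⟩
      · exact absurd h (zlt_irrefl ha)
      · exact Or.inr ⟨h1, h2.trans h⟩
  · have hab' := (zlt_or_zlt ha hb hab).resolve_right e1
    by_cases hbc : b = c
    · subst hbc
      exact Or.inl hab'
    · exact Or.inl (hab'.trans ha hb hc ((zlt_or_zlt hb hc hbc).resolve_right e2))

theorem Anc.trans (ha : IsCell a s) (hb : 0 ≤ b) (hc : 0 ≤ c)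
    (h : Anc a s b t) (h' : Anc b t c r) : Anc a s c r :=
  ⟨h'.1.trans h.1, h.2.trans ha.isScale ha.nonneg hb hc (h'.2.mono h.1)⟩

theorem Anc.of_inCell (ha : IsCell a s) (hb : IsCell b t) (hax : InCell a s x)
    (hbx : InCell b t x) (hts : t ≤ s) : Anc a s b t :=
  have hx := hax.nonneg ha
  ⟨hts, ((ha.near_iff hx).2 hax).trans ha.isScale ha.nonneg hx hb.nonneg
    (((hb.near_iff hx).2 hbx).symm.mono hts)⟩

/-- Dyadic cells with a common point are nested, the larger around the smaller. If the second were
larger, its corner could not come later in Z-order, and the tie-break by size would force equal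
sides. -/
theorem CellLe.anc (ha : IsCell a s) (hb : IsCell b t) (hax : InCell a s x)
    (hbx : InCell b t x) (h : CellLe a s b t) : Anc a s b t := by
  rcases le_total t s with hts | hst
  · exact Anc.of_inCell ha hb hax hbx hts
  · have h1 := Anc.of_inCell hb ha hbx hax hst
    rcases h with h | ⟨-, h⟩
    · exact absurd h (hb.not_zlt ha.nonneg h1.2)
    · exact Anc.of_inCell ha hb hax hbx h

theorem Anc.of_between (ha : IsCell a s) (hb : IsCell b t) (hc : 0 ≤ c) (h : Anc a s c r)
    (hab : CellLe a s b t) (hbc : CellLe b t c r) : Anc a s b t := by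
  have h1 : Near s a b := near_of_between ha.isScale ha.nonneg hb.nonneg hc h.2
    (hab.not_zlt ha.nonneg hb.nonneg) (hbc.not_zlt hb.nonneg hc)
  refine ⟨?_, h1⟩
  by_contra hlt
  push Not at hlt
  have e1 := (ha.near_iff hb.nonneg).1 h1
  have e2 := (hb.near_iff ha.nonneg).1 (h1.mono hlt.le).symm
  -- If the middle cell were strictly larger, each corner would lie in the other cell, so the
  -- corners would coincide; the tie-break by size then excludes the assumed order.
  have : a = b := funext fun i => le_antisymm (e1 i).1 (e2 i).1
  subst this
  rcases hab with h | ⟨-, h⟩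
  · exact zlt_irrefl ha.nonneg h
  · exact hlt.not_ge h

theorem Anc.corner_le (ha : IsCell a s) (hb : 0 ≤ b) (h : Anc a s b t) (i : Fin d) :
    a i ≤ b i :=
  ((ha.near_iff hb).1 h.2 i).1

theorem Anc.le_corner (ha : IsCell a s) (hb : IsCell b t) (h : Anc a s b t) (i : Fin d) :
    b i + t ≤ a i + s := by
  obtain ⟨h1, h2⟩ := (ha.near_iff hb.nonneg).1 h.2 i
  have hts := h.1
  rcases h2 with h2 | h2
  · rcases hb.scale with rfl | ⟨f, rfl, hbf⟩
    · linarith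
    · rcases ha.scale with rfl | ⟨e, rfl, hae⟩
      · linarith
      · have hfe : f ≤ e := (zpow_le_zpow_iff_right₀ one_lt_two).1 hts
        obtain ⟨k, rfl⟩ := Int.le.dest hfe
        rw [hbf i, hae i] at h2 ⊢
        generalize ⌊b i / (2 : ℝ) ^ f⌋ = j at *
        generalize ⌊a i / (2 : ℝ) ^ (f + (k : ℤ))⌋ = j' at *
        rw [zpow_add₀ two_ne_zero, zpow_natCast] at *
        have h0 : (0 : ℝ) < 2 ^ f := by positivity
        -- In units of the smaller side all endpoints are integers, so a strict inequality between
        -- left ends improves to one between right ends.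
        have h3 : (j : ℝ) * 2 ^ f < ((j' * 2 ^ k + 2 ^ k : ℤ) : ℝ) * 2 ^ f := by
          push_cast; linarith
        have h4 : j < j' * 2 ^ k + 2 ^ k := by
          exact_mod_cast lt_of_mul_lt_mul_right h3 h0.le
        have h5 : ((j + 1 : ℤ) : ℝ) ≤ ((j' * 2 ^ k + 2 ^ k : ℤ) : ℝ) :=
          Int.cast_le.2 (by omega)
        have h6 := mul_le_mul_of_nonneg_right h5 h0.le
        push_cast at h6
        linarith
  · linarith

end ZOrder

end FatSubgraph

end

noncomputable section

namespace FatSubgraph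

/-! ### Geometry of shifted objects -/

section Objects

variable {d n : ℕ} (S : Fin n → Set (Fin d → ℝ))

/-- Left end of the extent of object `o`; `0` if there is no such object. -/
def lo (o : ℕ) (i : Fin d) : ℝ := if h : o < n then lower (S ⟨o, h⟩) i else 0

/-- Right end of the extent of object `o`; `0` if there is no such object. -/
def up (o : ℕ) (i : Fin d) : ℝ := if h : o < n then upper (S ⟨o, h⟩) i else 0

/-- Side length of object `o`; `0` if there is no such object. -/
def width (o : ℕ) : ℝ := (List.finRange d).foldl (fun L i => max L (up S o i - lo S o i)) 0

open Classical in
/-- Side length of the cell of object `o`. -/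
def side (K : ℕ) (o : ℕ) : ℝ :=
  if width S o ≤ 0 then 0 else dyadicSide 0 ((2 * K : ℕ) * width S o)

open Classical in
/-- Lower corner of the cell of the translate of object `o` by `τ`. -/
def corner (K : ℕ) (τ : ℝ) (o : ℕ) (i : Fin d) : ℝ :=
  if width S o ≤ 0 then lo S o i + τ else dyadicFloor (lo S o i + τ) (side S K o)

/-- The translate of object `o` by `τ` fits into its cell along axis `i`. -/
def Fits (K : ℕ) (τ : ℝ) (o : ℕ) (i : Fin d) : Prop :=
  up S o i + τ < corner S K τ o i + side S K o ∨ up S o i + τ ≤ corner S K τ o i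

/-- The translate of object `o` by `τ` fits into its cell. -/
def Good (K : ℕ) (τ : ℝ) (o : ℕ) : Prop := ∀ i, Fits S K τ o i

/-- The objects `o` and `p` intersect. -/
def Inter (o p : ℕ) : Prop := ∃ (h : o < n) (h' : p < n), (S ⟨o, h⟩ ∩ S ⟨p, h'⟩).Nonempty

/-- The object `o` meets the closed cell of the object `p`. -/
def MeetsCell (K : ℕ) (τ : ℝ) (o p : ℕ) : Prop :=
  ∃ h : o < n, (S ⟨o, h⟩ ∩ cube (fun i => corner S K τ p i - τ) (side S K p)).Nonempty

/-- The cell of `p` is contained in the cell of `o`. -/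
def AncO (K : ℕ) (τ : ℝ) (o p : ℕ) : Prop :=
  Anc (corner S K τ o) (side S K o) (corner S K τ p) (side S K p)

/-- Preorder of the cells of objects. -/
def LeO (K : ℕ) (τ : ℝ) (o p : ℕ) : Prop :=
  CellLe (corner S K τ o) (side S K o) (corner S K τ p) (side S K p)

variable {S}

theorem lower_le {s : Set (Fin d → ℝ)} (hs : IsObject s) {x : Fin d → ℝ} (hx : x ∈ s)
    (i : Fin d) : lower s i ≤ x i :=
  csInf_le ((Bornology.forall_isBounded_image_eval_iff.2 hs.2 i).bddBelow)
    (Set.mem_image_of_mem _ hx)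

theorem le_upper {s : Set (Fin d → ℝ)} (hs : IsObject s) {x : Fin d → ℝ} (hx : x ∈ s)
    (i : Fin d) : x i ≤ upper s i :=
  le_csSup ((Bornology.forall_isBounded_image_eval_iff.2 hs.2 i).bddAbove)
    (Set.mem_image_of_mem _ hx)

theorem lo_le {o : ℕ} (h : o < n) (hS : ∀ i, IsObject (S i)) {x : Fin d → ℝ}
    (hx : x ∈ S ⟨o, h⟩) (i : Fin d) : lo S o i ≤ x i := by
  rw [lo, dif_pos h]; exact lower_le (hS _) hx i

theorem le_up {o : ℕ} (h : o < n) (hS : ∀ i, IsObject (S i)) {x : Fin d → ℝ}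
    (hx : x ∈ S ⟨o, h⟩) (i : Fin d) : x i ≤ up S o i := by
  rw [up, dif_pos h]; exact le_upper (hS _) hx i

theorem lo_le_up (hS : ∀ i, IsObject (S i)) (o : ℕ) (i : Fin d) : lo S o i ≤ up S o i := by
  by_cases h : o < n
  · obtain ⟨x, hx⟩ := (hS ⟨o, h⟩).1
    exact (lo_le h hS hx i).trans (le_up h hS hx i)
  · simp [lo, up, h]

theorem foldl_max_spec {ι : Type} (f : ι → ℝ) (l : List ι) (a : ℝ) :
    a ≤ l.foldl (fun L i => max L (f i)) a ∧ (∀ i ∈ l, f i ≤ l.foldl (fun L i => max L (f i)) a) ∧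
    (l.foldl (fun L i => max L (f i)) a = a ∨
      ∃ i ∈ l, l.foldl (fun L i => max L (f i)) a = f i) := by
  induction l generalizing a with
  | nil => simp
  | cons j l ih =>
    obtain ⟨h1, h2, h3⟩ := ih (max a (f j))
    simp only [List.foldl_cons]
    refine ⟨(le_max_left _ _).trans h1, ?_, ?_⟩
    · intro i hi
      rcases List.mem_cons.1 hi with rfl | hi
      · exact (le_max_right _ _).trans h1
      · exact h2 i hi
    · rcases h3 with h3 | ⟨i, hi, h3⟩
      · rw [h3]
        rcases max_choice a (f j) with h | h
        · exact Or.inl h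
        · exact Or.inr ⟨j, by simp, h⟩
      · exact Or.inr ⟨i, by simp [hi], h3⟩

theorem le_width (o : ℕ) (i : Fin d) : up S o i - lo S o i ≤ width S o :=
  (foldl_max_spec (fun i => up S o i - lo S o i) (List.finRange d) 0).2.1 i (List.mem_finRange i)

theorem width_le_sideLength (hS : ∀ i, IsObject (S i)) {o : ℕ} (h : o < n) :
    width S o ≤ sideLength (S ⟨o, h⟩) := by
  have hle : ∀ i, up S o i - lo S o i ≤ sideLength (S ⟨o, h⟩) := by
    intro i
    rw [lo, up, dif_pos h, dif_pos h]
    exact le_ciSup (f := fun i => upper (S ⟨o, h⟩) i - lower (S ⟨o, h⟩) i)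
      (Set.finite_range _).bddAbove i
  rcases (foldl_max_spec (fun i => up S o i - lo S o i) (List.finRange d) 0).2.2 with h0 | ⟨i, -, h0⟩
  · rw [width, h0]
    refine Real.iSup_nonneg fun i => ?_
    have := lo_le_up hS o i
    rw [lo, up, dif_pos h, dif_pos h] at this
    linarith
  · rw [width, h0]
    exact hle i

variable {K : ℕ} {τ : ℝ}

/-- The lower bound makes grid crossings rare over the shifts; the upper bound makes objects with
large cells large enough for fatness to apply. -/
theorem side_spec (hK : 0 < K) {o : ℕ} (h : 0 < width S o) :
    ∃ e : ℤ, side S K o = 2 ^ e ∧ 2 * K * width S o < 2 ^ e ∧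
      (2 : ℝ) ^ e ≤ 4 * K * width S o := by
  have hpos : (0 : ℝ) < (2 * K : ℕ) * width S o := by positivity
  obtain ⟨e, h1, h2, h3⟩ := dyadicSide_zero_left hpos
  push_cast at h2 h3
  exact ⟨e, by rw [side, if_neg h.not_ge, h1], h2, by linarith⟩

theorem isCell_corner (hK : 0 < K) (hτ : ∀ o i, 0 ≤ lo S o i + τ) (o : ℕ) :
    IsCell (corner S K τ o) (side S K o) := by
  by_cases h : width S o ≤ 0
  · refine ⟨fun i => ?_, Or.inl ?_⟩
    · rw [corner, if_pos h]; exact hτ o i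
    · rw [side, if_pos h]
  · obtain ⟨e, he, -⟩ := side_spec hK (not_le.1 h)
    have hc : ∀ i, corner S K τ o i = (⌊(lo S o i + τ) / (2 : ℝ) ^ e⌋ : ℝ) * 2 ^ e := fun i => by
      rw [corner, if_neg h, he, dyadicFloor_zpow]
    have h0 : (0 : ℝ) < 2 ^ e := by positivity
    refine ⟨fun i => ?_, Or.inr ⟨e, he, fun i => ?_⟩⟩
    · rw [hc]
      have := hτ o i
      have : (0 : ℤ) ≤ ⌊(lo S o i + τ) / (2 : ℝ) ^ e⌋ := Int.floor_nonneg.2 (by positivity)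
      have : (0 : ℝ) ≤ ⌊(lo S o i + τ) / (2 : ℝ) ^ e⌋ := Int.cast_nonneg this
      exact mul_nonneg this h0.le
    · rw [hc, mul_div_assoc, div_self h0.ne', mul_one, Int.floor_intCast]

theorem corner_le (hK : 0 < K) (o : ℕ) (i : Fin d) : corner S K τ o i ≤ lo S o i + τ := by
  by_cases h : width S o ≤ 0
  · rw [corner, if_pos h]
  · obtain ⟨e, he, -⟩ := side_spec hK (not_le.1 h)
    rw [corner, if_neg h, he, dyadicFloor_zpow]
    have h0 : (0 : ℝ) < 2 ^ e := by positivity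
    exact (le_div_iff₀ h0).1 (Int.floor_le _)

theorem Good.inCell (hS : ∀ i, IsObject (S i)) (hK : 0 < K) {o : ℕ} (hg : Good S K τ o)
    (h : o < n) {x : Fin d → ℝ} (hx : x ∈ S ⟨o, h⟩) :
    InCell (corner S K τ o) (side S K o) (fun i => x i + τ) := by
  intro i
  have h1 := lo_le h hS hx i
  have h2 := le_up h hS hx i
  refine ⟨(corner_le hK o i).trans (by linarith), ?_⟩
  rcases hg i with h3 | h3
  · left; linarith
  · right; linarith

theorem Inter.symm {o p : ℕ} (h : Inter S o p) : Inter S p o := by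
  obtain ⟨h1, h2, x, hx, hy⟩ := h
  exact ⟨h2, h1, x, hy, hx⟩

theorem inter_self_iff (hS : ∀ i, IsObject (S i)) {o : ℕ} : Inter S o o ↔ o < n :=
  ⟨fun h => h.1, fun h => ⟨h, h, by simpa using (hS _).1⟩⟩

theorem LeO.anc (hS : ∀ i, IsObject (S i)) (hK : 0 < K) (hτ : ∀ o i, 0 ≤ lo S o i + τ)
    {o p : ℕ} (ho : Good S K τ o) (hp : Good S K τ p) (h : Inter S o p) (hle : LeO S K τ o p) :
    AncO S K τ o p := by
  obtain ⟨h1, h2, x, hx, hy⟩ := h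
  exact CellLe.anc (isCell_corner hK hτ o) (isCell_corner hK hτ p)
    (ho.inCell hS hK h1 hx) (hp.inCell hS hK h2 hy) hle

theorem Inter.meetsCell (hS : ∀ i, IsObject (S i)) (hK : 0 < K) (hτ : ∀ o i, 0 ≤ lo S o i + τ)
    {o p : ℕ} (hp : Good S K τ p) (h : Inter S o p) :
    MeetsCell S K τ o p := by
  obtain ⟨h1, h2, x, hx, hy⟩ := h
  refine ⟨h1, x, hx, fun i => ?_⟩
  have hs := (isCell_corner hK hτ p).isScale.nonneg
  obtain ⟨h3, h4 | h4⟩ := hp.inCell hS hK h2 hy i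
  · constructor <;> linarith
  · constructor <;> linarith

/-- Nested half-open cells have nested closures. This monotonicity is what allows the boundary list
of a new stack level to be filtered from that of its parent. -/
theorem MeetsCell.mono (hK : 0 < K) (hτ : ∀ o i, 0 ≤ lo S o i + τ) {o p q : ℕ}
    (hpq : AncO S K τ p q) (h : MeetsCell S K τ o q) : MeetsCell S K τ o p := by
  obtain ⟨h1, x, hx, hc⟩ := h
  refine ⟨h1, x, hx, fun i => ?_⟩
  have e1 := Anc.corner_le (isCell_corner hK hτ p) (isCell_corner hK hτ q).nonneg hpq i
  have e2 := Anc.le_corner (isCell_corner hK hτ p) (isCell_corner hK hτ q) hpq i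
  have e3 := hc i
  simp only at e3
  exact ⟨by linarith, by linarith⟩

theorem exists_subinterval {N : ℕ} (hN : 0 < N) {r u : ℝ} (hr : 0 < r) (h0 : 0 ≤ u)
    (h1 : u ≤ N * r) : ∃ z : Fin N, z * r ≤ u ∧ u ≤ z * r + r := by
  by_cases h : ⌊u / r⌋₊ < N
  · refine ⟨⟨_, h⟩, (le_div_iff₀ hr).1 (Nat.floor_le (by positivity)), ?_⟩
    have := (div_lt_iff₀ hr).1 (Nat.lt_floor_add_one (u / r))
    simp only
    linarith
  -- Only the right end `u = N * r` remains; it belongs to the last closed subinterval.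
  · have hu : N * r ≤ u := (le_div_iff₀ hr).1 ((Nat.le_floor_iff (by positivity)).1 (not_lt.1 h))
    refine ⟨⟨N - 1, by omega⟩, ?_, ?_⟩
    · simp only [Nat.cast_pred hN]; linarith
    · simp only [Nat.cast_pred hN]; linarith

/-- The cell of `p` is cut into `(4K)^d` subcubes; fatness gives at most `c` stabbing points for
each, and each of the `b` objects contains one of these points. By pigeonhole one point lies in the
objects of more than `k` indices. If the cell of `p` degenerates to a point, that point itself is
common. -/
theorem exists_common_point (hS : ∀ i, IsObject (S i)) {c : ℕ} (hfat : IsFat c S) (hK : 0 < K)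
    (k : ℕ) {b : ℕ} (hb : (4 * K) ^ d * c * k + k < b) (v : Fin b → ℕ)
    (p : ℕ) (hanc : ∀ q, AncO S K τ (v q) p) (hm : ∀ q, MeetsCell S K τ (v q) p) :
    ∃ f : Fin k → Fin b, Function.Injective f ∧ ∀ i j, Inter S (v (f i)) (v (f j)) := by
  classical
  by_cases hw : width S p ≤ 0
  · have hs : side S K p = 0 := by rw [side, if_pos hw]
    have hpt : ∀ q, ∃ h : v q < n, (fun i => corner S K τ p i - τ) ∈ S ⟨v q, h⟩ := by
      intro q
      obtain ⟨h, x, hx, hc⟩ := hm q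
      refine ⟨h, ?_⟩
      convert hx using 1
      funext i
      have := hc i
      rw [hs] at this
      exact le_antisymm this.1 (by linarith [this.2])
    have hkb : k ≤ b := by omega
    refine ⟨Fin.castLE hkb, Fin.castLE_injective hkb, fun i j => ?_⟩
    obtain ⟨h1, h2⟩ := hpt (Fin.castLE hkb i)
    obtain ⟨h3, h4⟩ := hpt (Fin.castLE hkb j)
    exact ⟨h1, h3, _, h2, h4⟩
  · obtain ⟨e, he, -⟩ := side_spec (K := K) hK (not_le.1 hw)
    -- The subcube side is chosen so that every object whose cell side is at least that of `p` has
    -- width at least `r`, by the upper bound in `side_spec`.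
    set r : ℝ := side S K p / (4 * K : ℕ) with hr
    have hKpos : (0 : ℝ) < (4 * K : ℕ) := by exact_mod_cast (by omega : 0 < 4 * K)
    have hsp : 0 < side S K p := by rw [he]; positivity
    have hr0 : 0 < r := by positivity
    have hNr : ((4 * K : ℕ) : ℝ) * r = side S K p := mul_div_cancel₀ _ hKpos.ne'
    choose P hP1 hP2 using fun z : Fin d → Fin (4 * K) =>
      hfat (fun i => corner S K τ p i - τ + z i * r) r hr0
    have key : ∀ q, ∃ y ∈ Finset.univ.biUnion P, ∃ h : v q < n, y ∈ S ⟨v q, h⟩ := by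
      intro q
      obtain ⟨h, x, hx, hc⟩ := hm q
      choose z hz1 hz2 using fun i => exists_subinterval (N := 4 * K) (by omega) hr0
        (sub_nonneg.2 (hc i).1) (by rw [hNr]; linarith [(hc i).2])
      have hlen : r ≤ sideLength (S ⟨v q, h⟩) := by
        refine le_trans ?_ (width_le_sideLength hS h)
        have hle := (hanc q).1
        have hwq : 0 < width S (v q) := by
          by_contra hneg
          have h0 : side S K (v q) = 0 := if_pos (not_lt.1 hneg)
          linarith
        obtain ⟨e', he', -, h3⟩ := side_spec (K := K) hK hwq
        rw [hr, div_le_iff₀ hKpos]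
        push_cast
        linarith
      obtain ⟨y, hy1, hy2⟩ := hP2 z ⟨v q, h⟩ ⟨x, hx, fun i => ⟨by linarith [hz1 i], by
        linarith [hz2 i]⟩⟩ hlen
      exact ⟨y, Finset.mem_biUnion.2 ⟨z, Finset.mem_univ _, hy1⟩, h, hy2⟩
    choose y hy1 hyn hy2 using key
    have hcard : (Finset.univ.biUnion P).card ≤ (4 * K) ^ d * c := by
      refine (Finset.card_biUnion_le_card_mul _ _ c fun z _ => hP1 z).trans (le_of_eq ?_)
      simp
    have hlt : (Finset.univ.biUnion P).card * k < (Finset.univ : Finset (Fin b)).card := by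
      rw [Finset.card_fin]
      exact (Nat.mul_le_mul_right k hcard).trans_lt (by omega)
    obtain ⟨pt, -, hpt⟩ := Finset.exists_lt_card_fiber_of_mul_lt_card_of_maps_to
      (fun q _ => hy1 q) hlt
    set F := Finset.univ.filter fun q => y q = pt with hF
    obtain ⟨g⟩ : Nonempty (Fin k ↪ F) := by
      rw [Function.Embedding.nonempty_iff_card_le]
      simpa using hpt.le
    refine ⟨fun i => g i, fun i j h => g.injective (Subtype.ext h), fun i j => ?_⟩
    have hi : y (g i) = pt := (Finset.mem_filter.1 (g i).2).2
    have hj : y (g j) = pt := (Finset.mem_filter.1 (g j).2).2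
    exact ⟨hyn _, hyn _, pt, hi ▸ hy2 _, hj ▸ hy2 _⟩

/-! ### The shifts -/

/-- The translations that are tried. -/
def shift (K : ℕ) (W m₀ : ℝ) (j : ℕ) : ℝ := j / K * W - m₀

/-- Failing to fit means that a grid line hits the translated extent. Modulo the grid `2^e`, with `e
≤ M`, different shifts are at distance at least `2^e / K` since the odd `K` is prime to powers of
two. Two hits would place them within the width, which is less than `2^e / (2K)`. -/
theorem not_fits_unique (hS : ∀ i, IsObject (S i)) (hK : Odd K) {m₀ : ℝ} {M : ℤ} {o : ℕ}
    {i : Fin d} (hlo : m₀ ≤ lo S o i) (hup : up S o i - m₀ < 2 ^ M) {j j' : ℕ} (hj : j < K)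
    (hj' : j' < K)
    (h : ¬ Fits S K (shift K (2 ^ M) m₀ j) o i) (h' : ¬ Fits S K (shift K (2 ^ M) m₀ j') o i) :
    j = j' := by
  have hKpos : 0 < K := by omega
  have hK0 : (0 : ℝ) < K := Nat.cast_pos.2 hKpos
  have hW : (0 : ℝ) < 2 ^ M := by positivity
  by_cases hw : width S o ≤ 0
  · refine absurd (Or.inr ?_) h
    rw [corner, if_pos hw]
    linarith [le_width (S := S) o i]
  obtain ⟨e, he, h2, -⟩ := side_spec hKpos (not_le.1 hw)
  have hs : (0 : ℝ) < 2 ^ e := by positivity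
  have hlu := lo_le_up hS o i
  have hwid := le_width (S := S) o i
  have grid : ∀ j, j < K → ¬ Fits S K (shift K (2 ^ M) m₀ j) o i → ∃ z : ℤ,
      lo S o i - m₀ + j / K * 2 ^ M < z * 2 ^ e ∧ z * 2 ^ e ≤ up S o i - m₀ + j / K * 2 ^ M := by
    intro j _ h
    unfold Fits at h
    push Not at h
    have h1 := h.1
    rw [corner, if_neg hw, he, dyadicFloor_zpow] at h1
    refine ⟨⌊(lo S o i + shift K (2 ^ M) m₀ j) / (2 : ℝ) ^ e⌋ + 1, ?_, ?_⟩
    · have := (div_lt_iff₀ hs).1 (Int.lt_floor_add_one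
        ((lo S o i + shift K (2 ^ M) m₀ j) / (2 : ℝ) ^ e))
      push_cast
      unfold shift at this ⊢
      linarith
    · push_cast
      unfold shift at h1 ⊢
      linarith
  obtain ⟨z, hz1, hz2⟩ := grid j hj h
  obtain ⟨z', hz1', hz2'⟩ := grid j' hj' h'
  rcases le_or_gt e M with heM | heM
  · obtain ⟨a, rfl⟩ := Int.le.dest heM
    rw [zpow_add₀ two_ne_zero, zpow_natCast] at *
    -- After subtracting the shifts, both grid lines lie in the same untranslated extent, so they
    -- differ by at most the width. Multiplying by `K` turns this into an integer multiple of `2^e`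
    -- that is smaller than `2^e`, hence zero.
    have hab : |(((K : ℤ) * (z - z') - ((j : ℤ) - j') * 2 ^ a : ℤ) : ℝ) * 2 ^ e| < 1 * 2 ^ e := by
      have e1 : (((K : ℤ) * (z - z') - ((j : ℤ) - j') * 2 ^ a : ℤ) : ℝ) * 2 ^ e =
          K * ((z * 2 ^ e - j / K * (2 ^ e * 2 ^ a)) -
            (z' * 2 ^ e - j' / K * (2 ^ e * 2 ^ a))) := by
        push_cast; field_simp; ring
      rw [e1, abs_mul, abs_of_pos hK0]
      have e2 : |((z : ℝ) * 2 ^ e - j / K * (2 ^ e * 2 ^ a)) -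
            (z' * 2 ^ e - j' / K * (2 ^ e * 2 ^ a))| ≤ width S o := by
        rw [abs_le]; constructor <;> linarith
      have e3 := mul_le_mul_of_nonneg_left e2 hK0.le
      have e4 : 0 < K * width S o := mul_pos hK0 (not_le.1 hw)
      linarith
    rw [abs_mul, abs_of_pos hs] at hab
    have h3 := lt_of_mul_lt_mul_right hab hs.le
    rw [← Int.cast_abs] at h3
    have h4 : |(K : ℤ) * (z - z') - ((j : ℤ) - j') * 2 ^ a| < 1 := by exact_mod_cast h3
    have h5 := Int.abs_lt_one_iff.1 h4
    have h6 : (K : ℤ) ∣ ((j : ℤ) - j') * 2 ^ a := ⟨z - z', by linarith⟩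
    have hcop : IsCoprime (K : ℤ) (2 ^ a) := by
      refine IsCoprime.pow_right ?_
      exact Nat.isCoprime_iff_coprime.2 (Nat.coprime_two_right.2 hK)
    have h7 := hcop.dvd_of_dvd_mul_right h6
    have h8 : (j : ℤ) - j' = 0 := by
      refine Int.eq_zero_of_abs_lt_dvd h7 ?_
      rw [abs_lt]; constructor <;> omega
    omega
  · exfalso
    -- For cells larger than the whole extent, every translate lies between `0` and `2 * 2^M ≤ 2^e`,
    -- so no grid line can be hit at all.
    have hWs : 2 * (2 : ℝ) ^ M ≤ 2 ^ e := by
      have := zpow_le_zpow_right₀ (one_le_two (α := ℝ)) (show M + 1 ≤ e by omega)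
      rw [zpow_add_one₀ two_ne_zero] at this
      linarith
    have hjK : (j : ℝ) / K ≤ 1 := by
      rw [div_le_one hK0]; exact_mod_cast hj.le
    have hjK0 : (0 : ℝ) ≤ j / K := by positivity
    have h3 : (j : ℝ) / K * 2 ^ M ≤ 1 * 2 ^ M := mul_le_mul_of_nonneg_right hjK hW.le
    have h4 : (0 : ℝ) ≤ j / K * 2 ^ M := by positivity
    have h5 : (z : ℝ) * 2 ^ e < 1 * 2 ^ e := by linarith
    have h6 : 0 * (2 : ℝ) ^ e < z * 2 ^ e := by linarith
    have h7 : (z : ℝ) < 1 := lt_of_mul_lt_mul_right h5 hs.le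
    have h8 : (0 : ℝ) < z := lt_of_mul_lt_mul_right h6 hs.le
    have h9 : z < 1 := by exact_mod_cast h7
    have h10 : 0 < z := by exact_mod_cast h8
    omega

/-- If every shift failed, sending it to a failing pair of vertex and axis would inject `2kd + 1`
shifts into `kd` pairs. The number `kd + 1` would suffice for counting; the factor two ensures
oddness. -/
theorem exists_shift_good (hS : ∀ i, IsObject (S i)) {m₀ : ℝ} {M : ℤ}
    (hlo : ∀ o i, m₀ ≤ lo S o i) (hup : ∀ o i, up S o i - m₀ < 2 ^ M) {k : ℕ} (f : Fin k → ℕ) :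
    ∃ j < 2 * (k * d) + 1, ∀ v, Good S (2 * (k * d) + 1) (shift (2 * (k * d) + 1) (2 ^ M) m₀ j)
      (f v) := by
  by_contra hcon
  push Not at hcon
  have h1 : ∀ j : Fin (2 * (k * d) + 1), ∃ x : Fin k × Fin d,
      ¬ Fits S (2 * (k * d) + 1) (shift (2 * (k * d) + 1) (2 ^ M) m₀ j) (f x.1) x.2 := by
    intro j
    obtain ⟨v, hv⟩ := hcon j j.2
    unfold Good at hv
    push Not at hv
    obtain ⟨i, hi⟩ := hv
    exact ⟨(v, i), hi⟩
  choose x hx using h1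
  have hinj : Function.Injective x := by
    intro j j' hjj
    refine Fin.ext (not_fits_unique hS ⟨_, rfl⟩ (hlo _ _) (hup _ _) j.2 j'.2 (hx j) ?_)
    rw [hjj]; exact hx j'
  have := Fintype.card_le_of_injective x hinj
  simp at this
  omega

end Objects

end FatSubgraph

end

noncomputable section

namespace FatSubgraph

/-! ### Merge sort -/

/-- The list `l` is stored in the array `A` from position `p` on. -/
def Seg (A : ℕ → ℕ) : ℕ → List ℕ → Prop
  | _, [] => True
  | p, x :: l => A p = x ∧ Seg A (p + 1) l

theorem seg_append {A : ℕ → ℕ} {p : ℕ} {l l' : List ℕ} :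
    Seg A p (l ++ l') ↔ Seg A p l ∧ Seg A (p + l.length) l' := by
  induction l generalizing p with
  | nil => simp [Seg]
  | cons x l ih =>
    simp only [List.cons_append, Seg, ih, List.length_cons, and_assoc]
    rw [show p + 1 + l.length = p + (l.length + 1) by omega]

theorem Seg.congr {A A' : ℕ → ℕ} {p : ℕ} {l : List ℕ} (h : Seg A p l)
    (hA : ∀ q, p ≤ q → q < p + l.length → A' q = A q) : Seg A' p l := by
  induction l generalizing p with
  | nil => trivial
  | cons x l ih =>
    refine ⟨(hA p le_rfl (by simp)).trans h.1, ih h.2 fun q h1 h2 => hA q (by omega) ?_⟩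
    simp only [List.length_cons]; omega

theorem seg_iff {A : ℕ → ℕ} {p : ℕ} {l : List ℕ} :
    Seg A p l ↔ ∀ (q : ℕ) (hq : q < l.length), A (p + q) = l[q] := by
  induction l generalizing p with
  | nil => simp [Seg]
  | cons x l ih =>
    simp only [Seg, ih]
    constructor
    · rintro ⟨h1, h2⟩ q hq
      cases q with
      | zero => simpa using h1
      | succ q =>
        have := h2 q (by simpa using hq)
        simp only [List.getElem_cons_succ]
        rw [← this]; congr 1; omega
    · intro h
      refine ⟨h 0 (by simp), fun q hq => ?_⟩
      have := h (q + 1) (by simpa using hq)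
      simp only [List.getElem_cons_succ] at this
      rw [← this]; congr 1; omega

/-- The lists `rs` are stored consecutively in the array `A`, with boundaries in `B` from
position `r` on. -/
def RunsAt (A B : ℕ → ℕ) : ℕ → List (List ℕ) → Prop
  | _, [] => True
  | r, l :: rs => (Seg A (B r) l ∧ B (r + 1) = B r + l.length) ∧ RunsAt A B (r + 1) rs

theorem runsAt_append {A B : ℕ → ℕ} {r : ℕ} {rs rs' : List (List ℕ)} :
    RunsAt A B r (rs ++ rs') ↔ RunsAt A B r rs ∧ RunsAt A B (r + rs.length) rs' := by
  induction rs generalizing r with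
  | nil => simp [RunsAt]
  | cons l rs ih =>
    simp only [List.cons_append, RunsAt, ih, List.length_cons, and_assoc]
    rw [show r + 1 + rs.length = r + (rs.length + 1) by omega]

theorem RunsAt.le {A B : ℕ → ℕ} {r : ℕ} {rs : List (List ℕ)} (h : RunsAt A B r rs) :
    B r ≤ B (r + rs.length) := by
  induction rs generalizing r with
  | nil => simp
  | cons l rs ih =>
    have := ih h.2
    rw [show r + 1 + rs.length = r + (l :: rs).length by simp; omega, h.1.2] at this
    omega

theorem RunsAt.congr {A A' B B' : ℕ → ℕ} {r : ℕ} {rs : List (List ℕ)} (h : RunsAt A B r rs)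
    (hB : ∀ q, q ≤ r + rs.length → B' q = B q)
    (hA : ∀ q, q < B (r + rs.length) → A' q = A q) : RunsAt A' B' r rs := by
  induction rs generalizing r with
  | nil => trivial
  | cons l rs ih =>
    have h1 := RunsAt.le h.2
    have e : r + 1 + rs.length = r + (l :: rs).length := by simp; omega
    rw [← e] at hA hB
    refine ⟨⟨?_, ?_⟩, ih h.2 hB hA⟩
    · rw [hB r (by omega)]
      refine h.1.1.congr fun q _ hq => hA q ?_
      rw [h.1.2] at h1
      omega
    · rw [hB r (by omega), hB (r + 1) (by omega), h.1.2]

section MergeSort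

variable {d n : ℕ} {S : Fin n → Set (Fin d → ℝ)}

/-- The merging step: moves the smaller one of the two front elements to the output. -/
def mergeBody (cmp : NExp → NExp → BExp d) : Prog d :=
  .seq (.ite (.and (.natLt (.var 8) (.var 9)) (.or (.not (.natLt (.var 10) (.var 11)))
      (cmp (.get 4 (.var 8)) (.get 4 (.var 10)))))
    (.seq (.setNat 4 (.var 12) (.get 4 (.var 8)))
      (.setNat 8 (.lit 0) (.add (.var 8) (.lit 1))))
    (.seq (.setNat 4 (.var 12) (.get 4 (.var 10)))
      (.setNat 10 (.lit 0) (.add (.var 10) (.lit 1)))))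
    (.setNat 12 (.lit 0) (.add (.var 12) (.lit 1)))

/-- The merging loop continues while there are elements left. -/
def mergeTest : BExp d := .or (.natLt (.var 8) (.var 9)) (.natLt (.var 10) (.var 11))

theorem loopFree_mergeBody (cmp : NExp → NExp → BExp d) : (mergeBody cmp).LoopFree := by
  simp [mergeBody, Prog.LoopFree]

/-- The test `cmp` implements the relation `le` on the indices below `n`, as long as the real
part of the memory is `ρ`. -/
def Implements (S : Fin n → Set (Fin d → ℝ)) (cmp : NExp → NExp → BExp d) (le : ℕ → ℕ → Prop)
    (ρ : ℕ → ℕ → ℝ) : Prop :=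
  ∀ (m : Memory) (e f : NExp), m.real = ρ → e.val m < n → f.val m < n →
    ((cmp e f).Holds S m ↔ le (e.val m) (f.val m))

open Classical in
/-- Merge of two lists. -/
def mergeBy (le : ℕ → ℕ → Prop) (l l' : List ℕ) : List ℕ := l.merge l' fun a b => decide (le a b)

/-- The loop invariant is that the output so far, followed by the merge of the unread rests, equals
the final merge. Writing never damages the sources, because by `hp₁` and `hp₂` the output starts
after both runs. -/
theorem reach_merge {cmp : NExp → NExp → BExp d} {le : ℕ → ℕ → Prop} {ρ : ℕ → ℕ → ℝ}
    (hcmp : Implements S cmp le ρ) (m : Memory) (hρ : m.real = ρ) (l₁ l₂ : List ℕ)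
    (h₁ : ∀ x ∈ l₁, x < n) (h₂ : ∀ x ∈ l₂, x < n)
    (hs₁ : Seg (m.nat 4) (m.nat 8 0) l₁) (he₁ : m.nat 9 0 = m.nat 8 0 + l₁.length)
    (hs₂ : Seg (m.nat 4) (m.nat 10 0) l₂) (he₂ : m.nat 11 0 = m.nat 10 0 + l₂.length)
    (hp₁ : m.nat 9 0 ≤ m.nat 12 0) (hp₂ : m.nat 11 0 ≤ m.nat 12 0) :
    Reach S (.loop mergeTest (mergeBody cmp)) m
      (((mergeTest : BExp d).cost + (mergeBody cmp).bound + 1) * (l₁.length + l₂.length + 1))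
      fun m' => m'.real = ρ ∧ Seg (m'.nat 4) (m.nat 12 0) (mergeBy le l₁ l₂) ∧
        m'.nat 12 0 = m.nat 12 0 + (l₁.length + l₂.length) ∧
        (∀ q < m.nat 12 0, m'.nat 4 q = m.nat 4 q) ∧
        (∀ a, a ≠ 4 → a ≠ 8 → a ≠ 10 → a ≠ 12 → m'.nat a = m.nat a) := by
  classical
  refine Reach.mono (Reach.loop_measure (loopFree_mergeBody cmp)
    (fun m' => m'.real = ρ ∧ (∀ q < m.nat 12 0, m'.nat 4 q = m.nat 4 q) ∧
      (∀ a, a ≠ 4 → a ≠ 8 → a ≠ 10 → a ≠ 12 → m'.nat a = m.nat a) ∧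
      ∃ r₁ r₂ out, (∀ x ∈ r₁, x < n) ∧ (∀ x ∈ r₂, x < n) ∧
        Seg (m'.nat 4) (m'.nat 8 0) r₁ ∧ m.nat 9 0 = m'.nat 8 0 + r₁.length ∧
        Seg (m'.nat 4) (m'.nat 10 0) r₂ ∧ m.nat 11 0 = m'.nat 10 0 + r₂.length ∧
        Seg (m'.nat 4) (m.nat 12 0) out ∧ m'.nat 12 0 = m.nat 12 0 + out.length ∧
        out ++ mergeBy le r₁ r₂ = mergeBy le l₁ l₂)
    (fun m' => (m'.nat 9 0 - m'.nat 8 0) + (m'.nat 11 0 - m'.nat 10 0)) ?_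
    ⟨hρ, fun _ _ => rfl, fun _ _ _ _ _ => rfl, l₁, l₂, [], h₁, h₂, hs₁, he₁, hs₂, he₂, trivial,
      by simp, by simp⟩ le_rfl) ?_ ?_
  · rintro m' ⟨hρ', hlow, hfr, r₁, r₂, out, g₁, g₂, s₁, e₁, s₂, e₂, so, eo, heq⟩ hb
    have f9 : m'.nat 9 = m.nat 9 := hfr 9 (by simp) (by simp) (by simp) (by simp)
    have f11 : m'.nat 11 = m.nat 11 := hfr 11 (by simp) (by simp) (by simp) (by simp)
    have hb' : m'.nat 8 0 < m.nat 9 0 ∨ m'.nat 10 0 < m.nat 11 0 := by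
      simpa [mergeTest, NExp.val, f9, f11] using hb
    -- the effect of one step, depending on the outcome of the test
    by_cases ht : m'.nat 8 0 < m.nat 9 0 ∧ (m.nat 11 0 ≤ m'.nat 10 0 ∨
        le (m'.nat 4 (m'.nat 8 0)) (m'.nat 4 (m'.nat 10 0)))
    · obtain ⟨x, r₁', rfl⟩ : ∃ x r₁', r₁ = x :: r₁' := by
        cases r₁ with
        | nil => simp at e₁; omega
        | cons x r => exact ⟨x, r, rfl⟩
      have hholds : (BExp.and (.natLt (.var 8) (.var 9)) (.or (.not (.natLt (.var 10) (.var 11)))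
          (cmp (.get 4 (.var 8)) (.get 4 (.var 10))))).Holds S m' := by
        simp only [BExp.Holds, BExp.holds_natLt, BExp.holds_or, NExp.val, f9, f11, not_lt]
        refine ⟨ht.1, ?_⟩
        by_cases hj : m.nat 11 0 ≤ m'.nat 10 0
        · exact Or.inl hj
        · right
          obtain ⟨y, r₂', rfl⟩ : ∃ y r₂', r₂ = y :: r₂' := by
            cases r₂ with
            | nil => simp at e₂; omega
            | cons y r => exact ⟨y, r, rfl⟩
          rw [hcmp m' _ _ hρ' (by simpa [NExp.val, s₁.1] using g₁ x (by simp))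
            (by simpa [NExp.val, s₂.1] using g₂ y (by simp))]
          exact ht.2.resolve_left hj
      simp only [mergeBody, exec, if_pos hholds]
      simp only [NExp.val, update_apply]
      simp only [List.length_cons] at e₁
      refine ⟨⟨hρ', ?_, ?_, r₁', r₂, out ++ [x], fun y hy => g₁ y (by simp [hy]), g₂, ?_, ?_, ?_,
        ?_, ?_, ?_, ?_⟩, ?_⟩
      · intro q hq
        simp [show q ≠ m'.nat 12 0 by omega, hlow q hq]
      · intro a h4 h8 h10 h12
        funext j
        simp [update_apply, h4, h8, h12, hfr a h4 h8 h10 h12]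
      · simp
        refine s₁.2.congr fun q h1 h2 => ?_
        simp [update_apply]; intro; omega
      · simp; omega
      · simp
        refine s₂.congr fun q h1 h2 => ?_
        simp [update_apply]; intro; omega
      · simp; omega
      · rw [seg_append]
        refine ⟨so.congr fun q h1 h2 => ?_, ?_⟩
        · simp [update_apply]; intro; omega
        · simp [Seg, eo, s₁.1, update_apply]
      · simp; omega
      · rw [← heq, List.append_assoc]
        congr 1
        cases r₂ with
        | nil => simp [mergeBy]
        | cons y r₂ =>
          have : le x y := by
            have := ht.2.resolve_left (by simp at e₂; omega)
            rwa [s₁.1, s₂.1] at this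
          simp [mergeBy, this]
      · simp [f9, f11]; omega
    · obtain ⟨y, r₂', rfl⟩ : ∃ y r₂', r₂ = y :: r₂' := by
        cases r₂ with
        | nil =>
          simp at e₂
          exact absurd ⟨by omega, Or.inl (by omega)⟩ ht
        | cons y r => exact ⟨y, r, rfl⟩
      simp only [List.length_cons] at e₂
      have hholds : ¬ (BExp.and (.natLt (.var 8) (.var 9))
          (.or (.not (.natLt (.var 10) (.var 11)))
          (cmp (.get 4 (.var 8)) (.get 4 (.var 10))))).Holds S m' := by
        simp only [BExp.Holds, BExp.holds_natLt, BExp.holds_or, NExp.val, f9, f11, not_lt]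
        rintro ⟨h1, h2⟩
        obtain ⟨x, r₁', rfl⟩ : ∃ x r₁', r₁ = x :: r₁' := by
          cases r₁ with
          | nil => simp at e₁; omega
          | cons x r => exact ⟨x, r, rfl⟩
        rw [hcmp m' _ _ hρ' (by simpa [NExp.val, s₁.1] using g₁ x (by simp))
            (by simpa [NExp.val, s₂.1] using g₂ y (by simp))] at h2
        exact ht ⟨h1, h2⟩
      simp only [mergeBody, exec, if_neg hholds]
      simp only [NExp.val, update_apply]
      refine ⟨⟨hρ', ?_, ?_, r₁, r₂', out ++ [y], g₁, fun x hx => g₂ x (by simp [hx]), ?_, ?_, ?_,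
        ?_, ?_, ?_, ?_⟩, ?_⟩
      · intro q hq
        simp [show q ≠ m'.nat 12 0 by omega, hlow q hq]
      · intro a h4 h8 h10 h12
        funext j
        simp [update_apply, h4, h10, h12, hfr a h4 h8 h10 h12]
      · simp
        refine s₁.congr fun q h1 h2 => ?_
        simp [update_apply]; intro; omega
      · simp; omega
      · simp
        refine s₂.2.congr fun q h1 h2 => ?_
        simp [update_apply]; intro; omega
      · simp; omega
      · rw [seg_append]
        refine ⟨so.congr fun q h1 h2 => ?_, ?_⟩
        · simp [update_apply]; intro; omega
        · simp [Seg, eo, s₂.1, update_apply]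
      · simp; omega
      · rw [← heq, List.append_assoc]
        congr 1
        cases r₁ with
        | nil => simp [mergeBy]
        | cons x r₁ =>
          have : ¬ le x y := fun hle => ht ⟨by simp at e₁; omega, Or.inr (by
            rwa [s₁.1, s₂.1])⟩
          simp [mergeBy, this]
      · simp [f9, f11]; omega
  · exact Nat.mul_le_mul_left _ (by omega)
  · rintro m' ⟨⟨hρ', hlow, hfr, r₁, r₂, out, g₁, g₂, s₁, e₁, s₂, e₂, so, eo, heq⟩, hb⟩
    have f9 : m'.nat 9 = m.nat 9 := hfr 9 (by simp) (by simp) (by simp) (by simp)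
    have f11 : m'.nat 11 = m.nat 11 := hfr 11 (by simp) (by simp) (by simp) (by simp)
    have hb' : m.nat 9 0 ≤ m'.nat 8 0 ∧ m.nat 11 0 ≤ m'.nat 10 0 := by
      simpa [mergeTest, NExp.val, f9, f11] using hb
    have h1 : r₁ = [] := List.length_eq_zero_iff.1 (by omega)
    have h2 : r₂ = [] := List.length_eq_zero_iff.1 (by omega)
    subst h1 h2
    have : out = mergeBy le l₁ l₂ := by simpa [mergeBy] using heq
    subst this
    refine ⟨hρ', so, ?_, hlow, hfr⟩
    rw [eo]; simp [mergeBy]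

end MergeSort

end FatSubgraph

end

noncomputable section

namespace FatSubgraph

/-! ### Bottom-up merge sort on a queue of runs, and its running time. -/

section MergeSortLoop

variable {d n : ℕ} {S : Fin n → Set (Fin d → ℝ)}

/-- Loads the boundaries of the first two runs and of the free space. -/
def mergePre : Prog d :=
  seqs [.setNat 8 (.lit 0) (.get 5 (.var 6)),
    .setNat 9 (.lit 0) (.get 5 (.add (.var 6) (.lit 1))),
    .setNat 10 (.lit 0) (.get 5 (.add (.var 6) (.lit 1))),
    .setNat 11 (.lit 0) (.get 5 (.add (.var 6) (.lit 2))),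
    .setNat 12 (.lit 0) (.get 5 (.var 7))]

/-- Registers the merged run and drops the first two runs. -/
def mergePost : Prog d :=
  seqs [.setNat 7 (.lit 0) (.add (.var 7) (.lit 1)),
    .setNat 5 (.var 7) (.var 12),
    .setNat 6 (.lit 0) (.add (.var 6) (.lit 2))]

/-- One round of the sorting loop. -/
def sortBody (cmp : NExp → NExp → BExp d) : Prog d :=
  .seq mergePre (.seq (.loop mergeTest (mergeBody cmp)) mergePost)

/-- The factor in the running time of one round of the sorting loop. -/
def sortBodyCost (cmp : NExp → NExp → BExp d) : ℕ :=
  (mergePre : Prog d).bound + (((mergeTest : BExp d).cost + (mergeBody cmp).bound + 1) +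
    (mergePost : Prog d).bound)

/-- Array `4` holds the runs and array `5` their boundaries; cells `6` and `7` delimit the queue.
The merged run is written after all existing runs and space is never reclaimed, so the remaining
runs stay intact. -/
theorem reach_sortBody {cmp : NExp → NExp → BExp d} {le : ℕ → ℕ → Prop} {ρ : ℕ → ℕ → ℝ}
    (hcmp : Implements S cmp le ρ) (m : Memory) (hρ : m.real = ρ) (l₁ l₂ : List ℕ)
    (rest : List (List ℕ)) (h₁ : ∀ x ∈ l₁, x < n) (h₂ : ∀ x ∈ l₂, x < n)
    (hr : RunsAt (m.nat 4) (m.nat 5) (m.nat 6 0) (l₁ :: l₂ :: rest))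
    (he : m.nat 7 0 = m.nat 6 0 + (rest.length + 2)) :
    Reach S (sortBody cmp) m (sortBodyCost cmp * (l₁.length + l₂.length + 1))
      fun m' => m'.real = ρ ∧
        RunsAt (m'.nat 4) (m'.nat 5) (m'.nat 6 0) (rest ++ [mergeBy le l₁ l₂]) ∧
        m'.nat 7 0 = m'.nat 6 0 + (rest.length + 1) ∧
        (∀ a, a < 4 ∨ 12 < a → m'.nat a = m.nat a) := by
  obtain ⟨⟨hs₁, hb₁⟩, ⟨hs₂, hb₂⟩, hrest⟩ := hr
  have hle := hrest.le
  have e2 : m.nat 6 0 + 1 + 1 = m.nat 6 0 + 2 := rfl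
  rw [e2] at hb₂ hrest hle
  rw [show m.nat 6 0 + 2 + rest.length = m.nat 7 0 by omega] at hle
  have hpre : (mergePre : Prog d).LoopFree := by simp [mergePre, seqs, Prog.LoopFree]
  have hpost : (mergePost : Prog d).LoopFree := by simp [mergePost, seqs, Prog.LoopFree]
  obtain ⟨M, hM, hMr, h4, h5, h6, h7, h8, h9, h10, h11, h12, hMf⟩ : ∃ M, exec S mergePre m = M ∧
      M.real = ρ ∧ M.nat 4 = m.nat 4 ∧ M.nat 5 = m.nat 5 ∧ M.nat 6 = m.nat 6 ∧
      M.nat 7 = m.nat 7 ∧ M.nat 8 0 = m.nat 5 (m.nat 6 0) ∧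
      M.nat 9 0 = m.nat 5 (m.nat 6 0 + 1) ∧ M.nat 10 0 = m.nat 5 (m.nat 6 0 + 1) ∧
      M.nat 11 0 = m.nat 5 (m.nat 6 0 + 2) ∧ M.nat 12 0 = m.nat 5 (m.nat 7 0) ∧
      (∀ a, a < 4 ∨ 12 < a → M.nat a = m.nat a) := by
    refine ⟨_, rfl, ?_⟩
    simp only [mergePre, seqs, exec, NExp.val]
    refine ⟨hρ, ?_, ?_, ?_, ?_, ?_, ?_, ?_, ?_, ?_, ?_⟩
    iterate 4 funext j; simp [update_apply]
    iterate 5 simp [update_apply]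
    intro a ha
    funext j
    simp only [update_apply]
    rw [if_neg (by omega), if_neg (by omega), if_neg (by omega), if_neg (by omega),
      if_neg (by omega)]
  refine Reach.mono (Reach.seq (T' := ((mergeTest : BExp d).cost + (mergeBody cmp).bound + 1) *
    (l₁.length + l₂.length + 1) + (mergePost : Prog d).bound) (hpre.reach (Q := fun m' => m' = M) le_rfl hM) fun m' hm' => ?_) ?_ fun _ h => h
  · rw [hm']
    refine Reach.seq (reach_merge hcmp M hMr l₁ l₂ h₁ h₂ (by rwa [h4, h8]) (by rw [h9, h8, hb₁])
      (by rwa [h4, h10]) (by rw [h11, h10, hb₂]) (by rw [h9, h12]; omega)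
      (by rw [h11, h12]; omega)) ?_
    rintro M' ⟨hr', hseg, hp, hlow, hfr⟩
    refine hpost.reach le_rfl ?_
    have g5 : M'.nat 5 = m.nat 5 :=
      (hfr 5 (by simp) (by simp) (by simp) (by simp)).trans h5
    have g6 : M'.nat 6 = m.nat 6 :=
      (hfr 6 (by simp) (by simp) (by simp) (by simp)).trans h6
    have g7 : M'.nat 7 = m.nat 7 :=
      (hfr 7 (by simp) (by simp) (by simp) (by simp)).trans h7
    rw [h12] at hseg hp hlow
    simp only [mergePost, seqs, exec, NExp.val]
    refine ⟨hr', ?_, ?_, ?_⟩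
    · rw [runsAt_append]
      constructor
      · simp [update_apply, g6]
        refine hrest.congr ?_ ?_
        · intro q hq
          simp [update_apply, g5, g7]; intro; omega
        · intro q hq
          rw [show m.nat 6 0 + 2 + rest.length = m.nat 7 0 by omega] at hq
          simp [update_apply, hlow q hq, h4]
      · have e3 : m.nat 6 0 + 2 + rest.length = m.nat 7 0 := by omega
        have hlen : (mergeBy le l₁ l₂).length = l₁.length + l₂.length := by simp [mergeBy]
        refine ⟨⟨?_, ?_⟩, trivial⟩
        · simp [update_apply, g5, g6, g7, e3]
          refine hseg.congr fun q _ _ => ?_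
          simp [update_apply]
        · simp [update_apply, g5, g6, g7, e3, hlen, hp]
    · simp [update_apply, g6, g7]; omega
    · intro a ha
      funext j
      simp only [update_apply]
      rw [if_neg (by omega), if_neg (by omega), if_neg (by omega),
        hfr a (by omega) (by omega) (by omega) (by omega), hMf a ha]
  · unfold sortBodyCost
    generalize (mergeTest : BExp d).cost + (mergeBody cmp).bound + 1 = A
    rw [add_mul, add_mul]
    exact Nat.add_le_add (Nat.le_mul_of_pos_right _ (Nat.succ_pos _))
      (Nat.add_le_add le_rfl (Nat.le_mul_of_pos_right _ (Nat.succ_pos _)))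

/-- The sorting loop continues while there are two runs. -/
def sortTest : BExp d := .natLt (.add (.var 6) (.lit 1)) (.var 7)

/-- The sorting program, started with singleton runs; it ends with the pointers to the beginning
and the end of the sorted run in the cells `8` and `9`. -/
def sortProg (cmp : NExp → NExp → BExp d) : Prog d :=
  .seq (.loop sortTest (sortBody cmp))
    (.seq (.setNat 8 (.lit 0) (.get 5 (.var 6))) (.setNat 9 (.lit 0) (.get 5 (.var 7))))

/-- Potential of the queue of runs; `us` are the runs not yet merged in the current pass. -/
def sortPot (M : ℕ) (us qs : List (List ℕ)) : ℕ :=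
  us.flatten.length + M * Nat.clog 2 (qs.length + (us.length + 1) / 2) + (us.length + qs.length)

/-- When fewer than two unmerged runs are left, a new pass begins in which all runs count as
unmerged. This raises the first term of the potential to at most the total length `M`, paid for by
the drop of the logarithm by one as the anticipated number of runs halves. -/
theorem exists_sortPot_le (us qs : List (List ℕ)) (h : 2 ≤ (us ++ qs).length) :
    ∃ us' qs', us ++ qs = us' ++ qs' ∧ 2 ≤ us'.length ∧
      sortPot (us ++ qs).flatten.length us' qs' ≤ sortPot (us ++ qs).flatten.length us qs := by
  by_cases hu : 2 ≤ us.length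
  · exact ⟨us, qs, rfl, hu, le_rfl⟩
  · refine ⟨us ++ qs, [], by simp, h, ?_⟩
    have hc : Nat.clog 2 (us ++ qs).length = Nat.clog 2 (((us ++ qs).length + 1) / 2) + 1 := by
      rw [Nat.clog_of_two_le (by norm_num) h,
        show (us ++ qs).length + 2 - 1 = (us ++ qs).length + 1 by omega]
    have e : qs.length + (us.length + 1) / 2 = (us ++ qs).length := by
      rw [List.length_append]; omega
    unfold sortPot
    rw [e, hc, Nat.mul_add, List.length_nil, Nat.zero_add, List.length_append]
    omega

theorem mul_pot_step (B t P q : ℕ) (hq : 1 ≤ q) :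
    t + B * q + (B + t + 1) * (P + 1) + 1 ≤ (B + t + 1) * (P + q + 1) := by
  have h := Nat.le_mul_of_pos_right (t + 1) hq
  have e : (B + t + 1) * (P + q + 1) = (B + t + 1) * (P + 1) + B * q + (t + 1) * q := by ring
  omega

theorem reach_sortProg {cmp : NExp → NExp → BExp d} {le : ℕ → ℕ → Prop} {ρ : ℕ → ℕ → ℝ}
    (hcmp : Implements S cmp le ρ) (htrans : ∀ a b c, le a b → le b c → le a c)
    (htotal : ∀ a b, le a b ∨ le b a) (m : Memory) (hρ : m.real = ρ) (l : List ℕ)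
    (hl : ∀ x ∈ l, x < n) (hr : RunsAt (m.nat 4) (m.nat 5) (m.nat 6 0) (l.map fun x => [x]))
    (he : m.nat 7 0 = m.nat 6 0 + l.length) :
    Reach S (sortProg cmp) m
      ((sortBodyCost cmp + (sortTest : BExp d).cost + 1) *
        (sortPot l.length (l.map fun x => [x]) [] + 1) + 10)
      fun m' => m'.real = ρ ∧
        (∃ l', l'.Perm l ∧ l'.Pairwise le ∧ Seg (m'.nat 4) (m'.nat 8 0) l' ∧
          m'.nat 9 0 = m'.nat 8 0 + l'.length) ∧
        (∀ a, a < 4 ∨ 12 < a → m'.nat a = m.nat a) := by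
  classical
  set C := sortBodyCost cmp + (sortTest : BExp d).cost + 1 with hC
  have hloop := Reach.loop (S := S) (b := sortTest) (p := sortBody cmp)
    (Q := fun m' => m'.real = ρ ∧ (∃ rs : List (List ℕ), rs.length ≤ 1 ∧ rs.flatten.Perm l ∧
        (∀ r ∈ rs, r.Pairwise le) ∧ RunsAt (m'.nat 4) (m'.nat 5) (m'.nat 6 0) rs ∧
        m'.nat 7 0 = m'.nat 6 0 + rs.length) ∧
        (∀ a, a < 4 ∨ 12 < a → m'.nat a = m.nat a))
    (fun w m' => m'.real = ρ ∧ (∃ us qs : List (List ℕ), (us ++ qs).flatten.Perm l ∧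
        (∀ r ∈ us ++ qs, r.Pairwise le) ∧
        RunsAt (m'.nat 4) (m'.nat 5) (m'.nat 6 0) (us ++ qs) ∧
        m'.nat 7 0 = m'.nat 6 0 + (us ++ qs).length ∧
        C * (sortPot l.length us qs + 1) ≤ w) ∧
        (∀ a, a < 4 ∨ 12 < a → m'.nat a = m.nat a))
    ?_ ?_ _ m ⟨hρ, ⟨l.map fun x => [x], [], ?_, ?_, by simpa using hr, by simpa using he, le_rfl⟩,
      fun _ _ => rfl⟩
  · refine Reach.seq hloop ?_
    rintro m' ⟨hρ', ⟨rs, hlen, hperm, hsort, hruns, hend⟩, hfr⟩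
    refine Prog.LoopFree.reach (by simp [Prog.LoopFree])
      (by simp [Prog.bound, NExp.cost]) ?_
    simp only [exec, NExp.val]
    refine ⟨hρ', ⟨rs.flatten, hperm, ?_, ?_, ?_⟩, ?_⟩
    · rcases rs with _ | ⟨r, _ | ⟨r', rs⟩⟩
      · simp
      · simpa using hsort
      · simp at hlen
    · rcases rs with _ | ⟨r, _ | ⟨r', rs⟩⟩
      · simp [Seg]
      · simp only [List.flatten_cons, List.flatten_nil, List.append_nil]
        refine Seg.congr (A := m'.nat 4) ?_ fun q _ _ => by simp [update_apply]
        simp only [update_apply]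
        simpa using hruns.1.1
      · simp at hlen
    · rcases rs with _ | ⟨r, _ | ⟨r', rs⟩⟩
      · simp at hend
        simp [update_apply, hend]
      · simp at hend
        simp [update_apply, hend, hruns.1.2]
      · simp at hlen
    · intro a ha
      funext j
      simp only [update_apply]
      rw [if_neg (by omega), if_neg (by omega), hfr a ha]
  · rintro w m' ⟨hρ', ⟨us₀, qs₀, hperm, hsort, hruns, hend, hw⟩, hfr⟩ hb
    have hb' : m'.nat 6 0 + 1 < m'.nat 7 0 := by simpa [sortTest, NExp.val] using hb
    have hM : (us₀ ++ qs₀).flatten.length = l.length := hperm.length_eq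
    obtain ⟨us, qs, heq, hlen, hpot⟩ := exists_sortPot_le us₀ qs₀ (by omega)
    rw [heq] at hperm hsort hruns hend
    rw [hM] at hpot
    obtain ⟨l₁, l₂, us, rfl⟩ : ∃ l₁ l₂ us', us = l₁ :: l₂ :: us' := by
      rcases us with _ | ⟨a, _ | ⟨b, us⟩⟩
      · simp at hlen
      · simp at hlen
      · exact ⟨a, b, us, rfl⟩
    have hmem : ∀ x ∈ (l₁ :: l₂ :: us ++ qs).flatten, x < n := fun x hx => hl x (hperm.subset hx)
    refine ⟨_, Reach.mono (reach_sortBody hcmp m' hρ' l₁ l₂ (us ++ qs) (fun x hx => hmem x (by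
      simp [hx])) (fun x hx => hmem x (by simp [hx])) hruns (by simpa using hend)) le_rfl ?_⟩
    rintro m'' ⟨hρ'', hruns', hend', hfr'⟩
    refine ⟨C * (sortPot l.length us (qs ++ [mergeBy le l₁ l₂]) + 1), ⟨hρ'',
      ⟨us, qs ++ [mergeBy le l₁ l₂], ?_, ?_, ?_, ?_, le_rfl⟩,
      fun a ha => (hfr' a ha).trans (hfr a ha)⟩, ?_⟩
    · refine List.Perm.trans ?_ hperm
      have h1 : (mergeBy le l₁ l₂).Perm (l₁ ++ l₂) := List.merge_perm_append _
      simp only [List.flatten_append, List.flatten_cons, List.flatten_nil, List.append_nil,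
        List.cons_append]
      rw [← List.append_assoc, ← List.append_assoc l₁]
      exact (List.Perm.append_left _ h1).trans List.perm_append_comm
    · intro r hr
      rw [← List.append_assoc, List.mem_append] at hr
      rcases hr with hr | hr
      · exact hsort r (by
          rw [List.cons_append, List.cons_append]
          exact List.mem_cons_of_mem _ (List.mem_cons_of_mem _ hr))
      · rw [List.mem_singleton] at hr
        subst hr
        have := List.pairwise_merge (le := fun a b => decide (le a b))
          (by simpa using htrans) (by simpa using htotal) l₁ l₂
          (by simpa using hsort l₁ (by simp)) (by simpa using hsort l₂ (by simp))
        simpa [mergeBy] using this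
    · rwa [← List.append_assoc]
    · rw [hend', ← List.append_assoc]; simp; omega
    · refine le_trans ?_ (le_trans (Nat.mul_le_mul_left C (Nat.succ_le_succ hpot)) hw)
      -- Merging two runs of a pass leaves the argument of the logarithm unchanged, so the potential
      -- falls exactly by the number of moved elements plus one run, matching the cost of the round.
      have e1 : sortPot l.length (l₁ :: l₂ :: us) qs =
          sortPot l.length us (qs ++ [mergeBy le l₁ l₂]) + (l₁.length + l₂.length + 1) := by
        unfold sortPot
        have : qs.length + ((l₁ :: l₂ :: us).length + 1) / 2 =
          (qs ++ [mergeBy le l₁ l₂]).length + (us.length + 1) / 2 := by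
          simp; omega
        rw [this]
        simp
        omega
      rw [Nat.succ_eq_add_one, e1, hC]
      generalize sortPot l.length us (qs ++ [mergeBy le l₁ l₂]) = P
      refine le_trans (le_of_eq ?_) (mul_pot_step (sortBodyCost cmp) (sortTest : BExp d).cost P
        (l₁.length + l₂.length + 1) (by omega))
      rfl
  · rintro w m' ⟨hρ', ⟨us, qs, hperm, hsort, hruns, hend, hw⟩, hfr⟩ hb
    have hb' : m'.nat 7 0 ≤ m'.nat 6 0 + 1 := by simpa [sortTest, NExp.val] using hb
    refine ⟨le_trans ?_ hw, hρ', ⟨us ++ qs, by omega, hperm, hsort, hruns, hend⟩, hfr⟩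
    refine le_trans ?_ (Nat.le_mul_of_pos_right _ (by omega))
    omega
  · have : ∀ l : List ℕ, (l.map fun x => [x]).flatten = l := fun l => by
      induction l with
      | nil => rfl
      | cons a l ih => simp [ih]
    rw [List.append_nil, this]
  · simp

end MergeSortLoop

end FatSubgraph

end

noncomputable section

namespace FatSubgraph

/-! ### Representative sets -/

section Representatives

variable {k : ℕ}

/-- `f` is an occurrence of `X` with vertices in `V`, where `I` is the intersection relation. -/
def Occ (X : SimpleGraph (Fin k)) (I : ℕ → ℕ → Prop) (V : Set ℕ) (f : Fin k → ℕ) : Prop :=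
  Function.Injective f ∧ (∀ v, f v ∈ V) ∧ ∀ v w, X.Adj v w → I (f v) (f w)

theorem Occ.mono {X : SimpleGraph (Fin k)} {I : ℕ → ℕ → Prop} {V V' : Set ℕ} {f : Fin k → ℕ}
    (h : Occ X I V f) (hV : V ⊆ V') : Occ X I V' f :=
  ⟨h.1, fun v => hV (h.2.1 v), h.2.2⟩

variable {P : Type} {b : ℕ}

/-- `g` is a partial embedding of `X` into the graph on `P` given by `τ`. -/
structure IsPart (X : SimpleGraph (Fin k)) (τ : P → P → Prop) (g : Fin k → Option P) : Prop where
  inj : ∀ v w p, g v = some p → g w = some p → v = w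
  refl : ∀ v p, g v = some p → τ p p
  adj : ∀ v w p q, X.Adj v w → g v = some p → g w = some q → τ p q

/-- A signature assigns to each vertex of `X` either nothing or a subset of the `b` boundary
objects. There are `(2^b + 1)^k` of them, and `R` collects the at most `k` images of one partial
embedding for each signature that is realised. -/
theorem exists_representatives [Fintype P] (X : SimpleGraph (Fin k)) (τ : P → P → Prop)
    (σ : P → Fin b → Prop) :
    ∃ R : Finset P, R.card ≤ (2 ^ b + 1) ^ k * k ∧ ∀ g, IsPart X τ g →
      ∃ g', IsPart X τ g' ∧ (∀ v, (g' v).map σ = (g v).map σ) ∧ ∀ v p, g' v = some p → p ∈ R := by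
  classical
  let rep : (Fin k → Option (Fin b → Prop)) → Fin k → Option P := fun s =>
    if h : ∃ g, IsPart X τ g ∧ ∀ v, (g v).map σ = s v then h.choose else fun _ => none
  have hrep : ∀ s, (∃ g, IsPart X τ g ∧ ∀ v, (g v).map σ = s v) →
      IsPart X τ (rep s) ∧ ∀ v, (rep s v).map σ = s v := by
    intro s h
    simp only [rep, dif_pos h]
    exact h.choose_spec
  refine ⟨Finset.univ.biUnion fun s => Finset.univ.biUnion fun v => (rep s v).toFinset,
    ?_, ?_⟩
  · refine (Finset.card_biUnion_le_card_mul _ _ k fun s _ => ?_).trans (le_of_eq ?_)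
    · refine (Finset.card_biUnion_le_card_mul _ _ 1 fun v _ => ?_).trans (le_of_eq (by simp))
      cases rep s v <;> simp
    · simp
  · intro g hg
    obtain ⟨h1, h2⟩ := hrep (fun v => (g v).map σ) ⟨g, hg, fun _ => rfl⟩
    refine ⟨_, h1, h2, fun v p hp => ?_⟩
    exact Finset.mem_biUnion.2 ⟨fun v => (g v).map σ, Finset.mem_univ _, Finset.mem_biUnion.2
      ⟨v, Finset.mem_univ _, Option.mem_toFinset.2 hp⟩⟩

theorem exists_selection [Fintype P] (X : SimpleGraph (Fin k)) (τ : P → P → Prop)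
    (σ : P → Fin b → Prop) :
    ∃ out : Fin ((2 ^ b + 1) ^ k * k) → Option P,
      (∀ q q' p, out q = some p → out q' = some p → q = q') ∧ ∀ g, IsPart X τ g →
      ∃ g', IsPart X τ g' ∧ (∀ v, (g' v).map σ = (g v).map σ) ∧
        ∀ v p, g' v = some p → ∃ q, out q = some p := by
  obtain ⟨R, hR, h⟩ := exists_representatives X τ σ
  refine ⟨fun q => if hq : (q : ℕ) < R.card then some (R.equivFin.symm ⟨q, hq⟩ : P) else none,
    ?_, fun g hg => ?_⟩
  · intro q q' p h1 h2
    dsimp only at h1 h2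
    split_ifs at h1 h2
    simp only [Option.some.injEq] at h1 h2
    have := R.equivFin.symm.injective (Subtype.ext (h1.trans h2.symm))
    exact Fin.ext (by simpa using this)
  · obtain ⟨g', h1, h2, h3⟩ := h g hg
    refine ⟨g', h1, h2, fun v p hp => ?_⟩
    set j := R.equivFin ⟨p, h3 v p hp⟩ with hj
    refine ⟨⟨j, j.2.trans_le hR⟩, ?_⟩
    dsimp only
    rw [dif_pos j.2]
    simp [hj]

/-- A choice of the objects to be kept. -/
def selection [Fintype P] (X : SimpleGraph (Fin k)) (τ : P → P → Prop) (σ : P → Fin b → Prop) :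
    Fin ((2 ^ b + 1) ^ k * k) → Option P :=
  (exists_selection X τ σ).choose

end Representatives

/-! ### The sweep -/

/-- What the sweep needs to know about intersection (`I`), meeting a closed cell (`mc`),
containment of cells (`anc`), the order of cells (`le`), and the sorted list `l`. -/
structure SweepCtx (n : ℕ) (I mc anc le : ℕ → ℕ → Prop) (l : List ℕ) : Prop where
  lt : ∀ x ∈ l, x < n
  nodup : l.Nodup
  sorted : l.Pairwise le
  symm : ∀ x y, I x y → I y x
  refl : ∀ x, I x x ↔ x < n
  anc_trans : ∀ x y z, anc x y → anc y z → anc x z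
  anc_between : ∀ x y z, anc x z → le x y → le y z → anc x y
  anc_of : ∀ x y, x ∈ l → y ∈ l → I x y → le x y → anc x y
  mc_mono : ∀ x y z, anc y z → mc x z → mc x y
  mc_of : ∀ x y, y ∈ l → I x y → mc x y
  mc_lt : ∀ x y, mc x y → x < n

section Sweep

variable {n k b L : ℕ} {X : SimpleGraph (Fin k)} {I mc anc le : ℕ → ℕ → Prop} {l : List ℕ}

/-- The objects that are still alive. -/
def alive (n : ℕ) (l : List ℕ) (h i : ℕ) (ob : ℕ → ℕ) (U : Fin L → ℕ → ℕ) : Set ℕ :=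
  {x | x < n ∧ ((∃ p, 1 ≤ p ∧ p ≤ h ∧ ob p = x) ∨ (∃ p ≤ h, ∃ q, U q p = x) ∨ x ∈ l.drop i)}

/-- Invariant of the sweep. -/
structure SweepInv (n : ℕ) (X : SimpleGraph (Fin k)) (I mc anc : ℕ → ℕ → Prop) (l : List ℕ)
    (h i : ℕ) (ob : ℕ → ℕ) (E : Fin b → ℕ → ℕ) (U : Fin L → ℕ → ℕ) : Prop where
  -- The first `i` list elements have been read. Level `0` is a base frame without an object, so
  -- stack objects have levels `1` to `h`; an entry of `E` or `U` that is not below `n` is an empty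
  -- slot.
  le_length : i ≤ l.length
  ob_mem : ∀ p, 1 ≤ p → p ≤ h → ob p ∈ l.take i
  U_mem : ∀ q p, p ≤ h → U q p < n → U q p ∈ l.take i
  ob_inj : ∀ p p', 1 ≤ p → p ≤ h → 1 ≤ p' → p' ≤ h → ob p = ob p' → p = p'
  U_inj : ∀ q p q' p', p ≤ h → p' ≤ h → U q p < n → U q p = U q' p' → q = q' ∧ p = p'
  U_ob : ∀ q p p', p ≤ h → U q p < n → 1 ≤ p' → p' ≤ h → U q p ≠ ob p'
  anc : ∀ p p', 1 ≤ p → p < p' → p' ≤ h → anc (ob p) (ob p')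
  -- Together with `E_mc`: the slots `E · p` list exactly the stack objects up to level `p` that
  -- meet the closed cell at level `p`.
  E_mem : ∀ q p, p ≤ h → E q p < n → ∃ p', 1 ≤ p' ∧ p' ≤ p ∧ ob p' = E q p ∧ mc (ob p') (ob p)
  E_mc : ∀ p p', 1 ≤ p' → p' ≤ p → p ≤ h → mc (ob p') (ob p) → ∃ q, E q p = ob p'
  E_inj : ∀ p q q', p ≤ h → E q p < n → E q p = E q' p → q = q'
  -- The separator property: an object kept at level `p` interacts with the living objects only
  -- inside its own frame or through the boundary list of that level.
  closed : ∀ q p x, p ≤ h → U q p < n → x ∈ alive n l h i ob U → I (U q p) x →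
    (∃ q', U q' p = x) ∨ ∃ q', E q' p = x
  complete : (∃ f, Occ X I {x | x ∈ l} f) → ∃ f, Occ X I (alive n l h i ob U) f

theorem SweepInv.init {ob : ℕ → ℕ} {E : Fin b → ℕ → ℕ} {U : Fin L → ℕ → ℕ}
    (hc : SweepCtx n I mc anc le l)
    (hE : ∀ q, n ≤ E q 0) (hU : ∀ q, n ≤ U q 0) : SweepInv n X I mc anc l 0 0 ob E U where
  le_length := by omega
  ob_mem p h1 h2 := by omega
  U_mem q p hp hlt := by
    obtain rfl : p = 0 := by omega
    exact absurd hlt (hU q).not_gt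
  ob_inj p p' h1 h2 := by omega
  U_inj q p q' p' hp hp' hlt := by
    obtain rfl : p = 0 := by omega
    exact absurd hlt (hU q).not_gt
  U_ob q p p' hp hlt h1 h2 := by omega
  anc p p' h1 h2 h3 := by omega
  E_mem q p hp hlt := by
    obtain rfl : p = 0 := by omega
    exact absurd hlt (hE q).not_gt
  E_mc p p' h1 h2 h3 := by omega
  E_inj p q q' hp hlt := by
    obtain rfl : p = 0 := by omega
    exact absurd hlt (hE q).not_gt
  closed q p x hp hlt := by
    obtain rfl : p = 0 := by omega
    exact absurd hlt (hU q).not_gt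
  complete := by
    rintro ⟨f, hf⟩
    exact ⟨f, hf.mono fun x hx => ⟨hc.lt x hx, Or.inr (Or.inr (by simpa using hx))⟩⟩

theorem SweepCtx.le_of_take_drop (hc : SweepCtx n I mc anc le l) {i x y : ℕ}
    (hx : x ∈ l.take i) (hy : y ∈ l.drop i) : le x y := by
  have := hc.sorted
  rw [← List.take_append_drop i l, List.pairwise_append] at this
  exact this.2.2 x hx y hy

theorem SweepCtx.ne_of_take_drop (hc : SweepCtx n I mc anc le l) {i x y : ℕ}
    (hx : x ∈ l.take i) (hy : y ∈ l.drop i) : x ≠ y := by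
  have := hc.nodup
  rw [← List.take_append_drop i l, List.nodup_append] at this
  exact this.2.2 x hx y hy

/-- The object moves from the unread list to the stack, so the living set does not change. Its
boundary list is the parent's list filtered by the new cell, plus the object itself in a freed slot
`q₀`; filtering loses nothing because a stack object meeting the new cell also meets the parent's
cell. -/
theorem SweepInv.push {h i : ℕ} {ob ob' : ℕ → ℕ} {E E' : Fin b → ℕ → ℕ} {U U' : Fin L → ℕ → ℕ}
    (hc : SweepCtx n I mc anc le l) (hv : SweepInv n X I mc anc l h i ob E U) (hi : i < l.length)
    (hanc : h = 0 ∨ anc (ob h) l[i]) (q₀ : Fin b) (hq₀ : ¬ mc (E q₀ h) l[i])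
    (hob : ob' (h + 1) = l[i]) (hob' : ∀ p ≤ h, ob' p = ob p)
    (hE₀ : E' q₀ (h + 1) = l[i])
    (hE₁ : ∀ q, q ≠ q₀ → mc (E q h) l[i] → E' q (h + 1) = E q h)
    (hE₂ : ∀ q, q ≠ q₀ → ¬ mc (E q h) l[i] → n ≤ E' q (h + 1))
    (hE' : ∀ q, ∀ p ≤ h, E' q p = E q p)
    (hU : ∀ q, n ≤ U' q (h + 1)) (hU' : ∀ q, ∀ p ≤ h, U' q p = U q p) :
    SweepInv n X I mc anc l (h + 1) (i + 1) ob' E' U' := by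
  have hs : l[i] ∈ l := List.getElem_mem hi
  have hsn : l[i] < n := hc.lt _ hs
  have hdrop : l.drop i = l[i] :: l.drop (i + 1) := List.drop_eq_getElem_cons hi
  have htake : l.take (i + 1) = l.take i ++ [l[i]] := by simp
  have hnew : ∀ p, 1 ≤ p → p ≤ h → ob p ≠ l[i] := fun p h1 h2 =>
    hc.ne_of_take_drop (hv.ob_mem p h1 h2) (by rw [hdrop]; exact List.mem_cons_self)
  have hUnew : ∀ q p, p ≤ h → U q p < n → U q p ≠ l[i] := fun q p h1 h2 =>
    hc.ne_of_take_drop (hv.U_mem q p h1 h2) (by rw [hdrop]; exact List.mem_cons_self)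
  have hUle : ∀ q p, p ≤ h + 1 → U' q p < n → p ≤ h := by
    intro q p hp hlt
    by_contra hcon
    obtain rfl : p = h + 1 := by omega
    exact absurd hlt (hU q).not_gt
  have hanc' : ∀ p, 1 ≤ p → p ≤ h → anc (ob p) l[i] := by
    intro p h1 h2
    have h3 := hanc.resolve_left (by omega)
    rcases h2.eq_or_lt with rfl | h2
    · exact h3
    · exact hc.anc_trans _ _ _ (hv.anc p h h1 h2 le_rfl) h3
  have halive : alive n l (h + 1) (i + 1) ob' U' = alive n l h i ob U := by
    ext x
    unfold alive
    simp only [Set.mem_ofPred_eq, hdrop, List.mem_cons]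
    refine and_congr_right fun hx => ?_
    constructor
    · rintro (⟨p, h1, h2, rfl⟩ | ⟨p, h1, q, rfl⟩ | h3)
      · rcases Nat.lt_or_ge h p with h3 | h3
        · obtain rfl : p = h + 1 := by omega
          exact Or.inr (Or.inr (Or.inl hob))
        · exact Or.inl ⟨p, h1, h3, (hob' p h3).symm⟩
      · have := hUle q p h1 hx
        exact Or.inr (Or.inl ⟨p, this, q, (hU' q p this).symm⟩)
      · exact Or.inr (Or.inr (Or.inr h3))
    · rintro (⟨p, h1, h2, rfl⟩ | ⟨p, h1, q, rfl⟩ | rfl | h3)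
      · exact Or.inl ⟨p, h1, by omega, hob' p h2⟩
      · exact Or.inr (Or.inl ⟨p, by omega, q, hU' q p h1⟩)
      · exact Or.inl ⟨h + 1, by omega, le_rfl, hob⟩
      · exact Or.inr (Or.inr h3)
  have hEcases : ∀ q, E' q (h + 1) < n →
      (q = q₀ ∧ E' q (h + 1) = l[i]) ∨
        (q ≠ q₀ ∧ mc (E q h) l[i] ∧ E' q (h + 1) = E q h) := by
    intro q hlt
    by_cases hq : q = q₀
    · exact Or.inl ⟨hq, hq ▸ hE₀⟩
    · by_cases hm : mc (E q h) l[i]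
      · exact Or.inr ⟨hq, hm, hE₁ q hq hm⟩
      · exact absurd hlt (hE₂ q hq hm).not_gt
  refine ⟨hi, ?_, ?_, ?_, ?_, ?_, ?_, ?_, ?_, ?_, ?_, ?_⟩
  · intro p h1 h2
    rw [htake]
    rcases h2.eq_or_lt with rfl | h2
    · rw [hob]; exact List.mem_append_right _ (List.mem_singleton_self _)
    · rw [hob' p (by omega)]
      exact List.mem_append_left _ (hv.ob_mem p h1 (by omega))
  · intro q p hp hlt
    have := hUle q p hp hlt
    rw [hU' q p this] at hlt ⊢
    rw [htake]
    exact List.mem_append_left _ (hv.U_mem q p this hlt)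
  · intro p p' h1 h2 h1' h2' heq
    rcases h2.eq_or_lt with rfl | h2 <;> rcases h2'.eq_or_lt with rfl | h2'
    · rfl
    · rw [hob, hob' p' (by omega)] at heq
      exact absurd heq.symm (hnew p' h1' (by omega))
    · rw [hob, hob' p (by omega)] at heq
      exact absurd heq (hnew p h1 (by omega))
    · rw [hob' p (by omega), hob' p' (by omega)] at heq
      exact hv.ob_inj p p' h1 (by omega) h1' (by omega) heq
  · intro q p q' p' hp hp' hlt heq
    have e1 := hUle q p hp hlt
    have e2 := hUle q' p' hp' (heq ▸ hlt)
    rw [hU' q p e1] at hlt heq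
    rw [hU' q' p' e2] at heq
    exact hv.U_inj q p q' p' e1 e2 hlt heq
  · intro q p p' hp hlt h1 h2
    have e1 := hUle q p hp hlt
    rw [hU' q p e1] at hlt ⊢
    rcases h2.eq_or_lt with rfl | h2
    · rw [hob]; exact hUnew q p e1 hlt
    · rw [hob' p' (by omega)]; exact hv.U_ob q p p' e1 hlt h1 (by omega)
  · intro p p' h1 h2 h3
    rw [hob' p (by omega)]
    rcases h3.eq_or_lt with rfl | h3
    · rw [hob]; exact hanc' p h1 (by omega)
    · rw [hob' p' (by omega)]; exact hv.anc p p' h1 h2 (by omega)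
  · intro q p hp hlt
    rcases hp.eq_or_lt with rfl | hp
    · rcases hEcases q hlt with ⟨rfl, he⟩ | ⟨hq, hm, he⟩
      · exact ⟨h + 1, by omega, le_rfl, hob.trans he.symm, by
          rw [hob]; exact hc.mc_of _ _ hs ((hc.refl _).2 hsn)⟩
      · rw [he] at hlt ⊢
        obtain ⟨p', h1, h2, h3, -⟩ := hv.E_mem q h le_rfl hlt
        refine ⟨p', h1, by omega, by rw [hob' p' h2, h3], ?_⟩
        rw [hob' p' h2, h3, hob]; exact hm
    · rw [hE' q p (by omega)] at hlt ⊢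
      obtain ⟨p', h1, h2, h3, h4⟩ := hv.E_mem q p (by omega) hlt
      exact ⟨p', h1, h2, by rw [hob' p' (by omega), h3], by
        rwa [hob' p' (by omega), hob' p (by omega)]⟩
  · intro p p' h1 h2 h3 hm
    rcases h3.eq_or_lt with rfl | h3
    · rcases h2.eq_or_lt with rfl | h2
      · exact ⟨q₀, hE₀.trans hob.symm⟩
      · have h2' : p' ≤ h := by omega
        rw [hob, hob' p' h2'] at hm
        obtain ⟨q, hq⟩ := hv.E_mc h p' h1 h2' le_rfl
          (hc.mc_mono _ _ _ (hanc' h (by omega) le_rfl) hm)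
        rw [← hq] at hm
        have hne : q ≠ q₀ := by rintro rfl; exact hq₀ hm
        exact ⟨q, by rw [hE₁ q hne hm, hq, hob' p' h2']⟩
    · rw [hob' p' (by omega), hob' p (by omega)] at hm
      obtain ⟨q, hq⟩ := hv.E_mc p p' h1 h2 (by omega) hm
      exact ⟨q, by rw [hE' q p (by omega), hq, hob' p' (by omega)]⟩
  · intro p q q' hp hlt heq
    rcases hp.eq_or_lt with rfl | hp
    · have hold : ∀ q, E q h < n → E q h ≠ l[i] := by
        intro q hlt he
        obtain ⟨p', h1, h2, h3, -⟩ := hv.E_mem q h le_rfl hlt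
        exact hnew p' h1 h2 (h3.trans he)
      rcases hEcases q hlt with ⟨h1, he⟩ | ⟨h1, hm, he⟩ <;>
        rcases hEcases q' (heq ▸ hlt) with ⟨h1', he'⟩ | ⟨h1', hm', he'⟩
      · rw [h1, h1']
      · exact absurd (he'.symm.trans (heq.symm.trans he)) (hold q' (hc.mc_lt _ _ hm'))
      · exact absurd (he.symm.trans (heq.trans he')) (hold q (hc.mc_lt _ _ hm))
      · exact hv.E_inj h q q' le_rfl (hc.mc_lt _ _ hm) (he.symm.trans (heq.trans he'))
    · rw [hE' q p (by omega)] at hlt heq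
      rw [hE' q' p (by omega)] at heq
      exact hv.E_inj p q q' (by omega) hlt heq
  · intro q p x hp hlt hx hI
    have e1 := hUle q p hp hlt
    rw [halive] at hx
    rw [hU' q p e1] at hlt hI
    rcases hv.closed q p x e1 hlt hx hI with ⟨q', h1⟩ | ⟨q', h1⟩
    · exact Or.inl ⟨q', by rw [hU' q' p e1, h1]⟩
    · exact Or.inr ⟨q', by rw [hE' q' p e1, h1]⟩
  · rw [halive]
    exact hv.complete

/-- If no slot is free, all `b` boundary objects meet the new cell and have cells around it, so
`hfat` provides a clique of size `k`. -/
theorem SweepInv.exists_occ_of_overflow {h i : ℕ} {ob : ℕ → ℕ} {E : Fin b → ℕ → ℕ}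
    {U : Fin L → ℕ → ℕ}
    (hc : SweepCtx n I mc anc le l) (hv : SweepInv n X I mc anc l h i ob E U) (hi : i < l.length)
    (hanc : h = 0 ∨ anc (ob h) l[i]) (hall : ∀ q, mc (E q h) l[i])
    (hfat : ∀ (v : Fin b → ℕ) (p : ℕ), (∀ q, anc (v q) p) → (∀ q, mc (v q) p) →
      ∃ f : Fin k → Fin b, Function.Injective f ∧ ∀ i j, I (v (f i)) (v (f j))) :
    ∃ f : Fin k → Fin b, Function.Injective f ∧ ∀ i j, I (E (f i) h) (E (f j) h) := by
  refine hfat (fun q => E q h) l[i] (fun q => ?_) hall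
  obtain ⟨p', h1, h2, h3, -⟩ := hv.E_mem q h le_rfl (hc.mc_lt _ _ (hall q))
  have h4 := hanc.resolve_left (by omega)
  show anc (E q h) l[i]
  rw [← h3]
  rcases h2.eq_or_lt with rfl | h2
  · exact h4
  · exact hc.anc_trans _ _ _ (hv.anc p' h h1 h2 le_rfl) h4

/-- The objects that are merged when the top of the stack is removed. -/
def slotVal (h : ℕ) (ob : ℕ → ℕ) (U : Fin L → ℕ → ℕ) : Fin L ⊕ Fin L ⊕ Unit → ℕ
  | .inl q => U q h
  | .inr (.inl q) => U q (h + 1)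
  | .inr (.inr _) => ob (h + 1)

theorem SweepInv.slot_inj {h i : ℕ} {ob : ℕ → ℕ} {E : Fin b → ℕ → ℕ} {U : Fin L → ℕ → ℕ}
    (hv : SweepInv n X I mc anc l (h + 1) i ob E U) {p p' : Fin L ⊕ Fin L ⊕ Unit}
    (hlt : slotVal h ob U p < n) (heq : slotVal h ob U p = slotVal h ob U p') : p = p' := by
  rcases p with q | q | q <;> rcases p' with q' | q' | q' <;> simp only [slotVal] at hlt heq
  · rw [(hv.U_inj _ _ _ _ (by omega) (by omega) hlt heq).1]
  · exact absurd (hv.U_inj _ _ _ _ (by omega) (by omega) hlt heq).2 (by omega)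
  · exact absurd heq (hv.U_ob _ _ _ (by omega) hlt (by omega) (by omega))
  · exact absurd (hv.U_inj _ _ _ _ (by omega) (by omega) hlt heq).2 (by omega)
  · rw [(hv.U_inj _ _ _ _ (by omega) (by omega) hlt heq).1]
  · exact absurd heq (hv.U_ob _ _ _ (by omega) hlt (by omega) (by omega))
  · exact absurd heq.symm (hv.U_ob _ _ _ (by omega) (heq ▸ hlt) (by omega) (by omega))
  · exact absurd heq.symm (hv.U_ob _ _ _ (by omega) (heq ▸ hlt) (by omega) (by omega))
  · rfl

theorem SweepInv.slot_mem {h i : ℕ} {ob : ℕ → ℕ} {E : Fin b → ℕ → ℕ} {U : Fin L → ℕ → ℕ}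
    (hv : SweepInv n X I mc anc l (h + 1) i ob E U) {p : Fin L ⊕ Fin L ⊕ Unit}
    (hlt : slotVal h ob U p < n) : slotVal h ob U p ∈ l.take i := by
  rcases p with q | q | q
  · exact hv.U_mem q h (by omega) hlt
  · exact hv.U_mem q (h + 1) (by omega) hlt
  · exact hv.ob_mem (h + 1) (by omega) (by omega)

/-- The separator property for the merged frames relative to the boundary list of level `h`. A stack
object other than the popped one that meets the popped cell also meets the enclosing cell at level
`h`, hence is listed in `E · h`. -/
theorem SweepInv.slot_closed {h i : ℕ} {ob : ℕ → ℕ} {E : Fin b → ℕ → ℕ} {U : Fin L → ℕ → ℕ}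
    (hc : SweepCtx n I mc anc le l) (hv : SweepInv n X I mc anc l (h + 1) i ob E U)
    (hpop : ∀ hi : i < l.length, ¬ anc (ob (h + 1)) l[i]) {p : Fin L ⊕ Fin L ⊕ Unit} {y : ℕ}
    (hlt : slotVal h ob U p < n) (hy : y ∈ alive n l (h + 1) i ob U)
    (hI : I (slotVal h ob U p) y) : (∃ p', slotVal h ob U p' = y) ∨ ∃ e, E e h = y := by
  have hstack : ∀ p', 1 ≤ p' → p' ≤ h + 1 → ob p' = y → mc (ob p') (ob (h + 1)) →
      (∃ p', slotVal h ob U p' = y) ∨ ∃ e, E e h = y := by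
    rintro p' h1 h2 rfl hm
    rcases h2.eq_or_lt with rfl | h2
    · exact Or.inl ⟨.inr (.inr ()), rfl⟩
    · obtain ⟨e, he⟩ := hv.E_mc h p' h1 (by omega) (by omega)
        (hc.mc_mono _ _ _ (hv.anc h (h + 1) (by omega) (by omega) le_rfl) hm)
      exact Or.inr ⟨e, he⟩
  have hobl : ob (h + 1) ∈ l := List.mem_of_mem_take (hv.ob_mem (h + 1) (by omega) le_rfl)
  rcases p with q | q | q
  · rcases hv.closed q h y (by omega) hlt hy hI with ⟨q', h1⟩ | h1
    · exact Or.inl ⟨.inl q', h1⟩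
    · exact Or.inr h1
  · rcases hv.closed q (h + 1) y le_rfl hlt hy hI with ⟨q', h1⟩ | ⟨q', h1⟩
    · exact Or.inl ⟨.inr (.inl q'), h1⟩
    · obtain ⟨p', h2, h3, h4, h5⟩ := hv.E_mem q' (h + 1) le_rfl (h1 ▸ hy.1)
      exact hstack p' h2 h3 (h4.trans h1) h5
  · simp only [slotVal] at hI hlt
    obtain ⟨hyn, ⟨p', h1, h2, rfl⟩ | ⟨p', h1, q', rfl⟩ | h1⟩ := hy
    · exact hstack p' h1 h2 rfl (hc.mc_of _ _ hobl (hc.symm _ _ hI))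
    · by_cases hp1 : p' = h + 1
      · subst hp1; exact Or.inl ⟨.inr (.inl q'), rfl⟩
      by_cases hp2 : p' = h
      · subst hp2; exact Or.inl ⟨.inl q', rfl⟩
      -- Objects kept strictly below level `h` cannot meet the popped object: by `closed` it would
      -- be stored in their frame or in their boundary list, against the distinctness of entries and
      -- levels.
      exfalso
      rcases hv.closed q' p' (ob (h + 1)) h1 hyn ⟨hlt, Or.inl ⟨h + 1, by omega, le_rfl, rfl⟩⟩
        (hc.symm _ _ hI) with ⟨q₂, h2⟩ | ⟨q₂, h2⟩
      · exact hv.U_ob q₂ p' (h + 1) h1 (h2 ▸ hlt) (by omega) le_rfl h2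
      · obtain ⟨p₂, h3, h4, h5, -⟩ := hv.E_mem q₂ p' h1 (h2 ▸ hlt)
        have := hv.ob_inj p₂ (h + 1) h3 (by omega) (by omega) le_rfl (h5.trans h2)
        omega
    · exfalso
      have htk := hv.ob_mem (h + 1) (by omega) le_rfl
      have hyl : y ∈ l := List.mem_of_mem_drop h1
      -- An unread object meeting the popped one would have its cell inside the popped cell; since
      -- descendants form an interval, so would the next object of the list, and the level would not
      -- be popped.
      have ha := hc.anc_of _ _ hobl hyl hI (hc.le_of_take_drop htk h1)
      have hi : i < l.length := by
        by_contra hcon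
        rw [List.drop_eq_nil_of_le (by omega)] at h1
        simp at h1
      have hdrop : l.drop i = l[i] :: l.drop (i + 1) := List.drop_eq_getElem_cons hi
      have hle := hc.le_of_take_drop htk (y := l[i]) (by rw [hdrop]; exact List.mem_cons_self)
      rw [hdrop, List.mem_cons] at h1
      rcases h1 with rfl | h1
      · exact hpop hi ha
      · refine hpop hi (hc.anc_between _ _ _ ha hle ?_)
        refine hc.le_of_take_drop (i := i + 1) ?_ h1
        rw [show l.take (i + 1) = l.take i ++ [l[i]] by simp]
        exact List.mem_append_right _ (List.mem_singleton_self _)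

/-- The living set only shrinks, so the separator property is inherited from `slot_closed`.
Completeness is the exchange argument: the part of an occurrence inside the merged slots is replaced
by the kept partial embedding with the same signature. -/
theorem SweepInv.pop {h i : ℕ} {ob ob' : ℕ → ℕ} {E E' : Fin b → ℕ → ℕ}
    {U U' : Fin ((2 ^ b + 1) ^ k * k) → ℕ → ℕ}
    (hc : SweepCtx n I mc anc le l) (hv : SweepInv n X I mc anc l (h + 1) i ob E U)
    (hpop : ∀ hi : i < l.length, ¬ anc (ob (h + 1)) l[i])
    (hob : ∀ p ≤ h, ob' p = ob p) (hE : ∀ q, ∀ p ≤ h, E' q p = E q p)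
    (hU : ∀ q, ∀ p < h, U' q p = U q p)
    (hU' : ∀ q, U' q h = (selection X (fun p p' => I (slotVal h ob U p) (slotVal h ob U p'))
      (fun p e => I (slotVal h ob U p) (E e h)) q).elim n (slotVal h ob U)) :
    SweepInv n X I mc anc l h i ob' E' U' := by
  classical
  obtain ⟨hsel₁, hsel₂⟩ := (exists_selection X
    (fun p p' => I (slotVal h ob U p) (slotVal h ob U p'))
    (fun p e => I (slotVal h ob U p) (E e h))).choose_spec
  set out := selection X (fun p p' => I (slotVal h ob U p) (slotVal h ob U p'))
      (fun p e => I (slotVal h ob U p) (E e h)) with hout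
  have htop : ∀ q, U' q h < n → ∃ p, out q = some p ∧ U' q h = slotVal h ob U p := by
    intro q hlt
    rw [hU'] at hlt ⊢
    cases ho : out q with
    | none => rw [ho] at hlt; exact absurd hlt (lt_irrefl _)
    | some p => exact ⟨p, rfl, rfl⟩
  have halive : alive n l h i ob' U' ⊆ alive n l (h + 1) i ob U := by
    rintro x ⟨hx, ⟨p, h1, h2, rfl⟩ | ⟨p, h1, q, rfl⟩ | h1⟩
    · exact ⟨hx, Or.inl ⟨p, h1, by omega, (hob p h2).symm⟩⟩
    · rcases h1.eq_or_lt with rfl | h1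
      · obtain ⟨p', -, h2⟩ := htop q hx
        rw [h2] at hx ⊢
        rcases p' with q' | q' | q'
        · exact ⟨hx, Or.inr (Or.inl ⟨p, by omega, q', rfl⟩)⟩
        · exact ⟨hx, Or.inr (Or.inl ⟨p + 1, by omega, q', rfl⟩)⟩
        · exact ⟨hx, Or.inl ⟨p + 1, by omega, by omega, rfl⟩⟩
      · exact ⟨hx, Or.inr (Or.inl ⟨p, by omega, q, (hU q p h1).symm⟩)⟩
    · exact ⟨hx, Or.inr (Or.inr h1)⟩
  -- elements of lower frames are different from the merged ones
  have hlow : ∀ q p p', p < h → U q p < n → U q p ≠ slotVal h ob U p' := by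
    intro q p p' hp hlt heq
    rcases p' with q' | q' | q'
    · have := (hv.U_inj q p q' h (by omega) (by omega) hlt heq).2; omega
    · have := (hv.U_inj q p q' (h + 1) (by omega) (by omega) hlt heq).2; omega
    · exact hv.U_ob q p (h + 1) (by omega) hlt (by omega) (by omega) heq
  have hstk : ∀ p p', 1 ≤ p → p ≤ h → slotVal h ob U p' < n → slotVal h ob U p' ≠ ob p := by
    intro p p' h1 h2 hlt heq
    rcases p' with q' | q' | q'
    · exact hv.U_ob q' h p (by omega) hlt h1 (by omega) heq
    · exact hv.U_ob q' (h + 1) p (by omega) hlt h1 (by omega) heq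
    · have := hv.ob_inj (h + 1) p (by omega) (by omega) h1 (by omega) heq; omega
  refine ⟨hv.le_length, ?_, ?_, ?_, ?_, ?_, ?_, ?_, ?_, ?_, ?_, ?_⟩
  · intro p h1 h2
    rw [hob p h2]; exact hv.ob_mem p h1 (by omega)
  · intro q p hp hlt
    rcases hp.eq_or_lt with rfl | hp
    · obtain ⟨p', -, h2⟩ := htop q hlt
      rw [h2] at hlt ⊢
      exact hv.slot_mem hlt
    · rw [hU q p hp] at hlt ⊢
      exact hv.U_mem q p (by omega) hlt
  · intro p p' h1 h2 h1' h2' heq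
    rw [hob p h2, hob p' h2'] at heq
    exact hv.ob_inj p p' h1 (by omega) h1' (by omega) heq
  · intro q p q' p' hp hp' hlt heq
    rcases hp.eq_or_lt with rfl | hp <;> rcases hp'.eq_or_lt with rfl | hp'
    · obtain ⟨s, h1, h2⟩ := htop q hlt
      obtain ⟨s', h1', h2'⟩ := htop q' (heq ▸ hlt)
      have : s = s' := hv.slot_inj (h2 ▸ hlt) (h2.symm.trans (heq.trans h2'))
      subst this
      exact ⟨hsel₁ q q' s h1 h1', rfl⟩
    · obtain ⟨s, h1, h2⟩ := htop q hlt
      rw [hU q' p' hp'] at heq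
      exact absurd (heq.symm.trans h2) (hlow q' p' s hp' (heq ▸ hlt))
    · obtain ⟨s, h1, h2⟩ := htop q' (heq ▸ hlt)
      rw [hU q p hp] at heq hlt
      exact absurd (heq.trans h2) (hlow q p s hp hlt)
    · rw [hU q p hp] at heq hlt
      rw [hU q' p' hp'] at heq
      exact hv.U_inj q p q' p' (by omega) (by omega) hlt heq
  · intro q p p' hp hlt h1 h2
    rw [hob p' h2]
    rcases hp.eq_or_lt with rfl | hp
    · obtain ⟨s, -, h3⟩ := htop q hlt
      rw [h3] at hlt ⊢
      exact hstk p' s h1 h2 hlt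
    · rw [hU q p hp] at hlt ⊢
      exact hv.U_ob q p p' (by omega) hlt h1 (by omega)
  · intro p p' h1 h2 h3
    rw [hob p (by omega), hob p' h3]
    exact hv.anc p p' h1 h2 (by omega)
  · intro q p hp hlt
    rw [hE q p hp] at hlt ⊢
    obtain ⟨p', h1, h2, h3, h4⟩ := hv.E_mem q p (by omega) hlt
    exact ⟨p', h1, h2, by rw [hob p' (by omega), h3], by rwa [hob p' (by omega), hob p hp]⟩
  · intro p p' h1 h2 h3 hm
    rw [hob p h3, hob p' (by omega)] at hm
    obtain ⟨q, hq⟩ := hv.E_mc p p' h1 h2 (by omega) hm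
    exact ⟨q, by rw [hE q p h3, hob p' (by omega), hq]⟩
  · intro p q q' hp hlt heq
    rw [hE q p hp] at hlt heq
    rw [hE q' p hp] at heq
    exact hv.E_inj p q q' (by omega) hlt heq
  · intro q p x hp hlt hx hI
    rcases hp.eq_or_lt with rfl | hp
    · obtain ⟨s, -, h2⟩ := htop q hlt
      rw [h2] at hlt hI
      rcases hv.slot_closed hc hpop hlt (halive hx) hI with ⟨s', h3⟩ | ⟨e, he⟩
      · left
        obtain ⟨hxn, ⟨p', h4, h5, h6⟩ | ⟨p', h4, q', h6⟩ | h4⟩ := hx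
        · rw [hob p' h5] at h6
          exact absurd (h3.trans h6.symm) (hstk p' s' h4 h5 (h3 ▸ hxn))
        · rcases h4.eq_or_lt with rfl | h4
          · exact ⟨q', h6⟩
          · rw [hU q' p' h4] at h6
            exact absurd (h6.trans h3.symm) (hlow q' p' s' h4 (h6 ▸ hxn))
        · exact absurd h3 (hc.ne_of_take_drop (hv.slot_mem (h3 ▸ hxn)) h4)
      · exact Or.inr ⟨e, by rw [hE e p le_rfl, he]⟩
    · rw [hU q p hp] at hlt hI
      rcases hv.closed q p x (by omega) hlt (halive hx) hI with ⟨q', h1⟩ | ⟨q', h1⟩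
      · exact Or.inl ⟨q', by rw [hU q' p hp, h1]⟩
      · exact Or.inr ⟨q', by rw [hE q' p (by omega), h1]⟩
  · intro hocc
    obtain ⟨f, hf₁, hf₂, hf₃⟩ := hv.complete hocc
    let g : Fin k → Option (Fin ((2 ^ b + 1) ^ k * k) ⊕ Fin ((2 ^ b + 1) ^ k * k) ⊕ Unit) :=
      fun v => if hv : ∃ p, slotVal h ob U p = f v then some hv.choose else none
    have hg : ∀ v p, g v = some p → slotVal h ob U p = f v := by
      intro v p hp
      by_cases hex : ∃ p, slotVal h ob U p = f v
      · simp only [g, dif_pos hex, Option.some.injEq] at hp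
        rw [← hp]; exact hex.choose_spec
      · have hn : g v = none := dif_neg hex
        rw [hn] at hp; cases hp
    have hg' : ∀ v, g v = none → ¬ ∃ p, slotVal h ob U p = f v := by
      intro v hp hex
      have hn : g v = some hex.choose := dif_pos hex
      rw [hn] at hp; cases hp
    obtain ⟨g', hg'₁, hg'₂, hg'₃⟩ := hsel₂ g ⟨fun v w p h1 h2 =>
        hf₁ ((hg v p h1).symm.trans (hg w p h2)), fun v p h1 => by
        rw [hg v p h1]; exact (hc.refl _).2 (hf₂ v).1, fun v w p q ha h1 h2 => by
        rw [hg v p h1, hg w q h2]; exact hf₃ v w ha⟩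
    have hnone : ∀ v, g' v = none → g v = none := by
      intro v hv
      have := hg'₂ v
      rw [hv] at this
      simpa using this.symm
    have hsome : ∀ v p, g' v = some p → ∃ p₀, g v = some p₀ ∧
        ∀ e, I (slotVal h ob U p₀) (E e h) ↔ I (slotVal h ob U p) (E e h) := by
      intro v p hp
      have h1 := hg'₂ v
      rw [hp] at h1
      cases hgv : g v with
      | none => rw [hgv] at h1; simp at h1
      | some p₀ =>
        rw [hgv] at h1
        simp only [Option.map_some, Option.some.injEq] at h1
        exact ⟨p₀, rfl, fun e => (iff_of_eq (congrFun h1 e)).symm⟩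
    -- Edges between the exchanged part and the rest survive: the outer endpoint must be a boundary
    -- object of level `h`, and old and new inner endpoints meet the same boundary objects.
    have hcross : ∀ v w p, X.Adj v w → g' v = some p → g' w = none →
        I (slotVal h ob U p) (f w) := by
      intro v w p ha h1 h2
      obtain ⟨p₀, h3, h4⟩ := hsome v p h1
      have h5 := hg v p₀ h3
      have h6 := hf₃ v w ha
      rw [← h5] at h6
      rcases hv.slot_closed hc hpop (by rw [h5]; exact (hf₂ v).1) (hf₂ w) h6 with h7 | ⟨e, he⟩
      · exact absurd h7 (hg' w (hnone w h2))
      · rw [← he] at h6 ⊢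
        exact (h4 e).1 h6
    -- The new occurrence follows `g'` where it is defined and `f` elsewhere. It stays injective
    -- because `f` takes no slot value at vertices where `g'` is undefined.
    refine ⟨fun v => (g' v).elim (f v) (slotVal h ob U), ?_, ?_, ?_⟩
    · intro v w hvw
      simp only at hvw
      cases h1 : g' v with
      | none =>
        cases h2 : g' w with
        | none => rw [h1, h2] at hvw; exact hf₁ hvw
        | some q =>
          rw [h1, h2] at hvw
          exact absurd ⟨q, hvw.symm⟩ (hg' v (hnone v h1))
      | some p =>
        cases h2 : g' w with
        | none =>
          rw [h1, h2] at hvw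
          exact absurd ⟨p, hvw⟩ (hg' w (hnone w h2))
        | some q =>
          rw [h1, h2] at hvw
          have : p = q := hv.slot_inj ((hc.refl _).1 (hg'₁.refl v p h1)) hvw
          subst this
          exact hg'₁.inj v w p h1 h2
    · intro v
      simp only
      cases h1 : g' v with
      | none =>
        simp only [Option.elim_none]
        have h2 := hg' v (hnone v h1)
        obtain ⟨hx, ⟨p, h3, h4, h5⟩ | ⟨p, h3, q, h5⟩ | h3⟩ := hf₂ v
        · rcases h4.eq_or_lt with rfl | h4
          · exact absurd ⟨.inr (.inr ()), h5⟩ h2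
          · exact ⟨hx, Or.inl ⟨p, h3, by omega, by rw [hob p (by omega), h5]⟩⟩
        · by_cases hp1 : p = h + 1
          · subst hp1; exact absurd ⟨.inr (.inl q), h5⟩ h2
          by_cases hp2 : p = h
          · subst hp2; exact absurd ⟨.inl q, h5⟩ h2
          exact ⟨hx, Or.inr (Or.inl ⟨p, by omega, q, by rw [hU q p (by omega), h5]⟩)⟩
        · exact ⟨hx, Or.inr (Or.inr h3)⟩
      | some p =>
        simp only [Option.elim_some]
        obtain ⟨q, hq⟩ := hg'₃ v p h1
        refine ⟨(hc.refl _).1 (hg'₁.refl v p h1), Or.inr (Or.inl ⟨h, le_rfl, q, ?_⟩)⟩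
        rw [hU' q, hout]
        unfold selection
        rw [hq]
        rfl
    · intro v w ha
      simp only
      cases h1 : g' v with
      | none =>
        cases h2 : g' w with
        | none => exact hf₃ v w ha
        | some q => exact hc.symm _ _ (hcross w v q ha.symm h2 h1)
      | some p =>
        cases h2 : g' w with
        | none => exact hcross v w p ha h1 h2
        | some q => exact hg'₁.adj v w p q ha h1 h2

end Sweep

end FatSubgraph

end

noncomputable section

namespace FatSubgraph

/-! ### The program of the sweep -/

section SweepProgram

variable {d n k : ℕ} (X : SimpleGraph (Fin k)) {S : Fin n → Set (Fin d → ℝ)}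

open Classical in
/-- Searches for `X` among the objects in the given slots. -/
def solve {N : ℕ} (slot : Fin N → NExp) : Prog d :=
  branch (fun pq : Fin N × Fin N => .meets (slot pq.1) (slot pq.2)) fun τ =>
    if h : ∃ f : Fin k → Fin N, Function.Injective f ∧ (∀ v, τ (f v, f v)) ∧
        ∀ v w, X.Adj v w → τ (f v, f w) then
      .seq (assignNats (fun _ => 1) (fun v : Fin k => .lit v) fun v => slot (h.choose v))
        (.setNat 0 (.lit 0) (.lit 1))
    else .skip

theorem loopFree_solve {N : ℕ} (slot : Fin N → NExp) : (solve X slot : Prog d).LoopFree := by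
  refine loopFree_branch fun τ => ?_
  split_ifs
  · exact ⟨loopFree_assignNats _ _ _, trivial⟩
  · trivial

/-- The memory holds the flag `1` and an occurrence of `X`. -/
def Solved (S : Fin n → Set (Fin d → ℝ)) (m : Memory) : Prop :=
  m.nat 0 0 = 1 ∧ ∃ f : Fin k → ℕ, Occ X (Inter S) {x | x < n} f ∧ ∀ v : Fin k, m.nat 1 v = f v

/-- A slot holds an object exactly when its content meets itself, since tests on nonexistent objects
fail; this excludes empty slots from the search. By `hinj`, an embedding injective on slots is
injective on objects, and by `hst` the slots are unaffected by writing the answer to arrays `0` and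
`1`. -/
theorem exec_solve {N : ℕ} (slot : Fin N → NExp) (m : Memory)
    (hst : ∀ m' : Memory, (∀ a, 2 ≤ a → m'.nat a = m.nat a) →
      ∀ p, (slot p).val m' = (slot p).val m)
    (hinj : ∀ p p', (slot p).val m < n → (slot p).val m = (slot p').val m → p = p') :
    (exec S (solve X slot) m).real = m.real ∧
    (∀ a, 2 ≤ a → (exec S (solve X slot) m).nat a = m.nat a) ∧
    (((exec S (solve X slot) m).nat 0 0 = m.nat 0 0 ∧ ¬ ∃ f : Fin k → Fin N,
        Function.Injective f ∧ (∀ v, Inter S ((slot (f v)).val m) ((slot (f v)).val m)) ∧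
        ∀ v w, X.Adj v w → Inter S ((slot (f v)).val m) ((slot (f w)).val m)) ∨
      Solved X S (exec S (solve X slot) m)) := by
  unfold solve
  rw [exec_branch, show (fun pq : Fin N × Fin N =>
    (BExp.meets (slot pq.1) (slot pq.2) : BExp d).Holds S m) = fun pq =>
      Inter S ((slot pq.1).val m) ((slot pq.2).val m) from rfl]
  dsimp only
  by_cases h : ∃ f : Fin k → Fin N,
        Function.Injective f ∧ (∀ v, Inter S ((slot (f v)).val m) ((slot (f v)).val m)) ∧
        ∀ v w, X.Adj v w → Inter S ((slot (f v)).val m) ((slot (f w)).val m)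
  · rw [dif_pos h]
    obtain ⟨f₁, f₂, f₃⟩ := h.choose_spec
    change (exec S (.seq (assignNats (fun _ => 1) (fun v : Fin k => .lit v)
      fun v => slot (h.choose v)) (.setNat 0 (.lit 0) (.lit 1))) m).real = _ ∧
      (∀ a, 2 ≤ a → (exec S (.seq (assignNats (fun _ => 1) (fun v : Fin k => .lit v)
      fun v => slot (h.choose v)) (.setNat 0 (.lit 0) (.lit 1))) m).nat a = m.nat a) ∧ (_ ∨
      Solved X S (exec S (.seq (assignNats (fun _ => 1) (fun v : Fin k => .lit v)
      fun v => slot (h.choose v)) (.setNat 0 (.lit 0) (.lit 1))) m))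
    generalize h.choose = f at *
    obtain ⟨h1, h2, h3⟩ := exec_assignNats S (fun _ => 1) (fun v : Fin k => .lit v)
      (fun v => slot (f v)) m (fun v w hvw => by
        simpa [NExp.val, Fin.ext_iff] using hvw) (fun m' _ hm' v => ⟨rfl, hst m' (fun a ha => by
          funext j
          exact hm' a j fun q hq => by omega) _⟩)
    simp only [exec]
    refine ⟨h1, fun a ha => ?_, Or.inr ⟨?_, fun v => (slot (f v)).val m, ⟨?_, ?_, f₃⟩, ?_⟩⟩
    · funext j
      simp only [update_apply]
      rw [if_neg (by omega)]
      exact h3 a j fun q hq => by omega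
    · simp [update_apply, NExp.val]
    · intro v w hvw
      exact f₁ (hinj _ _ (f₂ v).1 hvw)
    · intro v; exact (f₂ v).1
    · intro v
      simp only [update_apply]
      rw [if_neg (by omega)]
      exact h2 v
  · rw [dif_neg h]
    exact ⟨rfl, fun _ _ => rfl, Or.inl ⟨rfl, h⟩⟩

/-- The test `cmp` implements the relation `mc` for second arguments below `n`, as long as the
real part of the memory is `ρ`. -/
def ImplementsCell (S : Fin n → Set (Fin d → ℝ)) (cmp : NExp → NExp → BExp d)
    (mc : ℕ → ℕ → Prop) (ρ : ℕ → ℕ → ℝ) : Prop :=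
  ∀ (m : Memory) (e f : NExp), m.real = ρ → f.val m < n →
    ((cmp e f).Holds S m ↔ mc (e.val m) (f.val m))

variable (b : ℕ)

/-- Number of objects kept in a frame of the stack. -/
abbrev keep (k b : ℕ) : ℕ := (2 ^ b + 1) ^ k * k

open Classical in
/-- Pushes the next object on the stack. -/
def push (mcB : NExp → NExp → BExp d) : Prog d :=
  branch (fun q : Fin b => mcB (.get (20 + 3 * q) (.var 13)) (.get 4 (.var 8))) fun τ =>
    if h : ∃ q, ¬ τ q then
      seqs [assignNats (fun q : Fin b => 20 + 3 * (q : ℕ)) (fun _ => .add (.var 13) (.lit 1))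
          (fun q => if q = h.choose then .get 4 (.var 8) else
            if τ q then .get (20 + 3 * q) (.var 13) else .var 2),
        assignNats (fun q : Fin (keep k b) => 21 + 3 * (q : ℕ))
          (fun _ => .add (.var 13) (.lit 1)) (fun _ => .var 2),
        .setNat 14 (.add (.var 13) (.lit 1)) (.get 4 (.var 8)),
        .setNat 8 (.lit 0) (.add (.var 8) (.lit 1)),
        .setNat 13 (.lit 0) (.add (.var 13) (.lit 1))]
    else solve X fun q : Fin b => .get (20 + 3 * q) (.var 13)

/-- The slots that are merged when the top of the stack is removed. -/
def slotExp {L : ℕ} : Fin L ⊕ Fin L ⊕ Unit → NExp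
  | .inl q => .get (21 + 3 * q) (.sub (.var 13) (.lit 1))
  | .inr (.inl q) => .get (21 + 3 * q) (.var 13)
  | .inr (.inr _) => .get 14 (.var 13)

/-- Removes the top of the stack. -/
def pop : Prog d :=
  branch (ι := ((Fin (keep k b) ⊕ Fin (keep k b) ⊕ Unit) ×
      (Fin (keep k b) ⊕ Fin (keep k b) ⊕ Unit)) ⊕
      (Fin (keep k b) ⊕ Fin (keep k b) ⊕ Unit) × Fin b)
    (Sum.elim (fun p => .meets (slotExp p.1) (slotExp p.2))
      (fun p => .meets (slotExp p.1) (.get (20 + 3 * p.2) (.sub (.var 13) (.lit 1))))) fun τ =>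
    seqs [assignNats (fun q : Fin (keep k b) => 22 + 3 * (q : ℕ)) (fun _ => .lit 0)
        (fun q => (selection X (fun p p' => τ (.inl (p, p'))) (fun p e => τ (.inr (p, e))) q).elim
          (.var 2) slotExp),
      assignNats (fun q : Fin (keep k b) => 21 + 3 * (q : ℕ))
        (fun _ => .sub (.var 13) (.lit 1)) (fun q => .var (22 + 3 * q)),
      .setNat 13 (.lit 0) (.sub (.var 13) (.lit 1))]

/-- One step of the sweep. -/
def sweepBody (ancB mcB : NExp → NExp → BExp d) : Prog d :=
  .ite (.and (.natLt (.var 8) (.var 9)) (.or (.natLe (.var 13) (.lit 0))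
    (ancB (.get 14 (.var 13)) (.get 4 (.var 8))))) (push X b mcB) (pop X b)

/-- The sweep continues while nothing has been found and there is something to do. -/
def sweepTest : BExp d :=
  .and (.natLe (.var 0) (.lit 0)) (.or (.natLt (.var 8) (.var 9)) (.natLe (.lit 1) (.var 13)))

/-- Initialization of the sweep. -/
def sweepInit : Prog d :=
  seqs [assignNats (fun q : Fin b => 20 + 3 * (q : ℕ)) (fun _ => .lit 0) (fun _ => .var 2),
    assignNats (fun q : Fin (keep k b) => 21 + 3 * (q : ℕ)) (fun _ => .lit 0) (fun _ => .var 2),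
    .setNat 13 (.lit 0) (.lit 0)]

/-- The sweep. -/
def sweep (ancB mcB : NExp → NExp → BExp d) : Prog d :=
  .seq (sweepInit (k := k) b) (.seq (.loop sweepTest (sweepBody X b ancB mcB))
    (.ite (.natLe (.var 0) (.lit 0))
      (solve X fun q : Fin (keep k b) => .get (21 + 3 * q) (.lit 0)) .skip))

variable {b}

theorem loopFree_push (mcB : NExp → NExp → BExp d) : (push X b mcB).LoopFree := by
  refine loopFree_branch fun τ => ?_
  split_ifs
  · exact ⟨loopFree_assignNats _ _ _, loopFree_assignNats _ _ _, trivial, trivial, trivial, trivial⟩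
  · exact loopFree_solve X _

theorem loopFree_pop : (pop X b : Prog d).LoopFree :=
  loopFree_branch fun _ =>
    ⟨loopFree_assignNats _ _ _, loopFree_assignNats _ _ _, trivial, trivial⟩

theorem loopFree_sweepBody (ancB mcB : NExp → NExp → BExp d) :
    (sweepBody X b ancB mcB).LoopFree :=
  ⟨loopFree_push X mcB, loopFree_pop X⟩

theorem loopFree_sweepInit : (sweepInit (k := k) b : Prog d).LoopFree :=
  ⟨loopFree_assignNats _ _ _, loopFree_assignNats _ _ _, trivial, trivial⟩

/-- The invariant of the sweep, as a property of the memory. -/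
def MemInv (b : ℕ) (S : Fin n → Set (Fin d → ℝ)) (mc anc : ℕ → ℕ → Prop) (l : List ℕ) (i₀ : ℕ)
    (m : Memory) : Prop :=
  m.nat 0 0 = 0 ∧ Seg (m.nat 4) i₀ l ∧ m.nat 9 0 = i₀ + l.length ∧ i₀ ≤ m.nat 8 0 ∧
    SweepInv n X (Inter S) mc anc l (m.nat 13 0) (m.nat 8 0 - i₀) (m.nat 14)
      (fun q : Fin b => m.nat (20 + 3 * q)) (fun q : Fin (keep k b) => m.nat (21 + 3 * q))

variable {X} {mc anc le : ℕ → ℕ → Prop} {l : List ℕ} {i₀ : ℕ} {ρ : ℕ → ℕ → ℝ}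
  {ancB mcB : NExp → NExp → BExp d}

-- Either a boundary slot is free and `SweepInv.push` applies, or all are occupied by objects
-- meeting the new cell and `solve` finds an occurrence among them. Array `13` holds the stack
-- height, `14` the stack objects, and `20 + 3q` and `21 + 3q` the slots `E` and `U`; cell `0` of
-- array `2` holds `n`, which serves as the mark of an empty slot.
open Classical in
theorem push_spec (hc : SweepCtx n (Inter S) mc anc le l)
    (hfat : ∀ (v : Fin b → ℕ) (p : ℕ), (∀ q, anc (v q) p) → (∀ q, mc (v q) p) →
      ∃ f : Fin k → Fin b, Function.Injective f ∧ ∀ i j, Inter S (v (f i)) (v (f j)))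
    (hmc : ImplementsCell S mcB mc ρ) {m : Memory} (hρ : m.real = ρ) (hn : m.nat 2 0 = n)
    (hm : MemInv X b S mc anc l i₀ m) (hi : m.nat 8 0 < m.nat 9 0)
    (hanc : m.nat 13 0 = 0 ∨ anc (m.nat 14 (m.nat 13 0)) (m.nat 4 (m.nat 8 0))) :
    (exec S (push X b mcB) m).real = ρ ∧ (exec S (push X b mcB) m).nat 2 0 = n ∧
    (Solved X S (exec S (push X b mcB) m) ∨ (MemInv X b S mc anc l i₀ (exec S (push X b mcB) m) ∧
      (exec S (push X b mcB) m).nat 8 0 = m.nat 8 0 + 1 ∧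
      (exec S (push X b mcB) m).nat 9 0 = m.nat 9 0 ∧
      (exec S (push X b mcB) m).nat 13 0 = m.nat 13 0 + 1)) := by
  obtain ⟨h0, hseg, he, hi₀, hv⟩ := hm
  have hil : m.nat 8 0 - i₀ < l.length := by omega
  have hAi : m.nat 4 (m.nat 8 0) = l[m.nat 8 0 - i₀] := by
    have := seg_iff.1 hseg (m.nat 8 0 - i₀) hil
    rwa [show i₀ + (m.nat 8 0 - i₀) = m.nat 8 0 by omega] at this
  have hAn : m.nat 4 (m.nat 8 0) < n := by rw [hAi]; exact hc.lt _ (List.getElem_mem hil)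
  rw [hAi] at hanc
  unfold push
  rw [exec_branch]
  have hτ : (fun q : Fin b => (mcB (.get (20 + 3 * q) (.var 13)) (.get 4 (.var 8))).Holds S m) =
      fun q : Fin b => mc (m.nat (20 + 3 * q) (m.nat 13 0)) l[m.nat 8 0 - i₀] := by
    funext q
    refine propext ((hmc m _ _ hρ (by simpa [NExp.val] using hAn)).trans ?_)
    simp only [NExp.val, hAi]
  rw [hτ]
  by_cases h : ∃ q : Fin b, ¬ mc (m.nat (20 + 3 * q) (m.nat 13 0)) l[m.nat 8 0 - i₀]
  · simp only [dif_pos h]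
    have hq₀ := h.choose_spec
    generalize h.choose = q₀ at *
    simp only [seqs, exec]
    set P₁ : Prog d := assignNats (fun q : Fin b => 20 + 3 * (q : ℕ))
      (fun _ => .add (.var 13) (.lit 1)) (fun q => if q = q₀ then .get 4 (.var 8) else
        if mc (m.nat (20 + 3 * q) (m.nat 13 0)) l[m.nat 8 0 - i₀] then
          .get (20 + 3 * q) (.var 13) else .var 2) with hP₁
    set P₂ : Prog d := assignNats (fun q : Fin (keep k b) => 21 + 3 * (q : ℕ))
          (fun _ => .add (.var 13) (.lit 1)) (fun _ => .var 2) with hP₂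
    obtain ⟨r1, a1, f1⟩ := exec_assignNats S (fun q : Fin b => 20 + 3 * (q : ℕ))
      (fun _ => .add (.var 13) (.lit 1)) (fun q => if q = q₀ then .get 4 (.var 8) else
        if mc (m.nat (20 + 3 * q) (m.nat 13 0)) l[m.nat 8 0 - i₀] then
          .get (20 + 3 * q) (.var 13) else .var 2) m
      (fun q q' h => Fin.ext (by simp at h; omega))
      (fun m' _ hm' q => by
        have e13 : m'.nat 13 0 = m.nat 13 0 := hm' _ _ fun q hq => by omega
        have e2 : m'.nat 2 0 = m.nat 2 0 := hm' _ _ fun q hq => by omega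
        have e8 : m'.nat 8 0 = m.nat 8 0 := hm' _ _ fun q hq => by omega
        have e4 : ∀ j, m'.nat 4 j = m.nat 4 j := fun j => hm' _ _ fun q hq => by omega
        -- The boundary slots are read at level `h` and written at level `h + 1`, so the assignments
        -- do not interfere.
        have eE : m'.nat (20 + 3 * q) (m.nat 13 0) = m.nat (20 + 3 * q) (m.nat 13 0) :=
          hm' _ _ fun q hq => by simp only [NExp.val] at hq; omega
        refine ⟨by simp [NExp.val, e13], ?_⟩
        split_ifs <;> simp [NExp.val, e13, e2, e8, e4, eE])
    rw [← hP₁] at r1 a1 f1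
    generalize exec S P₁ m = m₁ at *
    have f1' : ∀ a j, (∀ q : Fin b, a = 20 + 3 * (q : ℕ) → j ≠ m.nat 13 0 + 1) →
        m₁.nat a j = m.nat a j := fun a j h => f1 a j fun q hq => h q hq.1 hq.2
    have e13 : m₁.nat 13 0 = m.nat 13 0 := f1' _ _ fun q hq => by omega
    have e2 : m₁.nat 2 0 = m.nat 2 0 := f1' _ _ fun q hq => by omega
    obtain ⟨r2, a2, f2⟩ := exec_assignNats S (fun q : Fin (keep k b) => 21 + 3 * (q : ℕ))
          (fun _ => .add (.var 13) (.lit 1)) (fun _ => .var 2) m₁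
      (fun q q' h => Fin.ext (by simp at h; omega))
      (fun m' _ hm' q => by
        have e13 : m'.nat 13 0 = m₁.nat 13 0 := hm' _ _ fun q hq => by omega
        have e2 : m'.nat 2 0 = m₁.nat 2 0 := hm' _ _ fun q hq => by omega
        exact ⟨by simp [NExp.val, e13], by simp [NExp.val, e2]⟩)
    rw [← hP₂] at r2 a2 f2
    generalize exec S P₂ m₁ = m₂ at *
    simp only [NExp.val, e13, e2] at a1 a2 f2
    have f2' : ∀ a j, (∀ q : Fin (keep k b), a = 21 + 3 * (q : ℕ) → j ≠ m.nat 13 0 + 1) →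
        m₂.nat a j = m₁.nat a j := fun a j h => f2 a j fun q hq => h q hq.1 hq.2
    have fr : ∀ a, a < 20 → m₂.nat a = m.nat a := fun a ha => by
      funext j
      rw [f2' _ _ fun q hq => by omega, f1' _ _ fun q hq => by omega]
    refine ⟨r2.trans (r1.trans hρ), ?_, Or.inr ⟨⟨?_, ?_, ?_, ?_, ?_⟩, ?_, ?_, ?_⟩⟩
    · simp [update_apply, fr, NExp.val, hn]
    · simp [update_apply, fr, NExp.val, h0]
    · refine hseg.congr fun q _ _ => ?_
      simp [update_apply, fr, NExp.val]
    · simp [update_apply, fr, NExp.val, he]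
    · simp [update_apply, fr, NExp.val]; omega
    · have key : SweepInv n X (Inter S) mc anc l (m.nat 13 0 + 1) (m.nat 8 0 - i₀ + 1)
          (fun p => if p = m.nat 13 0 + 1 then m.nat 4 (m.nat 8 0) else m.nat 14 p)
          (fun q : Fin b => m₂.nat (20 + 3 * q))
          (fun q : Fin (keep k b) => m₂.nat (21 + 3 * q)) := by
        have hE : ∀ (q : Fin b) j, m₂.nat (20 + 3 * q) j = m₁.nat (20 + 3 * q) j :=
          fun q j => f2' _ _ fun q hq => by omega
        refine SweepInv.push hc hv hil hanc q₀ hq₀ (by simp [hAi]) (fun p hp => if_neg (by omega))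
          ?_ ?_ ?_ ?_ ?_ ?_
        · rw [hE, a1, if_pos rfl]; simp only [NExp.val, hAi]
        · intro q hq hm
          rw [hE, a1, if_neg hq, if_pos hm]; simp only [NExp.val]
        · intro q hq hm
          rw [hE, a1, if_neg hq, if_neg hm]; simp only [NExp.val, hn, le_refl]
        · intro q p hp
          rw [hE]
          exact f1' _ _ fun q _ => by omega
        · intro q
          simp only [a2, hn, le_refl]
        · intro q p hp
          show m₂.nat _ _ = m.nat _ _
          rw [f2' _ _ fun q _ => by omega, f1' _ _ fun q hq => by omega]
      convert key using 1
      · simp [update_apply, fr, NExp.val]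
      · simp [update_apply, fr, NExp.val]; omega
      · funext p
        simp [update_apply, fr, NExp.val]
      · funext q j
        simp only [update_apply]
        rw [if_neg (by omega), if_neg (by omega), if_neg (by omega)]
      · funext q j
        simp only [update_apply]
        rw [if_neg (by omega), if_neg (by omega), if_neg (by omega)]
    · simp [update_apply, fr, NExp.val]
    · simp [update_apply, fr, NExp.val]
    · simp [update_apply, fr, NExp.val]
  · simp only [dif_neg h]
    obtain ⟨r1, f1, hs⟩ := exec_solve (S := S) X
      (fun q : Fin b => .get (20 + 3 * q) (.var 13)) m (fun m' hm' p => by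
        simp [NExp.val, hm' 13, hm' (20 + 3 * p) (by omega)]) (fun p p' hlt heq => by
        exact hv.E_inj (m.nat 13 0) p p' le_rfl hlt heq)
    refine ⟨r1.trans hρ, by rw [f1 2 le_rfl, hn], Or.inl (hs.resolve_left ?_)⟩
    push Not at h
    rintro ⟨-, hno⟩
    obtain ⟨f, hf1, hf2⟩ := hv.exists_occ_of_overflow hc hil hanc h hfat
    exact hno ⟨f, hf1, fun v => hf2 v v, fun v w _ => hf2 v w⟩

theorem val_slotExp (m : Memory) {L : ℕ} (p : Fin L ⊕ Fin L ⊕ Unit) (h : 1 ≤ m.nat 13 0) :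
    (slotExp p).val m =
      slotVal (m.nat 13 0 - 1) (m.nat 14) (fun q : Fin L => m.nat (21 + 3 * q)) p := by
  have : m.nat 13 0 - 1 + 1 = m.nat 13 0 := by omega
  rcases p with q | q | q <;> simp [slotExp, slotVal, NExp.val, this]

theorem pop_spec (hc : SweepCtx n (Inter S) mc anc le l) {m : Memory} (hρ : m.real = ρ)
    (hn : m.nat 2 0 = n) (hm : MemInv X b S mc anc l i₀ m) (hpos : 1 ≤ m.nat 13 0)
    (hpop : m.nat 8 0 < m.nat 9 0 → ¬ anc (m.nat 14 (m.nat 13 0)) (m.nat 4 (m.nat 8 0))) :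
    (exec S (pop X b) m).real = ρ ∧ (exec S (pop X b) m).nat 2 0 = n ∧
    MemInv X b S mc anc l i₀ (exec S (pop X b) m) ∧
    (exec S (pop X b) m).nat 8 0 = m.nat 8 0 ∧ (exec S (pop X b) m).nat 9 0 = m.nat 9 0 ∧
    (exec S (pop X b) m).nat 13 0 + 1 = m.nat 13 0 := by
  obtain ⟨h0, hseg, he, hi₀, hv⟩ := hm
  have hh : m.nat 13 0 - 1 + 1 = m.nat 13 0 := by omega
  unfold pop
  rw [exec_branch]
  simp only [seqs, exec]
  set out := selection X
    (fun p p' => (Sum.elim (fun p : (Fin (keep k b) ⊕ Fin (keep k b) ⊕ Unit) ×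
      (Fin (keep k b) ⊕ Fin (keep k b) ⊕ Unit) => .meets (slotExp p.1) (slotExp p.2))
      (fun p : (Fin (keep k b) ⊕ Fin (keep k b) ⊕ Unit) × Fin b =>
        .meets (slotExp p.1) (.get (20 + 3 * p.2) (.sub (.var 13) (.lit 1))))
        (.inl (p, p')) : BExp d).Holds S m)
    (fun p e => (Sum.elim (fun p : (Fin (keep k b) ⊕ Fin (keep k b) ⊕ Unit) ×
      (Fin (keep k b) ⊕ Fin (keep k b) ⊕ Unit) => .meets (slotExp p.1) (slotExp p.2))
      (fun p : (Fin (keep k b) ⊕ Fin (keep k b) ⊕ Unit) × Fin b =>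
        .meets (slotExp p.1) (.get (20 + 3 * p.2) (.sub (.var 13) (.lit 1))))
        (.inr (p, e)) : BExp d).Holds S m) with hout
  have hout' : out = selection X (fun p p' => Inter S
      (slotVal (m.nat 13 0 - 1) (m.nat 14) (fun q : Fin (keep k b) => m.nat (21 + 3 * q)) p)
      (slotVal (m.nat 13 0 - 1) (m.nat 14) (fun q : Fin (keep k b) => m.nat (21 + 3 * q)) p'))
      (fun p e => Inter S
      (slotVal (m.nat 13 0 - 1) (m.nat 14) (fun q : Fin (keep k b) => m.nat (21 + 3 * q)) p)
      (m.nat (20 + 3 * e) (m.nat 13 0 - 1))) := by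
    simp only [← val_slotExp m _ hpos]
    rfl
  clear_value out
  clear hout
  -- The selection is first copied to the scratch arrays `22 + 3q`, because the frame at level `h -
  -- 1` is both a source and the target of the merge.
  obtain ⟨r1, a1, f1⟩ := exec_assignNats S (fun q : Fin (keep k b) => 22 + 3 * (q : ℕ))
    (fun _ => .lit 0) (fun q => (out q).elim (.var 2) slotExp) m
    (fun q q' h => Fin.ext (by simp at h; omega))
    (fun m' _ hm' q => by
      refine ⟨rfl, ?_⟩
      have e2 : m'.nat 2 = m.nat 2 := funext fun j => hm' _ _ fun q hq => by omega
      have e13 : m'.nat 13 = m.nat 13 := funext fun j => hm' _ _ fun q hq => by omega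
      have e14 : m'.nat 14 = m.nat 14 := funext fun j => hm' _ _ fun q hq => by omega
      have eU : ∀ q : Fin (keep k b), m'.nat (21 + 3 * q) = m.nat (21 + 3 * q) :=
        fun q => funext fun j => hm' _ _ fun q hq => by omega
      cases out q with
      | none => simp [NExp.val, e2]
      | some p =>
        simp only [Option.elim_some]
        rw [val_slotExp m p hpos, val_slotExp m' p (by rw [e13]; exact hpos), e13, e14]
        simp only [eU])
  generalize exec S (assignNats (fun q : Fin (keep k b) => 22 + 3 * (q : ℕ))
    (fun _ => .lit 0) (fun q => (out q).elim (.var 2) slotExp)) m = m₁ at *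
  have f1' : ∀ a j, (∀ q : Fin (keep k b), a ≠ 22 + 3 * (q : ℕ)) → m₁.nat a j = m.nat a j :=
    fun a j h => f1 a j fun q hq => h q hq.1
  have e13 : m₁.nat 13 0 = m.nat 13 0 := f1' _ _ fun q => by omega
  obtain ⟨r2, a2, f2⟩ := exec_assignNats S (fun q : Fin (keep k b) => 21 + 3 * (q : ℕ))
    (fun _ => .sub (.var 13) (.lit 1)) (fun q => .var (22 + 3 * q)) m₁
    (fun q q' h => Fin.ext (by simp at h; omega))
    (fun m' _ hm' q => by
      have e13 : m'.nat 13 0 = m₁.nat 13 0 := hm' _ _ fun q hq => by omega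
      have e2 : m'.nat (22 + 3 * q) 0 = m₁.nat (22 + 3 * q) 0 := hm' _ _ fun q hq => by omega
      exact ⟨by simp [NExp.val, e13], by simp [NExp.val, e2]⟩)
  generalize exec S (assignNats (fun q : Fin (keep k b) => 21 + 3 * (q : ℕ))
    (fun _ => .sub (.var 13) (.lit 1)) (fun q => .var (22 + 3 * q))) m₁ = m₂ at *
  simp only [NExp.val, e13] at a1 a2 f2
  have fr : ∀ a, a < 20 → m₂.nat a = m.nat a := fun a ha => by
    funext j
    rw [f2 _ _ fun q hq => by omega, f1' _ _ fun q => by omega]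
  refine ⟨r2.trans (r1.trans hρ), ?_, ⟨?_, ?_, ?_, ?_, ?_⟩, ?_, ?_, ?_⟩
  · simp [update_apply, fr, NExp.val, hn]
  · simp [update_apply, fr, NExp.val, h0]
  · refine hseg.congr fun q _ _ => ?_
    simp [update_apply, fr, NExp.val]
  · simp [update_apply, fr, NExp.val, he]
  · simp [update_apply, fr, NExp.val, hi₀]
  · rw [← hh] at hv
    have key := SweepInv.pop (ob' := m.nat 14) (E' := fun q : Fin b => m₂.nat (20 + 3 * q))
      (U' := fun q : Fin (keep k b) => m₂.nat (21 + 3 * q)) hc hv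
      (fun hi => by
        have hlt : m.nat 8 0 < m.nat 9 0 := by omega
        have := seg_iff.1 hseg (m.nat 8 0 - i₀) hi
        rw [show i₀ + (m.nat 8 0 - i₀) = m.nat 8 0 by omega] at this
        rw [hh, ← this]
        exact hpop hlt)
      (fun p _ => rfl)
      (fun q p hp => by
        show m₂.nat _ _ = m.nat _ _
        rw [f2 _ _ fun q hq => by omega, f1' _ _ fun q => by omega])
      (fun q p hp => by
        show m₂.nat _ _ = m.nat _ _
        rw [f2 _ _ fun q hq => by omega, f1' _ _ fun q => by omega])
      (fun q => by
        show m₂.nat _ _ = _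
        rw [a2, a1, ← hout']
        cases out q with
        | none => simp [NExp.val, hn]
        | some p => simp only [Option.elim_some]; rw [val_slotExp m p hpos])
    convert key using 1
    · simp [update_apply, fr, NExp.val]
    · simp [update_apply, fr, NExp.val]
    · funext p
      simp [update_apply, fr, NExp.val]
    · funext q j
      simp only [update_apply]
      rw [if_neg (by omega)]
    · funext q j
      simp only [update_apply]
      rw [if_neg (by omega)]
  · simp [update_apply, fr, NExp.val]
  · simp [update_apply, fr, NExp.val]
  · simp [update_apply, fr, NExp.val]; omega

/-- Bound on the running time of the sweep over a list of length `N`. -/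
def sweepTime (X : SimpleGraph (Fin k)) (b : ℕ) (ancB mcB : NExp → NExp → BExp d) (N : ℕ) : ℕ :=
  (sweepInit (d := d) (k := k) b).bound +
    (((sweepTest (d := d)).cost + (sweepBody X b ancB mcB).bound + 1) * (2 * N + 2) +
    ((BExp.natLe (d := d) (.var 0) (.lit 0)).cost +
      ((solve X fun q : Fin (keep k b) => .get (21 + 3 * q) (.lit 0) : Prog d).bound + 1) + 1))

theorem sweepInit_spec (hc : SweepCtx n (Inter S) mc anc le l) {m : Memory} (hn : m.nat 2 0 = n)
    (h0 : m.nat 0 0 = 0) (hseg : Seg (m.nat 4) (m.nat 8 0) l)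
    (he : m.nat 9 0 = m.nat 8 0 + l.length) :
    (exec S (sweepInit (k := k) b) m).real = m.real ∧
    (exec S (sweepInit (k := k) b) m).nat 2 0 = n ∧
    MemInv X b S mc anc l (m.nat 8 0) (exec S (sweepInit (k := k) b) m) ∧
    (exec S (sweepInit (k := k) b) m).nat 8 0 = m.nat 8 0 ∧
    (exec S (sweepInit (k := k) b) m).nat 13 0 = 0 := by
  simp only [sweepInit, seqs, exec]
  obtain ⟨r1, a1, f1⟩ := exec_assignNats S (fun q : Fin b => 20 + 3 * (q : ℕ))
    (fun _ => .lit 0) (fun _ => .var 2) m (fun q q' h => Fin.ext (by simp at h; omega))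
    (fun m' _ hm' q => by
      have e2 : m'.nat 2 0 = m.nat 2 0 := hm' _ _ fun q hq => by omega
      exact ⟨rfl, by simp [NExp.val, e2]⟩)
  generalize exec S (assignNats (fun q : Fin b => 20 + 3 * (q : ℕ))
    (fun _ => .lit 0) (fun _ => .var 2)) m = m₁ at *
  have e2 : m₁.nat 2 0 = m.nat 2 0 := f1 _ _ fun q => by omega
  obtain ⟨r2, a2, f2⟩ := exec_assignNats S (fun q : Fin (keep k b) => 21 + 3 * (q : ℕ))
    (fun _ => .lit 0) (fun _ => .var 2) m₁ (fun q q' h => Fin.ext (by simp at h; omega))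
    (fun m' _ hm' q => by
      have e2 : m'.nat 2 0 = m₁.nat 2 0 := hm' _ _ fun q hq => by omega
      exact ⟨rfl, by simp [NExp.val, e2]⟩)
  generalize exec S (assignNats (fun q : Fin (keep k b) => 21 + 3 * (q : ℕ))
    (fun _ => .lit 0) (fun _ => .var 2)) m₁ = m₂ at *
  simp only [NExp.val, e2] at a1 a2 f2
  have fr : ∀ a, a < 20 → m₂.nat a = m.nat a := fun a ha => by
    funext j
    rw [f2 _ _ fun q hq => by omega, f1 _ _ fun q hq => by omega]
  refine ⟨r2.trans r1, ?_, ⟨?_, ?_, ?_, ?_, ?_⟩, ?_, ?_⟩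
  · simp [update_apply, fr, NExp.val, hn]
  · simp [update_apply, fr, NExp.val, h0]
  · refine hseg.congr fun q _ _ => ?_
    simp [update_apply, fr, NExp.val]
  · simp [update_apply, fr, NExp.val, he]
  · simp [update_apply, fr, NExp.val]
  · have key := SweepInv.init (X := X) (ob := m.nat 14) (E := fun q : Fin b => m₂.nat (20 + 3 * q))
      (U := fun q : Fin (keep k b) => m₂.nat (21 + 3 * q)) hc
      (fun q => by
        show n ≤ m₂.nat _ _
        rw [f2 _ _ fun q hq => by omega, a1, hn])
      (fun q => by
        show n ≤ m₂.nat _ _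
        rw [a2, hn])
    convert key using 1
    · simp [update_apply, NExp.val]
    · simp [update_apply, fr, NExp.val]
    · funext p
      simp [update_apply, fr, NExp.val]
    · funext q j
      simp only [update_apply]
      rw [if_neg (by omega)]
    · funext q j
      simp only [update_apply]
      rw [if_neg (by omega)]
  · simp [update_apply, fr, NExp.val]
  · simp [update_apply, NExp.val]

theorem reach_sweep (hc : SweepCtx n (Inter S) mc anc le l)
    (hfat : ∀ (v : Fin b → ℕ) (p : ℕ), (∀ q, anc (v q) p) → (∀ q, mc (v q) p) →
      ∃ f : Fin k → Fin b, Function.Injective f ∧ ∀ i j, Inter S (v (f i)) (v (f j)))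
    (hmc : ImplementsCell S mcB mc ρ) (hancB : Implements S ancB anc ρ) {m : Memory}
    (hρ : m.real = ρ) (hn : m.nat 2 0 = n) (h0 : m.nat 0 0 = 0)
    (hseg : Seg (m.nat 4) (m.nat 8 0) l) (he : m.nat 9 0 = m.nat 8 0 + l.length) :
    Reach S (sweep X b ancB mcB) m (sweepTime X b ancB mcB l.length) fun m' =>
      m'.real = ρ ∧ m'.nat 2 0 = n ∧ (Solved X S m' ∨
        m'.nat 0 0 = 0 ∧ ¬ ∃ f, Occ X (Inter S) {x | x ∈ l} f) := by
  obtain ⟨s1, s2, s3, s4, s5⟩ := sweepInit_spec (X := X) (b := b) hc hn h0 hseg he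
  generalize m.nat 8 0 = i₀ at *
  refine Reach.seq ((loopFree_sweepInit (k := k)).reach le_rfl
    (Q := fun m' => m'.real = ρ ∧ m'.nat 2 0 = n ∧ MemInv X b S mc anc l i₀ m' ∧
      m'.nat 8 0 = i₀ ∧ m'.nat 13 0 = 0) ⟨s1.trans hρ, s2, s3, s4, s5⟩) ?_
  rintro m₁ ⟨t1, t2, t3, t4, t5⟩
  refine Reach.seq (Reach.loop_measure (loopFree_sweepBody X ancB mcB)
    (fun m' => m'.real = ρ ∧ m'.nat 2 0 = n ∧ (Solved X S m' ∨ MemInv X b S mc anc l i₀ m'))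
    -- An unread object counts twice, for its push and its pop, and a stacked one once; so either
    -- kind of step decreases the measure by one. The summand `1` makes finding an answer a decrease
    -- as well.
    (fun m' => if m'.nat 0 0 = 0 then 2 * (m'.nat 9 0 - m'.nat 8 0) + m'.nat 13 0 + 1 else 0)
    ?_ ⟨t1, t2, Or.inr t3⟩ ?_) ?_
  · rintro m' ⟨hρ', hn', hm'⟩ hb
    simp only [sweepTest, BExp.Holds, BExp.holds_or, BExp.holds_natLt, NExp.val] at hb
    have hflag : m'.nat 0 0 = 0 := by omega
    have hm := hm'.resolve_left fun h => by have := h.1; omega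
    obtain ⟨-, hseg', he', hi', hv⟩ := id hm
    have hAn : m'.nat 8 0 < m'.nat 9 0 → m'.nat 4 (m'.nat 8 0) < n := by
      intro hlt
      have hil : m'.nat 8 0 - i₀ < l.length := by omega
      have := seg_iff.1 hseg' (m'.nat 8 0 - i₀) hil
      rw [show i₀ + (m'.nat 8 0 - i₀) = m'.nat 8 0 by omega] at this
      rw [this]; exact hc.lt _ (List.getElem_mem hil)
    have hob : 1 ≤ m'.nat 13 0 → m'.nat 14 (m'.nat 13 0) < n := fun h =>
      hc.lt _ (List.mem_of_mem_take (hv.ob_mem _ h le_rfl))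
    have hanc' : 1 ≤ m'.nat 13 0 → m'.nat 8 0 < m'.nat 9 0 →
        ((ancB (.get 14 (.var 13)) (.get 4 (.var 8))).Holds S m' ↔
          anc (m'.nat 14 (m'.nat 13 0)) (m'.nat 4 (m'.nat 8 0))) := fun h h' =>
      hancB m' (.get 14 (.var 13)) (.get 4 (.var 8)) hρ' (hob h) (hAn h')
    rw [if_pos hflag]
    simp only [sweepBody, exec]
    split_ifs with hcond hz hz
    all_goals simp only [BExp.Holds, BExp.holds_or, BExp.holds_natLt, NExp.val] at hcond
    · obtain ⟨p1, p2, p3⟩ := push_spec (X := X) hc hfat hmc hρ' hn' hm hcond.1 (by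
        refine (Nat.eq_zero_or_pos (m'.nat 13 0)).imp_right fun hpos => ?_
        exact (hanc' hpos hcond.1).1 (hcond.2.resolve_left (by omega)))
      rcases p3 with p3 | ⟨p3, p4, p5, p6⟩
      · exact absurd p3.1 (by omega)
      · exact ⟨⟨p1, p2, Or.inr p3⟩, by omega⟩
    · obtain ⟨p1, p2, p3⟩ := push_spec (X := X) hc hfat hmc hρ' hn' hm hcond.1 (by
        refine (Nat.eq_zero_or_pos (m'.nat 13 0)).imp_right fun hpos => ?_
        exact (hanc' hpos hcond.1).1 (hcond.2.resolve_left (by omega)))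
      exact ⟨⟨p1, p2, p3.imp_right fun h => h.1⟩, by omega⟩
    all_goals
      have hpos : 1 ≤ m'.nat 13 0 := by
        by_contra hcon
        exact hcond ⟨by omega, Or.inl (by omega)⟩
      obtain ⟨p1, p2, p3, p4, p5, p6⟩ := pop_spec hc hρ' hn' hm hpos fun hlt ha =>
        hcond ⟨hlt, Or.inr ((hanc' hpos hlt).2 ha)⟩
      exact ⟨⟨p1, p2, Or.inr p3⟩, by omega⟩
  · refine Nat.mul_le_mul_left _ ?_
    have := t3.2.2.1
    split_ifs <;> omega
  · rintro m₂ ⟨⟨hρ', hn', hm'⟩, hb⟩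
    simp only [sweepTest, BExp.Holds, BExp.holds_or, BExp.holds_natLt, NExp.val] at hb
    refine Reach.ite (fun hz => ?_) (fun hz => ?_)
    · refine (loopFree_solve X _).reach (by omega) ?_
      simp only [BExp.Holds, NExp.val] at hz
      have hm := hm'.resolve_left fun h => by have := h.1; omega
      obtain ⟨-, hseg', he', hi', hv⟩ := hm
      have h13 : m₂.nat 13 0 = 0 := by omega
      have hle := hv.le_length
      have hil : m₂.nat 8 0 - i₀ = l.length := by omega
      -- With the stack empty and the list read, the living objects are those in the base frame, so
      -- searching its constantly many slots is exhaustive.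
      rw [h13, hil] at hv
      obtain ⟨r1, f1, hs⟩ := exec_solve (S := S) X
        (fun q : Fin (keep k b) => .get (21 + 3 * q) (.lit 0)) m₂ (fun m' hm' p => by
          simp [NExp.val, hm' (21 + 3 * p) (by omega)]) (fun p p' hlt heq =>
          (hv.U_inj p 0 p' 0 le_rfl le_rfl hlt heq).1)
      refine ⟨r1.trans hρ', by rw [f1 2 le_rfl, hn'], ?_⟩
      rcases hs with ⟨hs1, hs2⟩ | hs
      · refine Or.inr ⟨by omega, fun hocc => hs2 ?_⟩
        obtain ⟨f, hf1, hf2, hf3⟩ := hv.complete hocc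
        have hq : ∀ v, ∃ q : Fin (keep k b), m₂.nat (21 + 3 * q) 0 = f v := by
          intro v
          obtain ⟨-, ⟨p, h1, h2, -⟩ | ⟨p, h1, q, h2⟩ | h1⟩ := hf2 v
          · omega
          · obtain rfl : p = 0 := by omega
            exact ⟨q, h2⟩
          · simp at h1
        choose g hg using hq
        refine ⟨g, fun v w hvw => hf1 (by rw [← hg, ← hg, hvw]), fun v => ?_, fun v w ha => ?_⟩
        · simp only [NExp.val, hg]
          exact (hc.refl _).2 (hf2 v).1
        · simp only [NExp.val, hg]
          exact hf3 v w ha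
      · exact Or.inl hs
    · simp only [BExp.Holds, NExp.val] at hz
      refine Prog.LoopFree.reach (p := .skip) trivial (by simp [Prog.bound]) ?_
      exact ⟨hρ', hn', Or.inl (hm'.resolve_right fun h => by have := h.1; omega)⟩

end SweepProgram

end FatSubgraph

end

noncomputable section

namespace FatSubgraph

/-! ### Tests on cells -/

section CellTests

variable {d n : ℕ} {S : Fin n → Set (Fin d → ℝ)}

/-- Coordinate `i` of the corner of the cell of object `e`. -/
abbrev cornerExp (e : NExp) (i : Fin d) : RExp d := .get (5 + i) e

/-- Side length of the cell of object `e`. -/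
abbrev sideExp (e : NExp) : RExp d := .get 4 e

/-- Lexicographic comparison. -/
def lexB {ι : Type} : List ι → (ι → RExp d) → (ι → RExp d) → BExp d
  | [], _, _ => .not .tt
  | i :: l, x, y => .or (.realLt (x i) (y i)) (.and (.realLe (x i) (y i)) (lexB l x y))

@[simp] theorem holds_lexB {ι : Type} (m : Memory) (l : List ι) (x y : ι → RExp d) :
    (lexB l x y).Holds S m ↔ lexLt l (fun i => (x i).val S m) (fun i => (y i).val S m) := by
  induction l with
  | nil => simp [lexB, lexLt, BExp.Holds]
  | cons i l ih => simp [lexB, lexLt, BExp.Holds, ih]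

/-- Comparison in the Z-order. -/
def zltB (x y : Fin d → RExp d) : BExp d :=
  .any (List.finRange d) fun i =>
    .and (.all (List.finRange d) fun l =>
      .realLe (.dyadicSide (x l) (y l)) (.dyadicSide (x i) (y i)))
    (lexB (List.finRange d)
      (fun l => .dyadicFloor (x l) (.scale (1 / 2) (.dyadicSide (x i) (y i))))
      (fun l => .dyadicFloor (y l) (.scale (1 / 2) (.dyadicSide (x i) (y i)))))

-- Multiplication by the literal `1/2` replaces the division by two in `zlt`, which the machine
-- lacks.
@[simp] theorem holds_zltB (m : Memory) (x y : Fin d → RExp d) :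
    (zltB x y).Holds S m ↔ zlt (fun i => (x i).val S m) (fun i => (y i).val S m) := by
  have h : ∀ r : ℝ, 2⁻¹ * r = r / 2 := fun r => by ring
  simp [zltB, zlt, BExp.Holds, RExp.val, h]

/-- The order of the cells. -/
def cellLeB (e f : NExp) : BExp d :=
  .or (zltB (cornerExp e) (cornerExp f))
    (.and (.not (zltB (cornerExp f) (cornerExp e))) (.realLe (sideExp f) (sideExp e)))

/-- Containment of cells. -/
def ancB (e f : NExp) : BExp d :=
  .and (.realLe (sideExp f) (sideExp e)) (.all (List.finRange d) fun i =>
    .realLe (.dyadicSide (cornerExp e i) (cornerExp f i)) (sideExp e))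

/-- The object `e` meets the cell of the object `f`. -/
def meetsB (e f : NExp) : BExp d :=
  .meetsCube e (fun i => .sub (cornerExp f i) (.var 2)) (sideExp f)

/-- The cells of the translates of the first `q` objects are stored in the memory. -/
def HasCells (S : Fin n → Set (Fin d → ℝ)) (K : ℕ) (τ : ℝ) (q : ℕ) (ρ : ℕ → ℕ → ℝ) : Prop :=
  ρ 2 0 = τ ∧ ∀ o < q, ρ 4 o = side S K o ∧ ∀ i : Fin d, ρ (5 + i) o = corner S K τ o i

variable {K : ℕ} {τ : ℝ} {ρ : ℕ → ℕ → ℝ}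

theorem HasCells.implements_cellLeB (h : HasCells S K τ n ρ) :
    Implements S cellLeB (LeO S K τ) ρ := by
  rintro m e f rfl he hf
  simp [cellLeB, BExp.Holds, RExp.val, LeO, CellLe, (h.2 _ he).1, (h.2 _ he).2, (h.2 _ hf).1,
    (h.2 _ hf).2]

theorem HasCells.implements_ancB (h : HasCells S K τ n ρ) :
    Implements S ancB (AncO S K τ) ρ := by
  rintro m e f rfl he hf
  simp [ancB, BExp.Holds, RExp.val, AncO, Anc, Near, (h.2 _ he).1, (h.2 _ he).2, (h.2 _ hf).1,
    (h.2 _ hf).2]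

theorem HasCells.implements_meetsB (h : HasCells S K τ n ρ) :
    ImplementsCell S meetsB (MeetsCell S K τ) ρ := by
  rintro m e f rfl hf
  simp [meetsB, BExp.Holds, RExp.val, MeetsCell, (h.2 _ hf).1, (h.2 _ hf).2, h.1, NExp.val]

end CellTests

/-! ### Computation of the cells -/

section Cells

variable {d n : ℕ} {S : Fin n → Set (Fin d → ℝ)}

/-- Replaces the variable `a` by its maximum with all `e i`. -/
def maxInto (a : ℕ) (e : Fin d → RExp d) : Prog d :=
  seqs ((List.finRange d).map fun i =>
    .ite (.realLt (.var a) (e i)) (.setReal a (.lit 0) (e i)) .skip)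

theorem loopFree_maxInto (a : ℕ) (e : Fin d → RExp d) : (maxInto a e).LoopFree :=
  loopFree_seqs fun p hp => by
    obtain ⟨q, -, rfl⟩ := List.mem_map.1 hp
    exact ⟨trivial, trivial⟩

theorem exec_maxInto (a : ℕ) (e : Fin d → RExp d) (m : Memory)
    (hst : ∀ x i, (e i).val S ⟨m.nat, update m.real a 0 x⟩ = (e i).val S m) :
    exec S (maxInto a e) m = ⟨m.nat, update m.real a 0
      ((List.finRange d).foldl (fun L i => max L ((e i).val S m)) (m.real a 0))⟩ := by
  have hself : (⟨m.nat, update m.real a 0 (m.real a 0)⟩ : Memory) = m := by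
    ext b j
    · rfl
    · simp only [update_apply]
      split_ifs with h
      · rw [h.1, h.2]
      · rfl
  have hup : ∀ x y, update (update m.real a 0 x) a 0 y = update m.real a 0 y := fun x y => by
    funext b j
    simp only [update_apply]
    split_ifs <;> rfl
  have H : ∀ (l : List (Fin d)) (x : ℝ), exec S (seqs (l.map fun i =>
      .ite (.realLt (.var a) (e i)) (.setReal a (.lit 0) (e i)) .skip))
        ⟨m.nat, update m.real a 0 x⟩ =
      ⟨m.nat, update m.real a 0 (l.foldl (fun L i => max L ((e i).val S m)) x)⟩ := by
    intro l
    induction l with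
    | nil => intro x; rfl
    | cons i l ih =>
      intro x
      simp only [List.map_cons, seqs, exec, BExp.holds_realLt, hst, RExp.val, NExp.val,
        List.foldl_cons, hup]
      rw [← ih, show update m.real a 0 x a 0 = x by simp [update_apply]]
      split_ifs with h
      · rw [max_eq_right h.le]
      · rw [max_eq_left (not_lt.1 h)]
  rw [maxInto, ← H, hself]

/-- Computes the side length of the bounding box of object number `nat 3 0`. -/
def widthProg : Prog d :=
  .seq (.setReal 3 (.lit 0) (.lit 0))
    (maxInto 3 fun i => .sub (.upper (.var 3) i) (.lower (.var 3) i))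

theorem exec_widthProg (m : Memory) : exec S widthProg m =
    ⟨m.nat, update m.real 3 0 (width S (m.nat 3 0))⟩ := by
  simp only [widthProg, exec]
  rw [exec_maxInto]
  · ext b j
    · rfl
    · simp only [update_apply, NExp.val]
      by_cases h1 : b = 3 ∧ j = 0
      · rw [if_pos h1, if_pos h1]
        simp only [and_self, if_true, RExp.val, Rat.cast_zero]
        rfl
      · rw [if_neg h1, if_neg h1, if_neg h1]
  · intro x i; rfl

/-- Computes the cell of the translate of object number `nat 3 0`. -/
def cellProg (K : ℕ) : Prog d :=
  .ite (.realLe (.var 3) (.lit 0))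
    (.seq (.setReal 4 (.var 3) (.lit 0))
      (assignReals (fun i : Fin d => 5 + (i : ℕ)) (.var 3) fun i =>
        .add (.lower (.var 3) i) (.var 2)))
    (.seq (.setReal 4 (.var 3) (.dyadicSide (.lit 0) (.scale (2 * K : ℕ) (.var 3))))
      (assignReals (fun i : Fin d => 5 + (i : ℕ)) (.var 3) fun i =>
        .dyadicFloor (.add (.lower (.var 3) i) (.var 2)) (sideExp (.var 3))))

theorem exec_cellProg (K : ℕ) {τ : ℝ} (m : Memory) (hw : m.real 3 0 = width S (m.nat 3 0))
    (hτ : m.real 2 0 = τ) :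
    (exec S (cellProg K) m).nat = m.nat ∧
    (exec S (cellProg K) m).real 4 (m.nat 3 0) = side S K (m.nat 3 0) ∧
    (∀ i : Fin d, (exec S (cellProg K) m).real (5 + i) (m.nat 3 0) =
      corner S K τ (m.nat 3 0) i) ∧
    ∀ a j, (a < 4 ∨ j ≠ m.nat 3 0) → (exec S (cellProg K) m).real a j = m.real a j := by
  have hinj : Function.Injective fun i : Fin d => 5 + (i : ℕ) := fun i j h => Fin.ext (by
    simp at h; omega)
  simp only [cellProg, exec, BExp.Holds, RExp.val, NExp.val, hw, Rat.cast_zero]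
  split_ifs with h
  · set m₁ : Memory := ⟨m.nat, update m.real 4 (m.nat 3 0) 0⟩ with hm₁
    obtain ⟨h1, h2, h3⟩ := exec_assignReals S (fun i : Fin d => 5 + (i : ℕ)) (.var 3)
      (fun i => .add (.lower (.var 3) i) (.var 2)) m₁ hinj (fun m' hn' hm' i => by
        have e2 : m'.real 2 0 = m₁.real 2 0 := hm' _ _ fun q => by omega
        show lo S (m'.nat 3 0) i + m'.real 2 0 = lo S (m₁.nat 3 0) i + m₁.real 2 0
        rw [e2, hn'])
    refine ⟨h1, ?_, fun i => ?_, fun a j ha => ?_⟩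
    · refine (h3 _ _ fun q => by omega).trans ?_
      simp [hm₁, update_apply, side, h]
    · refine (h2 i).trans ?_
      simp [hm₁, RExp.val, NExp.val, update_apply, corner, h, hτ, lo]
    · refine (h3 _ _ fun q => by simp only [NExp.val, hm₁]; omega).trans ?_
      simp only [hm₁, update_apply]
      rw [if_neg (by omega)]
  · set m₁ : Memory := ⟨m.nat, update m.real 4 (m.nat 3 0)
      (FatSubgraph.dyadicSide 0 (((2 * K : ℕ) : ℚ) * width S (m.nat 3 0)))⟩ with hm₁
    obtain ⟨h1, h2, h3⟩ := exec_assignReals S (fun i : Fin d => 5 + (i : ℕ)) (.var 3)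
      (fun i => .dyadicFloor (.add (.lower (.var 3) i) (.var 2)) (sideExp (.var 3))) m₁ hinj
      (fun m' hn' hm' i => by
        have e2 : m'.real 2 0 = m₁.real 2 0 := hm' _ _ fun q => by omega
        have e4 : ∀ j, m'.real 4 j = m₁.real 4 j := fun j => hm' _ _ fun q => by omega
        show FatSubgraph.dyadicFloor (lo S (m'.nat 3 0) i + m'.real 2 0) (m'.real 4 (m'.nat 3 0)) =
          FatSubgraph.dyadicFloor (lo S (m₁.nat 3 0) i + m₁.real 2 0) (m₁.real 4 (m₁.nat 3 0))
        rw [e2, e4, hn'])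
    have h4 : m₁.real 4 (m.nat 3 0) = side S K (m.nat 3 0) := by
      simp [hm₁, update_apply, side, h]
    refine ⟨h1, ?_, fun i => ?_, fun a j ha => ?_⟩
    · exact (h3 _ _ fun q => by omega).trans h4
    · refine (h2 i).trans ?_
      have e2 : m₁.real 2 0 = τ := by simp [hm₁, update_apply, hτ]
      show FatSubgraph.dyadicFloor (lo S (m.nat 3 0) i + m₁.real 2 0) (m₁.real 4 (m.nat 3 0)) = _
      rw [e2, h4, corner, if_neg h]
    · refine (h3 _ _ fun q => by simp only [NExp.val, hm₁]; omega).trans ?_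
      simp only [hm₁, update_apply]
      rw [if_neg (by omega)]

/-- Appends object number `nat 3 0` to the list if its translate fits into its cell. -/
def appendProg : Prog d :=
  .seq (.ite (.all (List.finRange d) fun i =>
      .or (.realLt (.add (.upper (.var 3) i) (.var 2))
        (.add (cornerExp (.var 3) i) (sideExp (.var 3))))
        (.realLe (.add (.upper (.var 3) i) (.var 2)) (cornerExp (.var 3) i)))
    (seqs [.setNat 4 (.var 7) (.var 3), .setNat 5 (.add (.var 7) (.lit 1)) (.add (.var 7) (.lit 1)),
      .setNat 7 (.lit 0) (.add (.var 7) (.lit 1))]) .skip)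
    (.setNat 3 (.lit 0) (.add (.var 3) (.lit 1)))

open Classical in
/-- The objects below `q` whose translates fit into their cells. -/
def goods (S : Fin n → Set (Fin d → ℝ)) (K : ℕ) (τ : ℝ) (q : ℕ) : List ℕ :=
  (List.range q).filter fun o => decide (Good S K τ o)

theorem goods_succ (K : ℕ) (τ : ℝ) (q : ℕ) : goods S K τ (q + 1) =
    goods S K τ q ++ (open Classical in if Good S K τ q then [q] else []) := by
  classical
  simp only [goods, List.range_succ, List.filter_append, List.filter_singleton]
  by_cases h : Good S K τ q <;> simp [h]

theorem mem_goods {K : ℕ} {τ : ℝ} {q o : ℕ} : o ∈ goods S K τ q ↔ o < q ∧ Good S K τ o := by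
  simp [goods]

theorem length_goods_le (K : ℕ) (τ : ℝ) (q : ℕ) : (goods S K τ q).length ≤ q :=
  (List.length_filter_le _ _).trans (by simp)

theorem nodup_goods (K : ℕ) (τ : ℝ) (q : ℕ) : (goods S K τ q).Nodup :=
  List.Nodup.filter _ List.nodup_range

/-- Invariant of the computation of the list of objects to be swept. -/
def ListInv (S : Fin n → Set (Fin d → ℝ)) (K : ℕ) (τ : ℝ) (m : Memory) : Prop :=
  m.nat 3 0 ≤ n ∧ m.nat 6 0 = 0 ∧ m.nat 7 0 = (goods S K τ (m.nat 3 0)).length ∧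
  m.nat 5 (m.nat 7 0) = m.nat 7 0 ∧
  RunsAt (m.nat 4) (m.nat 5) 0 ((goods S K τ (m.nat 3 0)).map fun x => [x])

/-- Good objects are appended as singleton runs with boundaries `B r = r`, which is the initial
configuration of the merge sort. -/
theorem exec_appendProg {K : ℕ} {τ : ℝ} {m : Memory} (hlt : m.nat 3 0 < n)
    (hρ : HasCells S K τ (m.nat 3 0 + 1) m.real) (hm : ListInv S K τ m) :
    (exec S appendProg m).real = m.real ∧ ListInv S K τ (exec S appendProg m) ∧
    (exec S appendProg m).nat 3 0 = m.nat 3 0 + 1 ∧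
    ∀ a, a < 3 → (exec S appendProg m).nat a = m.nat a := by
  obtain ⟨h3, h6, h7, h5, hr⟩ := hm
  have hgood : (BExp.all (List.finRange d) fun i =>
      .or (.realLt (.add (.upper (.var 3) i) (.var 2))
        (.add (cornerExp (.var 3) i) (sideExp (.var 3))))
        (.realLe (.add (.upper (.var 3) i) (.var 2)) (cornerExp (.var 3) i)) : BExp d).Holds S m ↔
      Good S K τ (m.nat 3 0) := by
    obtain ⟨hc1, hc2⟩ := hρ.2 _ (Nat.lt_succ_self _)
    simp [BExp.Holds, RExp.val, NExp.val, Good, Fits, hc1, hc2, hρ.1, up]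
    rfl
  simp only [appendProg, exec]
  have hs := goods_succ (S := S) K τ (m.nat 3 0)
  by_cases h : Good S K τ (m.nat 3 0)
  · rw [if_pos h] at hs
    simp only [if_pos (hgood.2 h)]
    refine ⟨rfl, ?_, by simp [seqs, exec, update_apply, NExp.val], fun a ha => ?_⟩
    · simp only [ListInv, seqs, exec]
      simp only [update_apply, NExp.val]
      simp only [Nat.reduceEqDiff, false_and, and_self, and_true, if_false,
        if_true]
      have hlen : ((goods S K τ (m.nat 3 0)).map fun x => [x]).length = m.nat 7 0 := by simp [h7]
      refine ⟨hlt, h6, by simp [hs, h7], ?_⟩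
      rw [hs, List.map_append, runsAt_append]
      refine ⟨by simp, hr.congr (fun q hq => ?_) fun q hq => ?_, ⟨?_, ?_⟩, trivial⟩
      · have : q ≠ m.nat 7 0 + 1 := by omega
        simp [update_apply, this]
      · rw [zero_add, hlen, h5] at hq
        simp [update_apply, hq.ne]
      · simp only [zero_add, hlen]
        simp [update_apply, Seg, h5]
      · simp only [zero_add, hlen]
        simp [update_apply, h5]
    · funext j
      simp only [seqs, exec, update_apply]
      rw [if_neg (by omega), if_neg (by omega), if_neg (by omega), if_neg (by omega)]
  · rw [if_neg h, List.append_nil] at hs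
    simp only [if_neg fun h' => h (hgood.1 h')]
    refine ⟨trivial, ?_, by simp [update_apply, NExp.val], fun a ha => ?_⟩
    · have hup : ∀ a, a ≠ 3 → update m.nat 3 0 (m.nat 3 0 + 1) a = m.nat a := fun a ha => by
        funext j
        simp [update_apply, ha]
      simp only [ListInv, NExp.val]
      simp only [hup 4 (by omega), hup 5 (by omega), hup 6 (by omega), hup 7 (by omega)]
      simp only [update_apply, and_self, if_true, hs]
      exact ⟨hlt, h6, h7, h5, hr⟩
    · funext j
      simp only [update_apply]
      rw [if_neg (by omega)]

end Cells

end FatSubgraph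

end

noncomputable section

namespace FatSubgraph

/-! ### The algorithm -/

section Main

variable {d n k : ℕ} {S : Fin n → Set (Fin d → ℝ)}

/-- The unit of the time bounds. -/
def steps (n : ℕ) : ℕ := (n + 1) * (Nat.clog 2 n + 1)

theorem succ_le_steps (n : ℕ) : n + 1 ≤ steps n := Nat.le_mul_of_pos_right _ (by omega)

/-- Processes one object. -/
def listBody (K : ℕ) : Prog d := .seq widthProg (.seq (cellProg K) appendProg)

theorem loopFree_listBody (K : ℕ) : (listBody K : Prog d).LoopFree :=
  ⟨⟨trivial, loopFree_maxInto _ _⟩, ⟨⟨trivial, loopFree_assignReals _ _ _⟩, trivial,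
    loopFree_assignReals _ _ _⟩, ⟨⟨trivial, trivial, trivial, trivial⟩, trivial⟩, trivial⟩

theorem exec_listBody {K : ℕ} {τ : ℝ} {m : Memory} (hlt : m.nat 3 0 < n)
    (hρ : HasCells S K τ (m.nat 3 0) m.real) (hm : ListInv S K τ m) :
    HasCells S K τ (m.nat 3 0 + 1) (exec S (listBody K) m).real ∧
    ListInv S K τ (exec S (listBody K) m) ∧
    (exec S (listBody K) m).nat 3 0 = m.nat 3 0 + 1 ∧
    (∀ a, a < 3 → (exec S (listBody K) m).nat a = m.nat a) ∧
    ∀ a, a < 3 → (exec S (listBody K) m).real a = m.real a := by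
  simp only [listBody, exec, exec_widthProg]
  set m₁ : Memory := ⟨m.nat, update m.real 3 0 (width S (m.nat 3 0))⟩ with hm₁
  have hr₁ : ∀ a, a ≠ 3 → m₁.real a = m.real a := fun a ha => by
    funext j
    simp [hm₁, update_apply, ha]
  obtain ⟨c1, c2, c3, c4⟩ := exec_cellProg (S := S) K (τ := τ) m₁
    (by simp [hm₁, update_apply]) (by rw [hr₁ 2 (by omega)]; exact hρ.1)
  generalize exec S (cellProg K) m₁ = m₂ at *
  replace c1 : m₂.nat = m.nat := c1
  replace c2 : m₂.real 4 (m.nat 3 0) = side S K (m.nat 3 0) := c2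
  replace c3 : ∀ i : Fin d, m₂.real (5 + i) (m.nat 3 0) = corner S K τ (m.nat 3 0) i := c3
  replace c4 : ∀ a j, (a < 4 ∨ j ≠ m.nat 3 0) → m₂.real a j = m₁.real a j := c4
  have hr₂ : ∀ a, a < 3 → m₂.real a = m.real a := fun a ha => by
    funext j
    rw [c4 a j (Or.inl (by omega)), hr₁ a (by omega)]
  have hcells : HasCells S K τ (m.nat 3 0 + 1) m₂.real := by
    refine ⟨by rw [hr₂ 2 (by omega)]; exact hρ.1, fun o ho => ?_⟩
    by_cases hoo : o = m.nat 3 0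
    · subst hoo
      exact ⟨c2, c3⟩
    · obtain ⟨h1, h2⟩ := hρ.2 o (by omega)
      refine ⟨?_, fun i => ?_⟩
      · rw [c4 _ _ (Or.inr hoo), hr₁ _ (by omega), h1]
      · rw [c4 _ _ (Or.inr hoo), hr₁ _ (by omega), h2]
  have hinv : ListInv S K τ m₂ := by unfold ListInv; rw [c1]; exact hm
  rw [← c1] at hcells hlt
  obtain ⟨a1, a2, a3, a4⟩ := exec_appendProg hlt hcells hinv
  rw [c1] at hcells a3
  exact ⟨by rwa [a1], a2, a3, fun a ha => by rw [a4 a ha, c1], fun a ha => by rw [a1, hr₂ a ha]⟩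

/-- Computes the cells for the translation by `q * W + R`, where `W` and `R` are the real
variables `1` and `0`, and the list of objects to be swept. -/
def listProg (K : ℕ) (q : ℚ) : Prog d :=
  .seq (seqs [.setReal 2 (.lit 0) (.add (.scale q (.var 1)) (.var 0)), .setNat 3 (.lit 0) (.lit 0),
    .setNat 5 (.lit 0) (.lit 0), .setNat 6 (.lit 0) (.lit 0), .setNat 7 (.lit 0) (.lit 0)])
    (.loop (.natLt (.var 3) (.var 2)) (listBody K))

/-- The quantifier order matters: `C` depends only on the program, not on the input. Its part `32`
is a generous bound for the initial assignments. -/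
theorem exists_reach_listProg (d K : ℕ) (q : ℚ) : ∃ C, ∀ (n : ℕ) (S : Fin n → Set (Fin d → ℝ))
    (m : Memory), m.nat 2 0 = n → Reach S (listProg K q) m (C * steps n) fun m' =>
      HasCells S K (q * m.real 1 0 + m.real 0 0) n m'.real ∧
      ListInv S K (q * m.real 1 0 + m.real 0 0) m' ∧ m'.nat 3 0 = n ∧
      (∀ a, a < 3 → m'.nat a = m.nat a) ∧ ∀ a, a < 2 → m'.real a = m.real a := by
  refine ⟨32 + ((BExp.natLt (d := d) (.var 3) (.var 2)).cost + (listBody (d := d) K).bound + 1),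
    fun n S m hn => ?_⟩
  generalize hC : (BExp.natLt (d := d) (.var 3) (.var 2)).cost + (listBody (d := d) K).bound + 1 = C
  set τ := q * m.real 1 0 + m.real 0 0 with hτ
  refine Reach.mono (Reach.seq (T := 32) (T' := C * (n + 1)) (Prog.LoopFree.reach
    (by exact ⟨trivial, trivial, trivial, trivial, trivial, trivial⟩)
    (by simp [seqs, Prog.bound, NExp.cost, RExp.cost])
    (Q := fun m' => HasCells S K τ 0 m'.real ∧ ListInv S K τ m' ∧ m'.nat 3 0 = 0 ∧
      (∀ a, a < 3 → m'.nat a = m.nat a) ∧ ∀ a, a < 2 → m'.real a = m.real a)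
    ?_) fun m₁ h₁ => Reach.mono (Reach.loop_measure (loopFree_listBody K)
      (fun m' => HasCells S K τ (m'.nat 3 0) m'.real ∧ ListInv S K τ m' ∧
        (∀ a, a < 3 → m'.nat a = m.nat a) ∧ ∀ a, a < 2 → m'.real a = m.real a)
      (fun m' => n - m'.nat 3 0) ?_ ?_ (T := C * (n + 1)) ?_) le_rfl ?_) ?_ fun _ h => h
  · simp only [seqs, exec]
    refine ⟨⟨?_, fun o ho => by omega⟩, ?_, ?_, fun a ha => ?_, fun a ha => ?_⟩
    · simp [update_apply, RExp.val, NExp.val, hτ]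
    · simp [ListInv, update_apply, NExp.val, goods, RunsAt]
    · simp [update_apply, NExp.val]
    · funext j
      simp only [update_apply]
      rw [if_neg (by omega), if_neg (by omega), if_neg (by omega), if_neg (by omega)]
    · funext j
      simp only [update_apply]
      rw [if_neg (by omega)]
  · rintro m' ⟨h1, h2, h3, h4⟩ hb
    have hb' : m'.nat 3 0 < n := by
      have := h3 2 (by omega)
      simpa [NExp.val, this, hn] using hb
    obtain ⟨e1, e2, e3, e4, e5⟩ := exec_listBody hb' h1 h2
    refine ⟨⟨by rwa [e3], e2, fun a ha => (e4 a ha).trans (h3 a ha),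
      fun a ha => (e5 a (by omega)).trans (h4 a ha)⟩, ?_⟩
    rw [e3]
    omega
  · obtain ⟨h1, h2, h3, h4, h5⟩ := h₁
    exact ⟨by rwa [h3], h2, h4, h5⟩
  · rw [hC]
    exact Nat.mul_le_mul_left _ (by omega)
  · rintro m' ⟨⟨h1, h2, h3, h4⟩, hb⟩
    have hb' : n ≤ m'.nat 3 0 := by
      have := h3 2 (by omega)
      simpa [NExp.val, this, hn] using hb
    have h5 : m'.nat 3 0 = n := le_antisymm h2.1 hb'
    exact ⟨by rwa [h5] at h1, h2, h5, h3, h4⟩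
  · have h1 := succ_le_steps n
    have h2 := Nat.mul_le_mul_left C h1
    rw [Nat.add_mul]
    omega

/-- Searches for an occurrence of `X` among the objects whose translates fit into their cells. -/
def tryShift (X : SimpleGraph (Fin k)) (K b : ℕ) (q : ℚ) : Prog d :=
  .seq (listProg K q) (.seq (sortProg cellLeB) (sweep X b ancB meetsB))

theorem sweepCtx (hS : ∀ i, IsObject (S i)) {K : ℕ} (hK : 0 < K) {τ : ℝ}
    (hτ : ∀ o i, 0 ≤ lo S o i + τ) {l : List ℕ} (hl : l.Perm (goods S K τ n))
    (hsort : l.Pairwise (LeO S K τ)) :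
    SweepCtx n (Inter S) (MeetsCell S K τ) (AncO S K τ) (LeO S K τ) l where
  lt _ hx := (mem_goods.1 (hl.subset hx)).1
  nodup := hl.nodup_iff.2 (nodup_goods K τ n)
  sorted := hsort
  symm _ _ h := h.symm
  refl _ := inter_self_iff hS
  anc_trans _ _ _ h h' := h.trans (isCell_corner hK hτ _) (isCell_corner hK hτ _).nonneg
    (isCell_corner hK hτ _).nonneg h'
  anc_between _ _ _ h h1 h2 := Anc.of_between (isCell_corner hK hτ _) (isCell_corner hK hτ _)
    (isCell_corner hK hτ _).nonneg h h1 h2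
  anc_of _ _ hx hy h hle := hle.anc hS hK hτ (mem_goods.1 (hl.subset hx)).2
    (mem_goods.1 (hl.subset hy)).2 h
  mc_mono _ _ _ h h' := h'.mono hK hτ h
  mc_of _ _ hy h := h.meetsCell hS hK hτ (mem_goods.1 (hl.subset hy)).2
  mc_lt _ _ h := h.1

/-- All runs start as unmerged singletons, so the linear terms are at most `2n` and the remaining
term is at most `n` times the logarithm. -/
theorem sortPot_le (l : List ℕ) (hl : l.length ≤ n) :
    sortPot l.length (l.map fun x => [x]) [] + 1 ≤ 2 * steps n := by
  have h1 : (l.map fun x => [x]).flatten.length = l.length := by simp [Function.comp_def]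
  have h2 : Nat.clog 2 ((l.length + 1) / 2) ≤ Nat.clog 2 n := Nat.clog_mono_right 2 (by omega)
  have h3 := Nat.mul_le_mul hl h2
  simp only [sortPot, h1, List.length_map, List.length_nil, zero_add, add_zero, steps]
  generalize Nat.clog 2 n = c at *
  generalize l.length * Nat.clog 2 ((l.length + 1) / 2) = e at *
  have h4 : 2 * ((n + 1) * (c + 1)) = 2 * (n * c) + 2 * n + 2 * c + 2 := by ring
  omega

/-- State of the search after some of the shifts. -/
def Searched (X : SimpleGraph (Fin k)) (S : Fin n → Set (Fin d → ℝ)) (R W : ℝ)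
    (V : Set ℕ → Prop) (m : Memory) : Prop :=
  m.nat 2 0 = n ∧ m.real 0 0 = R ∧ m.real 1 0 = W ∧
    (Solved X S m ∨ m.nat 0 0 = 0 ∧ ∀ U, V U → ¬ ∃ f, Occ X (Inter S) U f)

/-- The real cells `0` and `1` hold `-m₀` and `W`, so nonnegative `q` and `W` keep all translated
coordinates nonnegative, as the dyadic arguments require. The sorted list is a permutation of the
good objects, which transfers the sweep's negative answer to them. -/
theorem exists_reach_tryShift (X : SimpleGraph (Fin k)) (d K b c : ℕ) (q : ℚ) (hK : 0 < K)
    (hq : 0 ≤ q) (hb : (4 * K) ^ d * c * k + k < b) :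
    ∃ C, ∀ (n : ℕ) (S : Fin n → Set (Fin d → ℝ)) (m : Memory), (∀ i, IsObject (S i)) →
      IsFat c S → m.nat 2 0 = n → m.nat 0 0 = 0 → 0 ≤ m.real 1 0 →
      (∀ o i, -m.real 0 0 ≤ lo S o i) →
      Reach S (tryShift X K b q) m (C * steps n) (Searched X S (m.real 0 0) (m.real 1 0)
        (· = {x | x < n ∧ Good S K (q * m.real 1 0 + m.real 0 0) x})) := by
  obtain ⟨C₁, hC₁⟩ := exists_reach_listProg d K q
  set B := sortBodyCost (d := d) cellLeB + (sortTest : BExp d).cost + 1 with hB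
  refine ⟨C₁ + ((2 * B + 10) + sweepTime X b (ancB (d := d)) meetsB 0 +
    2 * ((sweepTest (d := d)).cost + (sweepBody X b (ancB (d := d)) meetsB).bound + 1)),
    fun n S m hS hfat hn h0 hW hlo => ?_⟩
  set τ := q * m.real 1 0 + m.real 0 0 with hτdef
  have hτ : ∀ o i, 0 ≤ lo S o i + τ := fun o i => by
    have h1 := hlo o i
    have h2 : (0 : ℝ) ≤ q * m.real 1 0 := mul_nonneg (Rat.cast_nonneg.2 hq) hW
    linarith
  refine Reach.mono (Reach.seq (hC₁ n S m hn) fun m₁ ⟨a1, a2, a3, a4, a5⟩ =>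
    Reach.seq (T := (2 * B + 10) * steps n) (Reach.mono (reach_sortProg (S := S)
      a1.implements_cellLeB (fun x y z h h' => CellLe.trans (isCell_corner hK hτ x).nonneg
        (isCell_corner hK hτ y).nonneg (isCell_corner hK hτ z).nonneg h h')
      (fun x y => CellLe.total (isCell_corner hK hτ x).nonneg (isCell_corner hK hτ y).nonneg _ _)
      m₁ rfl (goods S K τ n) (fun x hx => (mem_goods.1 hx).1) ?_ ?_) ?_ fun _ h => h)
      fun m₂ ⟨b1, ⟨l, b2, b3, b4, b5⟩, b6⟩ => Reach.mono (reach_sweep (X := X) (S := S) (b := b)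
        (sweepCtx hS hK hτ b2 b3)
        (fun v p h h' => exists_common_point hS hfat hK k hb v p h h')
        a1.implements_meetsB a1.implements_ancB (m := m₂) b1 ?_ ?_ b4 b5)
        (T' := (sweepTime X b (ancB (d := d)) meetsB 0 +
          2 * ((sweepTest (d := d)).cost + (sweepBody X b (ancB (d := d)) meetsB).bound + 1)) *
          steps n) ?_ ?_) ?_ fun _ h => h
  · obtain ⟨-, h1, -, -, h2⟩ := a2
    rw [h1]
    rwa [a3] at h2
  · obtain ⟨-, h1, h2, -, -⟩ := a2
    rw [h1, h2, a3, zero_add]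
  · have := Nat.mul_le_mul_left B (sortPot_le _ (length_goods_le (S := S) K τ n))
    have h1 := succ_le_steps n
    show B * _ + 10 ≤ _
    have h2 : (2 * B + 10) * steps n = B * (2 * steps n) + 10 * steps n := by ring
    omega
  · rw [b6 2 (by omega), a4 2 (by omega), hn]
  · rw [b6 0 (by omega), a4 0 (by omega), h0]
  · have h1 : l.length ≤ n := b2.length_eq.trans_le (length_goods_le K τ n)
    have h2 := succ_le_steps n
    unfold sweepTime
    generalize (sweepTest (d := d)).cost + (sweepBody X b (ancB (d := d)) meetsB).bound + 1 = A
    generalize (BExp.natLe (d := d) (.var 0) (.lit 0)).cost + _ + 1 = A'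
    generalize (sweepInit (d := d) (k := k) b).bound = A''
    have h3 := Nat.mul_le_mul_left A (show 2 * l.length + 2 ≤ 2 * steps n by omega)
    have h4 := Nat.le_mul_of_pos_right (A'' + A') (show 0 < steps n by omega)
    have h5 : (A'' + (A * (2 * 0 + 2) + A') + 2 * A) * steps n =
      (A'' + A') * steps n + 2 * (A * (2 * steps n)) := by ring
    omega
  · rintro m₃ ⟨c1, c2, c3⟩
    refine ⟨c2, ?_, ?_, c3.imp_right fun h => ⟨h.1, ?_⟩⟩
    · rw [c1, a5 0 (by omega)]
    · rw [c1, a5 1 (by omega)]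
    · rintro U rfl ⟨f, hf⟩
      exact h.2 ⟨f, hf.mono fun x hx => b2.symm.subset (mem_goods.2 hx)⟩
  · rw [← Nat.add_mul, ← Nat.add_mul, add_assoc (2 * B + 10)]

/-- Tries the first shifts. -/
def tryAll (X : SimpleGraph (Fin k)) (K b : ℕ) : ℕ → Prog d
  | 0 => .skip
  | j + 1 => .seq (tryAll X K b j)
      (.ite (.natLe (.var 0) (.lit 0)) (tryShift X K b (j / K : ℚ)) .skip)

theorem exists_reach_tryAll (X : SimpleGraph (Fin k)) (d K b c : ℕ) (hK : 0 < K)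
    (hb : (4 * K) ^ d * c * k + k < b) (j : ℕ) :
    ∃ C, ∀ (n : ℕ) (S : Fin n → Set (Fin d → ℝ)) (m : Memory), (∀ i, IsObject (S i)) →
      IsFat c S → m.nat 2 0 = n → m.nat 0 0 = 0 → 0 ≤ m.real 1 0 →
      (∀ o i, -m.real 0 0 ≤ lo S o i) →
      Reach S (tryAll X K b j) m (C * steps n) (Searched X S (m.real 0 0) (m.real 1 0)
        fun U => ∃ j' < j, U = {x | x < n ∧ Good S K (shift K (m.real 1 0) (-m.real 0 0) j') x}) := by
  induction j with
  | zero =>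
    refine ⟨1, fun n S m hS hfat hn h0 hW hlo => Prog.LoopFree.reach (p := .skip) trivial ?_ ?_⟩
    · have := succ_le_steps n
      simp only [Prog.bound]
      omega
    · refine ⟨hn, rfl, rfl, Or.inr ⟨h0, ?_⟩⟩
      rintro U ⟨j', hj', -⟩
      omega
  | succ j ih =>
    obtain ⟨C, hC⟩ := ih
    obtain ⟨C', hC'⟩ := exists_reach_tryShift X d K b c (j / K : ℚ) hK (by positivity) hb
    refine ⟨C + ((BExp.natLe (d := d) (.var 0) (.lit 0)).cost + (C' + 1) + 1),
      fun n S m hS hfat hn h0 hW hlo => ?_⟩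
    have h1 := succ_le_steps n
    generalize hA : (BExp.natLe (d := d) (.var 0) (.lit 0)).cost = A
    refine Reach.mono (Reach.seq (hC n S m hS hfat hn h0 hW hlo) fun m₁ ⟨a1, a2, a3, a4⟩ =>
      Reach.ite (T := (C' + 1) * steps n) (fun hz => ?_) fun hz => ?_)
      (T' := (C + (A + (C' + 1) + 1)) * steps n) ?_ fun _ h => h
    · have hz' : m₁.nat 0 0 = 0 := by simpa [BExp.Holds, NExp.val] using hz
      have a5 := (a4.resolve_left fun h => by have := h.1; omega).2
      refine Reach.mono (hC' n S m₁ hS hfat a1 hz' (a3 ▸ hW) (a2 ▸ hlo))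
        (Nat.mul_le_mul_right _ (by omega)) ?_
      rintro m₂ ⟨b1, b2, b3, b4⟩
      refine ⟨b1, b2.trans a2, b3.trans a3, b4.imp_right fun h => ⟨h.1, ?_⟩⟩
      rintro U ⟨j', hj', hU⟩
      rcases Nat.lt_succ_iff_lt_or_eq.1 hj' with hj' | rfl
      · exact a5 U ⟨j', hj', hU⟩
      · refine h.2 U (hU.trans ?_)
        rw [a2, a3, show (((j' / K : ℚ) : ℚ) : ℝ) * m.real 1 0 + m.real 0 0 =
          shift K (m.real 1 0) (-m.real 0 0) j' by unfold shift; push_cast; ring]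
    · have hz' : m₁.nat 0 0 ≠ 0 := by simpa [BExp.Holds, NExp.val] using hz
      refine Prog.LoopFree.reach (p := .skip) trivial ?_
        ⟨a1, a2, a3, Or.inl (a4.resolve_right fun h => hz' h.1)⟩
      have := Nat.le_mul_of_pos_left (steps n) (show 0 < C' + 1 by omega)
      simp only [Prog.bound]
      omega
    · rw [hA]
      have := Nat.le_mul_of_pos_right (A + 1) (show 0 < steps n by omega)
      have e : (C + (A + (C' + 1) + 1)) * steps n =
        C * steps n + (C' + 1) * steps n + (A + 1) * steps n := by ring
      omega

/-! ### Preprocessing: the extent of the input and a power of two above it. -/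

/-- Updates the extent of the input by one object. -/
def scanBody : Prog d :=
  .seq (maxInto 0 fun i => .sub (.lit 0) (.lower (.var 3) i))
    (.seq (maxInto 1 fun i => .upper (.var 3) i) (.setNat 3 (.lit 0) (.add (.var 3) (.lit 1))))

theorem loopFree_scanBody : (scanBody : Prog d).LoopFree :=
  ⟨loopFree_maxInto _ _, loopFree_maxInto _ _, trivial⟩

/-- Computes the extent of the input. -/
def scanProg : Prog d :=
  .seq (.seq (.setNat 2 (.lit 0) (.var 0)) (.setNat 0 (.lit 0) (.lit 0)))
    (.seq (.loop (.natLt (.var 3) (.var 2)) scanBody)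
      (.setReal 1 (.lit 0) (.dyadicSide (.lit 0) (.add (.add (.var 1) (.var 0)) (.lit 1)))))

theorem exec_scanBody (m : Memory) : exec S scanBody m =
    ⟨update m.nat 3 0 (m.nat 3 0 + 1), update (update m.real 0 0
      ((List.finRange d).foldl (fun L i => max L (-lo S (m.nat 3 0) i)) (m.real 0 0))) 1 0
      ((List.finRange d).foldl (fun L i => max L (up S (m.nat 3 0) i)) (m.real 1 0))⟩ := by
  simp only [scanBody, exec]
  rw [exec_maxInto _ _ m fun x i => rfl, exec_maxInto _ _ _ fun x i => rfl]
  have h1 : ∀ i : Fin d, (RExp.sub (.lit 0) (.lower (.var 3) i)).val S m =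
      -lo S (m.nat 3 0) i := fun i => by
    show ((0 : ℚ) : ℝ) - lo S (m.nat 3 0) i = _
    simp
  simp only [h1]
  congr 2

/-- Both maxima start from `0`, so the bounds also hold for nonexistent objects, whose extents read
as `0`. The number `n` is moved to array `2`, which frees cell `0` of array `0` for the answer flag.
-/
theorem exists_reach_scanProg (d : ℕ) : ∃ C, ∀ (n : ℕ) (S : Fin n → Set (Fin d → ℝ)),
    Reach S scanProg (initial n) (C * steps n) fun m => m.nat 2 0 = n ∧ m.nat 0 0 = 0 ∧
      ∃ M : ℤ, m.real 1 0 = 2 ^ M ∧ (∀ o i, -m.real 0 0 ≤ lo S o i) ∧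
        ∀ o i, up S o i + m.real 0 0 < 2 ^ M := by
  refine ⟨10 + ((BExp.natLt (d := d) (.var 3) (.var 2)).cost + (scanBody (d := d)).bound + 1) + 20,
    fun n S => ?_⟩
  generalize hC : (BExp.natLt (d := d) (.var 3) (.var 2)).cost + (scanBody (d := d)).bound + 1 = C
  refine Reach.mono (Reach.seq (T := 10) (Prog.LoopFree.reach (by exact ⟨trivial, trivial⟩)
    (by simp [Prog.bound, NExp.cost]) (Q := fun m => m = ⟨update (update (initial n).nat 2 0 n) 0 0 0,
      (initial n).real⟩) ?_) ?_ (T' := C * (n + 1) + 20)) ?_ fun _ h => h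
  · simp [exec, NExp.val, initial, update_apply]
  · rintro _ rfl
    refine Reach.seq (Reach.loop_measure loopFree_scanBody
      (fun m => m.nat 2 0 = n ∧ m.nat 0 0 = 0 ∧ m.nat 3 0 ≤ n ∧ 0 ≤ m.real 0 0 ∧ 0 ≤ m.real 1 0 ∧
        ∀ o < m.nat 3 0, ∀ i, -lo S o i ≤ m.real 0 0 ∧ up S o i ≤ m.real 1 0)
      (fun m => n - m.nat 3 0) ?_ ?_ (T := C * (n + 1)) ?_) ?_
    · rintro m ⟨h1, h2, h3, h4, h5, h6⟩ hb
      have hb' : m.nat 3 0 < n := by simpa [NExp.val, h1] using hb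
      rw [exec_scanBody]
      obtain ⟨f1, f2, -⟩ := foldl_max_spec (fun i => -lo S (m.nat 3 0) i) (List.finRange d)
        (m.real 0 0)
      obtain ⟨g1, g2, -⟩ := foldl_max_spec (fun i => up S (m.nat 3 0) i) (List.finRange d)
        (m.real 1 0)
      generalize List.foldl (fun L i => max L (-lo S (m.nat 3 0) i)) _ _ = F at *
      generalize List.foldl (fun L i => max L (up S (m.nat 3 0) i)) _ _ = G at *
      simp only [update_apply]
      simp only [reduceCtorEq, and_self, and_true, if_true, if_false, Nat.reduceEqDiff, zero_ne_one]
      refine ⟨⟨h1, h2, hb', h4.trans f1, h5.trans g1, fun o ho i => ?_⟩, by omega⟩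
      by_cases hoo : o = m.nat 3 0
      · subst hoo
        exact ⟨f2 i (List.mem_finRange i), g2 i (List.mem_finRange i)⟩
      · obtain ⟨e1, e2⟩ := h6 o (by omega) i
        exact ⟨e1.trans f1, e2.trans g1⟩
    · simp [update_apply, initial]
    · rw [hC]
      exact Nat.mul_le_mul_left _ (by omega)
    · rintro m ⟨⟨h1, h2, h3, h4, h5, h6⟩, hb⟩
      have hb' : n ≤ m.nat 3 0 := by simpa [NExp.val, h1] using hb
      refine Prog.LoopFree.reach (by exact trivial) (by simp [Prog.bound, NExp.cost, RExp.cost]) ?_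
      -- Adding `1` keeps the argument positive even for an extent of zero, so that `dyadicSide 0`
      -- yields a power of two strictly above the extent.
      obtain ⟨M, hM, hM', -⟩ := dyadicSide_zero_left
        (show 0 < m.real 1 0 + m.real 0 0 + 1 by linarith)
      simp only [exec, update_apply, RExp.val, NExp.val]
      simp only [zero_ne_one, false_and, if_false, and_self, if_true, Rat.cast_zero, Rat.cast_one]
      refine ⟨h1, h2, M, hM, fun o i => ?_, fun o i => ?_⟩
      · by_cases ho : o < n
        · linarith [(h6 o (by omega) i).1]
        · rw [lo, dif_neg ho]; linarith
      · by_cases ho : o < n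
        · linarith [(h6 o (by omega) i).2]
        · rw [up, dif_neg ho]; linarith
  · have h1 := succ_le_steps n
    have h2 := Nat.mul_le_mul_left C h1
    have e : (10 + C + 20) * steps n = C * steps n + 30 * steps n := by ring
    omega

/-! ### From occurrences to graph copies, the asymptotic bound, and the final assembly. -/

theorem Solved.isContained {X : SimpleGraph (Fin k)} {m : Memory} (h : Solved X S m) :
    Answers X (intersectionGraph S) m := by
  obtain ⟨h0, f, ⟨h1, h2, h3⟩, h4⟩ := h
  have hcopy : ∃ g : SimpleGraph.Copy X (intersectionGraph S), ∀ v, (g v : ℕ) = f v := by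
    refine ⟨⟨⟨fun v => ⟨f v, h2 v⟩, fun {v w} ha => ⟨?_, ?_⟩⟩, ?_⟩, fun v => rfl⟩
    · intro hvw
      exact ha.ne (h1 (by simpa using hvw))
    · obtain ⟨_, _, h⟩ := h3 v w ha
      exact h
    · intro v w hvw
      exact h1 (congrArg Fin.val hvw)
  obtain ⟨g, hg⟩ := hcopy
  exact Or.inl ⟨⟨g⟩, h0, g, fun v => (h4 v).trans (hg v).symm⟩

theorem exists_occ_of_copy {X : SimpleGraph (Fin k)}
    (g : SimpleGraph.Copy X (intersectionGraph S)) {V : Set ℕ} (hV : ∀ v, (g v : ℕ) ∈ V) :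
    Occ X (Inter S) V fun v => g v :=
  ⟨fun _ _ h => g.injective (Fin.ext h), hV, fun v w ha =>
    ⟨(g v).2, (g w).2, (g.toHom.map_adj ha).2⟩⟩

theorem isBigO_steps (C : ℕ) : Asymptotics.IsBigO Filter.atTop (fun n => ((C * steps n : ℕ) : ℝ))
    (fun n : ℕ => (n : ℝ) * Real.log n) := by
  have hlog2 : 0 < Real.log 2 := Real.log_pos one_lt_two
  -- For `n ≥ 2` one has `n + 1 ≤ 2n` and `clog n + 1 ≤ 3 log n / log 2`, which gives the factor `6
  -- / log 2`.
  refine Asymptotics.IsBigO.of_bound (C * (6 / Real.log 2)) ?_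
  filter_upwards [Filter.eventually_ge_atTop 2] with n hn
  have hn' : (2 : ℝ) ≤ n := by exact_mod_cast hn
  have hlog : Real.log 2 ≤ Real.log n := Real.log_le_log two_pos hn'
  have h1 : (Nat.clog 2 n : ℝ) ≤ Real.log n / Real.log 2 + 1 := by
    have h2 : Nat.clog 2 n ≤ Nat.log 2 n + 1 := by
      refine Nat.clog_le_of_le_pow ?_
      exact (Nat.lt_pow_succ_log_self one_lt_two n).le
    have h3 := Real.natLog_le_logb n 2
    have h4 : (Nat.clog 2 n : ℝ) ≤ Nat.log 2 n + 1 := by exact_mod_cast h2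
    rw [Real.logb] at h3
    push_cast at h3
    linarith
  have h2 : 1 ≤ Real.log n / Real.log 2 := (one_le_div hlog2).2 hlog
  have h3 : (steps n : ℝ) ≤ (2 * n) * (3 * (Real.log n / Real.log 2)) := by
    unfold steps
    push_cast
    exact mul_le_mul (by linarith) (by linarith) (by positivity) (by positivity)
  rw [Real.norm_of_nonneg (Nat.cast_nonneg _), Real.norm_of_nonneg (by positivity)]
  push_cast
  calc (C : ℝ) * steps n ≤ C * ((2 * n) * (3 * (Real.log n / Real.log 2))) :=
        mul_le_mul_of_nonneg_left h3 (Nat.cast_nonneg _)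
    _ = C * (6 / Real.log 2) * (n * Real.log n) := by ring

end Main

end FatSubgraph

end

theorem mainTheorem1 (d k c : ℕ) (X : SimpleGraph (Fin k)) :
    ∃ (p : FatSubgraph.Prog d) (T : ℕ → ℕ),
      Asymptotics.IsBigO Filter.atTop (fun n => (T n : ℝ)) (fun n : ℕ => (n : ℝ) * Real.log n) ∧
      ∀ (n : ℕ) (S : Fin n → Set (Fin d → ℝ)),
        (∀ i, FatSubgraph.IsObject (S i)) → FatSubgraph.IsFat c S →
        ∃ (t : ℕ) (m : FatSubgraph.Memory), t ≤ T n ∧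
          FatSubgraph.Runs S p (FatSubgraph.initial n) t m ∧
          FatSubgraph.Answers X (FatSubgraph.intersectionGraph S) m := by
  open FatSubgraph in
  set K := 2 * (k * d) + 1 with hK
  set b := (4 * K) ^ d * c * k + k + 1 with hb
  obtain ⟨C₁, hC₁⟩ := exists_reach_scanProg d
  obtain ⟨C₂, hC₂⟩ := exists_reach_tryAll X d K b c (by omega) (by omega) K
  refine ⟨.seq scanProg (tryAll X K b K), fun n => (C₁ + C₂) * steps n,
    isBigO_steps _, fun n S hS hfat => ?_⟩
  suffices h : Reach S (.seq scanProg (tryAll X K b K)) (initial n) ((C₁ + C₂) * steps n)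
      (Answers X (intersectionGraph S)) from h
  refine Reach.mono (Reach.seq (hC₁ n S) fun m₁ ⟨a1, a2, M, a3, a4, a5⟩ =>
    Reach.mono (hC₂ n S m₁ hS hfat a1 a2 (by rw [a3]; positivity) a4) le_rfl ?_)
    (le_of_eq (Nat.add_mul _ _ _).symm) fun _ h => h
  rintro m₂ ⟨-, -, -, h | ⟨h0, h⟩⟩
  · exact h.isContained
  · refine Or.inr ⟨?_, h0⟩
    rintro ⟨g⟩
    -- A hypothetical copy is good for one of the `K` translations, and the search with that
    -- translation has already excluded it.
    obtain ⟨j, hj, hgood⟩ := exists_shift_good hS (m₀ := -m₁.real 0 0) (M := M) a4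
      (fun o i => by rw [sub_neg_eq_add]; exact a5 o i) fun v => (g v : ℕ)
    refine h _ ⟨j, hj, rfl⟩ ⟨_, exists_occ_of_copy g fun v => ⟨(g v).2, ?_⟩⟩
    rw [a3]
    exact hgood v
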